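/- **Setting (the logical framework CompLF).** Fix a set $\mathcal C$ of constants, a set $\mathcal S$ of sorts and an injection $\|\cdot\|:\mathcal C\to\mathcal S$. Everything is up to renaming of bound variables and weakening is silent. *Raw syntax.* Scopes are $\gamma::=()\mid\gamma,x::\delta\to s$; a pre-signature is a list of entries $c::\delta\to s$ or $c::\delta\to\square$. Over a pre-signature, terms $\mathsf{Tm}\,\gamma\,s$ are $h(\mathbf t)$ with $h::\delta\to s$ a constant or a variable of $\gamma$ and $\mathbf t\in\mathsf{Sp}\,\gamma\,\delta$; spines are $\varepsilon\in\mathsf{Sp}\,\gamma\,()$ and $(\mathbf t,\vec x_{\gamma'}.t)\in\mathsf{Sp}\,\gamma\,(\delta,x::\gamma'\to s)$ with $\mathbf t\in\mathsf{Sp}\,\gamma\,\delta$, $t\in\mathsf{Tm}\,\gamma.\gamma'\,s$; types $\mathsf{Ty}\,\gamma$ are $c(\mathbf t)$ with $c::\delta\to\square$, $\mathbf t\in\mathsf{Sp}\,\gamma\,\delta$, with erasure $|c(\mathbf t)|=\|c\|$. Contexts $\mathsf{Ctx}\,\gamma$ are $()$ and $\Gamma,x:\Delta\to T$ with $\Gamma\in\mathsf{Ctx}\,\gamma$,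 $\Delta\in\mathsf{Ctx}\,\gamma.|\Gamma|$, $T\in\mathsf{Ty}\,\gamma.|\Gamma|.|\Delta|$, where $|\Gamma,x:\Delta\to T|=|\Gamma|,x::|\Delta|\to|T|$. $e[\mathbf u]=e[\mathbf u/\gamma]$ is hereditary substitution: $x(\mathbf v)[\mathbf u]=\mathbf u_x[\mathbf v[\mathbf u]/\gamma_x]$ for $x::\gamma_x\to s$ in $\gamma$, and it commutes with all other constructors. The identity spine is $\mathrm{id}_{()}=\varepsilon$, $\mathrm{id}_{\gamma,x::\delta\to s}=\mathrm{id}_\gamma,\vec y_\delta.x(\mathrm{id}_\delta)$. *Theories.* A signature $\Sigma$ is a list of declarations $c:\Delta_\nu\to T$ or $c:\Delta_\nu\to\square$, where $\Delta$ is a closed context and $T\in\mathsf{Ty}\,|\Delta|$ over the pre-signature $|\Sigma'|$ of the preceding declarations $\Sigma'$, each constant is declared at most once, and $\nu$ marks some entries of $\Delta$ as erased; the corresponding entry of $|\Sigma|$ is $c::|\Delta|_\nu\to|T|$ (resp. $\square$), where $|\Delta|_\nu$ omits the erased entries, and $\nu\cdot\mathbf t$ drops the erased arguments of $\mathbf t$.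 A rewrite system $\mathcal R$ is a set of rules $\gamma\Vdash l\longmapsto r::s$ with $l,r\in\mathsf{Tm}\,\gamma\,s$, $l$ a Miller pattern and $\mathrm{fv}(r)\subseteq\mathrm{fv}(l)$; $\longrightarrow$ is the closure of the instances $l[\mathbf v]\longrightarrow r[\mathbf v]$ under all constructors (on well-scoped expressions of one scope and class), $\longrightarrow^*$ its reflexive-transitive closure and $\equiv$ the generated equivalence. A theory is $\mathbb T=(\Sigma,\mathcal R)$ with $\mathcal R$ over $|\Sigma|$; $\mathbb T_{<c}$ keeps the declarations before $c$ and the rules over these. The typing judgments $\Gamma\vdash$, $\Gamma\vdash T$, $\Gamma\vdash t:T$, $\Gamma\vdash\mathbf t:\Delta$ (on well-scoped data, $\Gamma\in\mathsf{Ctx}\,()$) are generated by: - $()\vdash$; if $\Gamma.\Gamma'\vdash T$ then $\Gamma,x:\Gamma'\to T\vdash$; - if $\Gamma\vdash\mathbf t:\Delta$, then $\Gamma\vdash c(\nu\cdot\mathbf t)$ for $c:\Delta_\nu\to\square\in\Sigma$, $\Gamma\vdash c(\nu\cdot\mathbf t):T[\mathbf t]$ for $c:\Delta_\nu\to T\in\Sigma$,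 and $\Gamma\vdash x(\mathbf t):T[\mathbf t]$ for $x:\Delta\to T\in\Gamma$; - if $\Gamma\vdash t:T$, $T\equiv U$ and $\Gamma\vdash U$ then $\Gamma\vdash t:U$; - if $\Gamma\vdash$ then $\Gamma\vdash\varepsilon:()$; if $\Gamma\vdash\mathbf t:\Delta$ and $\Gamma.\Gamma'[\mathbf t]\vdash t:T[\mathbf t]$ then $\Gamma\vdash(\mathbf t,\vec x_{\Gamma'}.t):(\Delta,x:\Gamma'\to T)$. $\mathbb T$ satisfies *subject reduction* if $\Gamma\vdash t:T$ and $t\longrightarrow t'$ imply $\Gamma\vdash t':T$. *Patterns and matching.* Patterns over flexible variables $\gamma$ and rigid variables $\gamma_0$ (sets $\mathsf{Tm}^{\mathsf P}\gamma\,\gamma_0\,s$, $\mathsf{Sp}^{\mathsf P}\gamma\,\gamma_0\,\delta$, $\mathsf{Ty}^{\mathsf P}\gamma\,\gamma_0$) are generated by: $c(\mathbf t)$ for a constant $c$ and a pattern spine $\mathbf t$ over $\gamma,\gamma_0$; $x(\mathrm{id}_{\gamma_0})$ over $(x::\gamma_0\to s),\gamma_0$; $\varepsilon$ over $(),\gamma_0$;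 and $(\mathbf t,\vec x_{\gamma_x}.t)$ over $\gamma_1.\gamma_{12}.\gamma_2,\gamma_0$ for $\mathbf t$ over $\gamma_1.\gamma_{12},\gamma_0$ and $t$ over $\gamma_{12}.\gamma_2,\gamma_0.\gamma_x$. A pattern is *rigid* if no constant $c$ appearing in it is the head of the left-hand side of a rewrite rule or has a declaration with erased arguments. A strategy $\mathfrak S$ is a functional relation $\longrightarrow_{\mathfrak S}\ \subseteq\ \longrightarrow^*$ on expressions with the same normal forms as $\longrightarrow$; $\mathrm{nf}_{\mathfrak S}(e)$ is the normal form, if any, reached from $e$. Matching $t\prec u\leadsto\mathbf v$ ($t$ a pattern over $\gamma,\gamma_0$, $u$ in scope $\gamma_f.\gamma_0$, $\mathbf v\in\mathsf{Sp}\,\gamma_f\,\gamma$) is generated by: - for terms, $c(\mathbf t)\prec u\leadsto\mathbf v$ if $u\longrightarrow^*_{\mathfrak S}c(\mathbf u)$ and $\mathbf t\prec\mathbf u\leadsto\mathbf v$; and $x(\mathrm{id}_{\gamma_0})\prec u\leadsto\vec y_{\gamma_0}.u$; - $\varepsilon\prec\varepsilon\leadsto\varepsilon$; and $(\mathbf t,\vec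 x.t)\prec(\mathbf u,\vec x.u)\leadsto\mathbf v_1,\mathbf v_{12},\mathbf v_2$ if $\mathbf t\prec\mathbf u\leadsto\mathbf v_1,\mathbf v'_{12}$ and $t\prec u\leadsto\mathbf v''_{12},\mathbf v_2$ and $\mathrm{nf}_{\mathfrak S}(\mathbf v'_{12})=\mathrm{nf}_{\mathfrak S}(\mathbf v''_{12})=\mathbf v_{12}$; - for types, $c(\mathbf t)\prec c(\mathbf u)\leadsto\mathbf v$ if $\mathbf t\prec\mathbf u\leadsto\mathbf v$. *Moded theories.* A moded theory $\mathbb T^{+-}=(\Sigma^{+-},\mathcal R)$ has a list $\Sigma^{+-}$ of declarations (of distinct constants, each well-scoped over the preceding ones) of the four forms below; forgetting modes and marking exactly the entries in $\{\cdot\}$ as erased gives a signature $\Sigma$, and $\mathcal R$ is a rewrite system over $|\Sigma|$. Put $\mathbb T=(\Sigma,\mathcal R)$; the judgments $\vdash$ below are those of $\mathbb T$. $\mathbb T^{+-}$ is *well-typed* if each declaration satisfies the stated condition in $\mathbb T_{<c}$: 1. $c:\Delta^-\to\square$, with $\Delta\vdash$; 2. $c^+:\Delta^-\to T$, with $\Delta\vdash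 T$; 3. $c^-:\{\Delta'\}\Delta^-\to T$, where $T\in\mathsf{Ty}^{\mathsf P}|\Delta'|\,()$, with $\Delta'.\Delta\vdash$ and $\Delta'\vdash T$ and $T$ rigid (in $\mathbb T$); 4. $c^+:\Delta_1^-\{\Delta'\}(x:\Gamma_x\to T)^+\Delta_2^-\to U$, where $\Delta',\Gamma_x\in\mathsf{Ctx}\,|\Delta_1|$ and $T\in\mathsf{Ty}^{\mathsf P}|\Delta'|\,|\Gamma_x|$, with $\Delta_1.\Delta',x:\Gamma_x\to T,\Delta_2\vdash U$ and $\Delta_1.\Gamma_x\vdash$ and $T$ rigid (in $\mathbb T$). *The algorithm.* The judgments $\Gamma\vdash t\Rightarrow T$, $\Gamma\vdash t\Leftarrow T$, $\Gamma\vdash T\Leftrightarrow\square$, $\Gamma\vdash\mathbf t\Leftarrow\Delta$ (on well-scoped data) are generated by: - $\Gamma\vdash x(\mathbf t)\Rightarrow T[\mathbf t]$ if $x:\Delta\to T\in\Gamma$ and $\Gamma\vdash\mathbf t\Leftarrow\Delta$; $\ \Gamma\vdash c(\mathbf t)\Rightarrow T[\mathbf t]$ if $c^+:\Delta^-\to T\in\Sigma^{+-}$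 and $\Gamma\vdash\mathbf t\Leftarrow\Delta$; - $\Gamma\vdash c(\mathbf t,\vec x_{\Gamma_x}.t,\mathbf u)\Rightarrow U[\mathbf t,\mathbf v,\vec x_{\Gamma_x}.t,\mathbf u]$ if $c$ is declared as in 4, $\Gamma\vdash\mathbf t\Leftarrow\Delta_1$, $\ \Gamma.\Gamma_x[\mathbf t]\vdash t\Rightarrow V$, $\ T\prec V\leadsto\mathbf v$ and $\Gamma\vdash\mathbf u\Leftarrow\Delta_2[\mathbf t,\mathbf v,\vec x_{\Gamma_x}.t]$; - $\Gamma\vdash t\Leftarrow T$ if $t$ is not headed by a constant declared as in 3, $\Gamma\vdash t\Rightarrow U$ and $\mathrm{nf}_{\mathfrak S}(T)=\mathrm{nf}_{\mathfrak S}(U)$ (both existing); - $\Gamma\vdash c(\mathbf t)\Leftarrow V$ if $c$ is declared as in 3, $T\prec V\leadsto\mathbf v$ and $\Gamma\vdash\mathbf t\Leftarrow\Delta[\mathbf v]$; - $\Gamma\vdash c(\mathbf t)\Leftrightarrow\square$ if $c:\Delta^-\to\square\in\Sigma^{+-}$ and $\Gamma\vdash\mathbf t\Leftarrow\Delta$;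 - $\Gamma\vdash\varepsilon\Leftarrow()$; and $\Gamma\vdash(\mathbf t,\vec x_{\Gamma_x}.t)\Leftarrow(\Delta,x:\Gamma_x\to T)$ if $\Gamma\vdash\mathbf t\Leftarrow\Delta$ and $\Gamma.\Gamma_x[\mathbf t]\vdash t\Leftarrow T[\mathbf t]$. **Theorem (soundness of the bidirectional typing algorithm).** Let $\mathbb T^{+-}$ be a well-typed moded theory whose underlying theory $\mathbb T$ satisfies subject reduction, let $\mathfrak S$ be any strategy for $\mathcal R$, and let $\Gamma\in\mathsf{Ctx}\,()$ with $\Gamma\vdash$. Then: - if $\Gamma\vdash t\Rightarrow A$ then $\Gamma\vdash t:A$; - if $\Gamma\vdash t\Leftarrow A$ and $\Gamma\vdash A$ then $\Gamma\vdash t:A$; - if $\Gamma\vdash A\Leftrightarrow\square$ then $\Gamma\vdash A$; - if $\Gamma\vdash\mathbf t\Leftarrow\Delta$ and $\Gamma.\Delta\vdash$ then $\Gamma\vdash\mathbf t:\Delta$. -/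

import Mathlib

/-!
The logical framework CompLF, in de Bruijn style.  Raw expressions are unscoped; predicates single
out the well-scoped and well-sorted ones.  A variable is a natural number counting entries of the
scope from the right.  Weakening a scope on the left does not change an expression, any other
weakening is written explicitly.
-/

namespace CompLF

universe u v

variable {C : Type u} {S : Type v}

/-! ### Scopes and pre-signatures -/

/-- Scopes `γ ::= () | γ, x :: δ → s`, where `s` ranges over the sorts `S`. -/
inductive Scope (S : Type v) : Type v
  | nil : Scope S
  | snoc (γ δ : Scope S) (s : S) : Scope S

namespace Scope

/-- Number of variables of a scope. -/
def length : Scope S → ℕ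
  | nil => 0
  | snoc γ _ _ => γ.length + 1

/-- Concatenation `γ.δ`. -/
def append (γ : Scope S) : Scope S → Scope S
  | nil => γ
  | snoc δ δ' s => snoc (append γ δ) δ' s

/-- The arity `δ → s` of the `i`-th variable, counted from the right. -/
def get? : Scope S → ℕ → Option (Scope S × S)
  | nil, _ => none
  | snoc _ δ s, 0 => some (δ, s)
  | snoc γ _ _, i + 1 => γ.get? i

theorem sizeOf_lt_of_get? {γ : Scope S} {i : ℕ} {δ : Scope S} {s : S}
    (h : γ.get? i = some (δ, s)) : sizeOf δ < sizeOf γ := by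
  induction γ generalizing i with
  | nil => simp [get?] at h
  | snoc γ δ' s' ih _ =>
    cases i with
    | zero =>
      simp only [get?, Option.some.injEq, Prod.mk.injEq] at h
      obtain ⟨rfl, rfl⟩ := h
      simp only [snoc.sizeOf_spec]
      omega
    | succ i =>
      have h1 := ih (i := i) (by simpa [get?] using h)
      simp only [snoc.sizeOf_spec]
      omega

end Scope

/-- Pre-signatures: `(c, δ, some s)` is the entry `c :: δ → s` and `(c, δ, none)` is the entry
`c :: δ → □`. -/
abbrev PreSig (C : Type u) (S : Type v) := List (C × Scope S × Option S)

/-! ### Raw expressions -/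

/-- Raw expressions.  Terms are `x(t)` (`var`) and `c(t)` (`const`) for a spine `t`; spines are `ε`
(`nil`) and `t, x₁…xₙ. u` (`snoc t n u`, binding `n` variables in `u`).  A type `c(t)` is also
written `const c t`. -/
inductive Expr (C : Type u) : Type u
  | var (i : ℕ) (ts : Expr C) : Expr C
  | const (c : C) (ts : Expr C) : Expr C
  | nil : Expr C
  | snoc (ts : Expr C) (n : ℕ) (t : Expr C) : Expr C

/-- Extension of a renaming under `n` binders. -/
def liftRen (n : ℕ) (ρ : ℕ → ℕ) (i : ℕ) : ℕ := if i < n then i else ρ (i - n) + n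

/-- The renaming that inserts `n` new variables to the left of the `k` rightmost ones. -/
def wkRen (n k i : ℕ) : ℕ := if i < k then i else i + n

namespace Expr

/-- Renaming of the free variables. -/
def ren (ρ : ℕ → ℕ) : Expr C → Expr C
  | var i ts => var (ρ i) (ts.ren ρ)
  | const c ts => const c (ts.ren ρ)
  | nil => nil
  | snoc ts n t => snoc (ts.ren ρ) n (t.ren (liftRen n ρ))

/-- Weakening from `γ₁.γ₃` to `γ₁.γ₂.γ₃`, where `n` is the length of `γ₂` and `k` that of `γ₃`. -/
def wk (n k : ℕ) (e : Expr C) : Expr C := e.ren (wkRen n k)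

/-- Concatenation of spines. -/
def append (ts : Expr C) : Expr C → Expr C
  | snoc us n u => snoc (append ts us) n u
  | _ => ts

/-- The `i`-th argument of a spine, counted from the right. -/
def arg? : Expr C → ℕ → Option (Expr C)
  | snoc _ _ t, 0 => some t
  | snoc ts _ _, i + 1 => ts.arg? i
  | _, _ => none

/-- Hereditary substitution `e[us/γ]`.  If `e` lives in `γ₁.γ.γ₃`, `k` is the length of `γ₃`, and
`us` is a spine in scope `γ₁` for `γ`, then the result lives in `γ₁.γ₃`:
* `x(ts)[us/γ] = us_x [ts[us/γ] / δ]` if `x :: δ → s` is in `γ` (with `us_x` weakened from `γ₁.δ`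
  to `γ₁.γ₃.δ`);
* `h(ts)[us/γ] = h(ts[us/γ])` for all other heads.

The case of a missing argument does not occur for a spine for `γ`. -/
def subst (γ : Scope S) (us : Expr C) (k : ℕ) : Expr C → Expr C
  | var i ts =>
    if i < k then var i (subst γ us k ts)
    else
      match _h : γ.get? (i - k) with
      | none => var (i - γ.length) (subst γ us k ts)
      | some (δ, _) =>
        match us.arg? (i - k) with
        | none => nil
        | some u => subst δ (subst γ us k ts) 0 (u.wk k δ.length)
  | const c ts => const c (subst γ us k ts)
  | nil => nil
  | snoc ts n t => snoc (subst γ us k ts) n (subst γ us (k + n) t)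
termination_by e => (sizeOf γ, sizeOf e)
decreasing_by
  all_goals first
    | exact Prod.Lex.left _ _ (Scope.sizeOf_lt_of_get? ‹_›)
    | (apply Prod.Lex.right; simp only [var.sizeOf_spec, const.sizeOf_spec, snoc.sizeOf_spec]; omega)

/-- The variable `i` occurs free in the expression. -/
def Free (i : ℕ) : Expr C → Prop
  | var j ts => j = i ∨ ts.Free i
  | const _ ts => ts.Free i
  | nil => False
  | snoc ts n t => ts.Free i ∨ t.Free (i + n)

/-- The constant `c` appears in the expression. -/
def Occurs (c : C) : Expr C → Prop
  | var _ ts => ts.Occurs c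
  | const d ts => d = c ∨ ts.Occurs c
  | nil => False
  | snoc ts _ t => ts.Occurs c ∨ t.Occurs c

end Expr

/-- The identity spine: `id_() = ε` and `id_{γ, x :: δ → s} = id_γ, y_δ. x(id_δ)`. -/
def idSp : Scope S → Expr C
  | .nil => .nil
  | .snoc γ δ _ => .snoc ((idSp γ).wk 1 0) δ.length (.var δ.length (idSp δ))

/-- The syntactic classes of expressions in a given scope: terms of sort `s`, spines for `δ`, and
types. -/
inductive Kind (S : Type v) : Type v
  | tm (s : S) : Kind S
  | sp (δ : Scope S) : Kind S
  | ty : Kind S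

/-- `IsExpr ς γ K e` : the expression `e` is a member of `Tm γ s`, `Sp γ δ` or `Ty γ` over the
pre-signature `ς`, according to whether `K` is `tm s`, `sp δ` or `ty`. -/
inductive IsExpr (ς : PreSig C S) : Scope S → Kind S → Expr C → Prop
  | var {γ δ : Scope S} {s : S} {i : ℕ} {ts : Expr C} :
      γ.get? i = some (δ, s) → IsExpr ς γ (.sp δ) ts → IsExpr ς γ (.tm s) (.var i ts)
  | const {γ δ : Scope S} {s : S} {c : C} {ts : Expr C} :
      (c, δ, some s) ∈ ς → IsExpr ς γ (.sp δ) ts → IsExpr ς γ (.tm s) (.const c ts)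
  | ty {γ δ : Scope S} {c : C} {ts : Expr C} :
      (c, δ, none) ∈ ς → IsExpr ς γ (.sp δ) ts → IsExpr ς γ .ty (.const c ts)
  | nil {γ : Scope S} : IsExpr ς γ (.sp .nil) .nil
  | snoc {γ δ γ' : Scope S} {s : S} {ts t : Expr C} {n : ℕ} :
      IsExpr ς γ (.sp δ) ts → n = γ'.length → IsExpr ς (γ.append γ') (.tm s) t →
      IsExpr ς γ (.sp (δ.snoc γ' s)) (.snoc ts n t)

/-! ### Types and contexts -/

/-- Raw types `c(t)`. -/
structure Ty (C : Type u) : Type u where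
  /-- The type-level constant. -/
  head : C
  /-- The spine of arguments. -/
  args : Expr C

namespace Ty

/-- A type as an expression. -/
def expr (T : Ty C) : Expr C := .const T.head T.args

/-- Renaming. -/
def ren (ρ : ℕ → ℕ) (T : Ty C) : Ty C := ⟨T.head, T.args.ren ρ⟩

/-- Weakening, as for expressions. -/
def wk (n k : ℕ) (T : Ty C) : Ty C := T.ren (wkRen n k)

/-- Substitution, as for expressions. -/
def subst (γ : Scope S) (us : Expr C) (k : ℕ) (T : Ty C) : Ty C := ⟨T.head, Expr.subst γ us k T.args⟩

/-- Erasure `|c(t)| = ‖c‖` of a type into a sort. -/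
def erase (nrm : C ↪ S) (T : Ty C) : S := nrm T.head

end Ty

/-- Membership in `Ty γ`. -/
def IsTy (ς : PreSig C S) (γ : Scope S) (T : Ty C) : Prop := IsExpr ς γ .ty T.expr

/-- Raw contexts `Γ ::= () | Γ, x : Δ → T`. -/
inductive Ctx (C : Type u) : Type u
  | nil : Ctx C
  | snoc (Γ Δ : Ctx C) (T : Ty C) : Ctx C

namespace Ctx

/-- Number of entries. -/
def length : Ctx C → ℕ
  | nil => 0
  | snoc Γ _ _ => Γ.length + 1

/-- Concatenation `Γ.Δ`. -/
def append (Γ : Ctx C) : Ctx C → Ctx C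
  | nil => Γ
  | snoc Δ Θ T => snoc (append Γ Δ) Θ T

/-- Erasure of a context into a scope. -/
def erase (nrm : C ↪ S) : Ctx C → Scope S
  | nil => .nil
  | snoc Γ Δ T => .snoc (Γ.erase nrm) (Δ.erase nrm) (T.erase nrm)

/-- Erasure of a context along an erasure assignment (`true` marks the erased entries, and the
assignment lists the rightmost entry first). -/
def eraseBy (nrm : C ↪ S) : Ctx C → List Bool → Scope S
  | snoc Δ Γ T, b :: ν =>
    if b then Δ.eraseBy nrm ν else .snoc (Δ.eraseBy nrm ν) (Γ.erase nrm) (T.erase nrm)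
  | _, _ => .nil

/-- Renaming. -/
def ren (ρ : ℕ → ℕ) : Ctx C → Ctx C
  | nil => nil
  | snoc Γ Δ T =>
    snoc (Γ.ren ρ) (Δ.ren (liftRen Γ.length ρ)) (T.ren (liftRen (Γ.length + Δ.length) ρ))

/-- Weakening, as for expressions. -/
def wk (n k : ℕ) (Γ : Ctx C) : Ctx C := Γ.ren (wkRen n k)

/-- Substitution, as for expressions. -/
def subst (γ : Scope S) (us : Expr C) (k : ℕ) : Ctx C → Ctx C
  | nil => nil
  | snoc Γ Δ T =>
    snoc (Γ.subst γ us k) (Δ.subst γ us (k + Γ.length))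
      (T.subst γ us (k + Γ.length + Δ.length))

/-- `Γ.Has i Δ T` : the `i`-th entry of `Γ`, counted from the right, is `x : Δ → T`, with `Δ` and
`T` weakened so as to live in `Γ` and `Γ.Δ`. -/
inductive Has : Ctx C → ℕ → Ctx C → Ty C → Prop
  | here {Γ Δ : Ctx C} {T : Ty C} :
      Has (Γ.snoc Δ T) 0 (Δ.wk 1 0) (T.wk 1 Δ.length)
  | there {Γ Δ Δ' : Ctx C} {T T' : Ty C} {i : ℕ} :
      Has Γ i Δ T → Has (Γ.snoc Δ' T') (i + 1) (Δ.wk 1 0) (T.wk 1 Δ.length)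

end Ctx

/-- Membership in `Ctx γ`. -/
def IsCtx (nrm : C ↪ S) (ς : PreSig C S) (γ : Scope S) : Ctx C → Prop
  | .nil => True
  | .snoc Γ Δ T =>
    IsCtx nrm ς γ Γ ∧ IsCtx nrm ς (γ.append (Γ.erase nrm)) Δ ∧
      IsTy ς ((γ.append (Γ.erase nrm)).append (Δ.erase nrm)) T

/-- The action `ν · t` of an erasure assignment on a spine: the erased arguments are dropped. -/
def keep : List Bool → Expr C → Expr C
  | b :: ν, .snoc ts n t => if b then keep ν ts else .snoc (keep ν ts) n t
  | _, _ => .nil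

/-! ### Signatures -/

/-- A declaration `c : Δ_ν → T` (`result = some T`) or `c : Δ_ν → □` (`result = none`). -/
structure Decl (C : Type u) : Type u where
  /-- The declared constant. -/
  name : C
  /-- The context of premises. -/
  ctx : Ctx C
  /-- The erasure assignment, rightmost entry first. -/
  erased : List Bool
  /-- The output type, if any. -/
  result : Option (Ty C)

/-- Raw signatures, the most recent declaration first. -/
abbrev Sig (C : Type u) := List (Decl C)

/-- Erasure of a signature into a pre-signature. -/
def Sig.erase (nrm : C ↪ S) (sig : Sig C) : PreSig C S :=
  sig.map fun d => (d.name, d.ctx.eraseBy nrm d.erased, d.result.map (Ty.erase nrm))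

/-- Well-scoped signatures: each declaration lives over the earlier ones, and each constant is
declared only once. -/
def IsSig (nrm : C ↪ S) : Sig C → Prop
  | [] => True
  | d :: sig =>
    IsSig nrm sig ∧ (∀ d' ∈ sig, d'.name ≠ d.name) ∧
      IsCtx nrm (Sig.erase nrm sig) .nil d.ctx ∧ d.erased.length = d.ctx.length ∧
      ∀ T ∈ d.result, IsTy (Sig.erase nrm sig) (d.ctx.erase nrm) T

/-! ### Rewriting -/

/-- `EtaVars S js ts` : the arguments of the spine `ts` are, from right to left, the eta-expansions
of the variables `js`. -/
inductive EtaVars (S : Type v) : List ℕ → Expr C → Prop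
  | nil : EtaVars S [] .nil
  | snoc {js : List ℕ} {ts : Expr C} (j : ℕ) (δ : Scope S) :
      EtaVars S js ts →
      EtaVars S (j :: js) (.snoc ts δ.length (.var (j + δ.length) (idSp δ)))

/-- Higher-order (Miller) patterns, under `k` binders: each free variable is applied to the
eta-expansions of distinct bound variables. -/
def IsHOPattern (S : Type v) (k : ℕ) : Expr C → Prop
  | .var i ts =>
    (i < k ∧ IsHOPattern S k ts) ∨
      (k ≤ i ∧ ∃ js : List ℕ, js.Nodup ∧ (∀ j ∈ js, j < k) ∧ EtaVars S js ts)
  | .const _ ts => IsHOPattern S k ts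
  | .nil => True
  | .snoc ts n t => IsHOPattern S k ts ∧ IsHOPattern S (k + n) t

/-- Raw rewrite rules `γ ⊩ l ⟼ r :: s`. -/
structure Rule (C : Type u) (S : Type v) where
  /-- The scope of both sides. -/
  scope : Scope S
  /-- The sort of both sides. -/
  sort : S
  /-- Left-hand side. -/
  lhs : Expr C
  /-- Right-hand side. -/
  rhs : Expr C

/-- Well-formed rewrite rules over a pre-signature. -/
structure IsRule (ς : PreSig C S) (r : Rule C S) : Prop where
  lhs : IsExpr ς r.scope (.tm r.sort) r.lhs
  rhs : IsExpr ς r.scope (.tm r.sort) r.rhs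
  pattern : IsHOPattern S 0 r.lhs
  free : ∀ i, r.rhs.Free i → r.lhs.Free i

/-- One-step rewriting between expressions of kind `K` in scope `γ`. -/
inductive Red (ς : PreSig C S) (R : Set (Rule C S)) : Scope S → Kind S → Expr C → Expr C → Prop
  | rule {γ : Scope S} {r : Rule C S} {vs : Expr C} :
      r ∈ R → IsExpr ς γ (.sp r.scope) vs →
      Red ς R γ (.tm r.sort) (Expr.subst r.scope vs 0 r.lhs) (Expr.subst r.scope vs 0 r.rhs)
  | var {γ δ : Scope S} {s : S} {i : ℕ} {ts us : Expr C} :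
      γ.get? i = some (δ, s) → Red ς R γ (.sp δ) ts us →
      Red ς R γ (.tm s) (.var i ts) (.var i us)
  | const {γ δ : Scope S} {s : S} {c : C} {ts us : Expr C} :
      (c, δ, some s) ∈ ς → Red ς R γ (.sp δ) ts us →
      Red ς R γ (.tm s) (.const c ts) (.const c us)
  | ty {γ δ : Scope S} {c : C} {ts us : Expr C} :
      (c, δ, none) ∈ ς → Red ς R γ (.sp δ) ts us →
      Red ς R γ .ty (.const c ts) (.const c us)
  | snocLeft {γ δ γ' : Scope S} {s : S} {ts ts' u : Expr C} {n : ℕ} :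
      Red ς R γ (.sp δ) ts ts' → n = γ'.length → IsExpr ς (γ.append γ') (.tm s) u →
      Red ς R γ (.sp (δ.snoc γ' s)) (.snoc ts n u) (.snoc ts' n u)
  | snocRight {γ δ γ' : Scope S} {s : S} {ts u u' : Expr C} {n : ℕ} :
      IsExpr ς γ (.sp δ) ts → n = γ'.length → Red ς R (γ.append γ') (.tm s) u u' →
      Red ς R γ (.sp (δ.snoc γ' s)) (.snoc ts n u) (.snoc ts n u')

/-- Many-step rewriting. -/
def Reds (ς : PreSig C S) (R : Set (Rule C S)) (γ : Scope S) (K : Kind S) :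
    Expr C → Expr C → Prop :=
  Relation.ReflTransGen (Red ς R γ K)

/-- Conversion (definitional equality). -/
def Conv (ς : PreSig C S) (R : Set (Rule C S)) (γ : Scope S) (K : Kind S) :
    Expr C → Expr C → Prop :=
  Relation.EqvGen (Red ς R γ K)

/-! ### Theories and typing -/

/-- A signature together with a rewrite system. -/
structure Theory (C : Type u) (S : Type v) where
  /-- The signature. -/
  sig : Sig C
  /-- The rewrite system. -/
  rew : Set (Rule C S)

namespace Theory

/-- The underlying pre-signature. -/
def presig (nrm : C ↪ S) (𝕋 : Theory C S) : PreSig C S := Sig.erase nrm 𝕋.sig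

/-- The theory with signature `sig` and those rewrite rules of `𝕋` that are over `sig`. -/
def restrict (nrm : C ↪ S) (𝕋 : Theory C S) (sig : Sig C) : Theory C S :=
  ⟨sig, {r | r ∈ 𝕋.rew ∧ IsRule (Sig.erase nrm sig) r}⟩

end Theory

/-- The judgments `Γ ⊢`, `Γ ⊢ T`, `Γ ⊢ t : T` and `Γ ⊢ t : Δ`, without the context `Γ`. -/
inductive Judgment (C : Type u) : Type u
  | ctx : Judgment C
  | ty (T : Ty C) : Judgment C
  | tm (t : Expr C) (T : Ty C) : Judgment C
  | sp (ts : Expr C) (Δ : Ctx C) : Judgment C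

/-- Derivability in the theory `𝕋`.  In `extSpine` the first premise states that the context is
well-scoped; in the other rules the conclusion is well-scoped as soon as the premises are. -/
inductive Derives (nrm : C ↪ S) (𝕋 : Theory C S) : Ctx C → Judgment C → Prop
  | emptyCtx : Derives nrm 𝕋 .nil .ctx
  | extCtx {Γ Γ' : Ctx C} {T : Ty C} :
      Derives nrm 𝕋 (Γ.append Γ') (.ty T) → Derives nrm 𝕋 (Γ.snoc Γ' T) .ctx
  | type {Γ Δ : Ctx C} {ν : List Bool} {c : C} {ts : Expr C} :
      ⟨c, Δ, ν, none⟩ ∈ 𝕋.sig → Derives nrm 𝕋 Γ (.sp ts Δ) →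
      Derives nrm 𝕋 Γ (.ty ⟨c, keep ν ts⟩)
  | const {Γ Δ : Ctx C} {ν : List Bool} {c : C} {T : Ty C} {ts : Expr C} :
      ⟨c, Δ, ν, some T⟩ ∈ 𝕋.sig → Derives nrm 𝕋 Γ (.sp ts Δ) →
      Derives nrm 𝕋 Γ (.tm (.const c (keep ν ts)) (T.subst (Δ.erase nrm) ts 0))
  | var {Γ Δ : Ctx C} {i : ℕ} {T : Ty C} {ts : Expr C} :
      Γ.Has i Δ T → Derives nrm 𝕋 Γ (.sp ts Δ) →
      Derives nrm 𝕋 Γ (.tm (.var i ts) (T.subst (Δ.erase nrm) ts 0))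
  | conv {Γ : Ctx C} {T U : Ty C} {t : Expr C} :
      Conv (𝕋.presig nrm) 𝕋.rew (Γ.erase nrm) .ty T.expr U.expr →
      Derives nrm 𝕋 Γ (.tm t T) → Derives nrm 𝕋 Γ (.ty U) → Derives nrm 𝕋 Γ (.tm t U)
  | emptySpine {Γ : Ctx C} :
      Derives nrm 𝕋 Γ .ctx → Derives nrm 𝕋 Γ (.sp .nil .nil)
  | extSpine {Γ Δ Γ' : Ctx C} {T : Ty C} {ts t : Expr C} :
      IsCtx nrm (𝕋.presig nrm) (Γ.erase nrm) (Δ.snoc Γ' T) →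
      Derives nrm 𝕋 Γ (.sp ts Δ) →
      Derives nrm 𝕋 (Γ.append (Γ'.subst (Δ.erase nrm) ts 0))
        (.tm t (T.subst (Δ.erase nrm) ts Γ'.length)) →
      Derives nrm 𝕋 Γ (.sp (.snoc ts Γ'.length t) (Δ.snoc Γ' T))

/-- Subject reduction: `Γ ⊢ t : T` and `t ⟶ t'` imply `Γ ⊢ t' : T`. -/
def Theory.SubjectReduction (nrm : C ↪ S) (𝕋 : Theory C S) : Prop :=
  ∀ (Γ : Ctx C) (t t' : Expr C) (T : Ty C), Derives nrm 𝕋 Γ (.tm t T) →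
    Red (𝕋.presig nrm) 𝕋.rew (Γ.erase nrm) (.tm (T.erase nrm)) t t' →
    Derives nrm 𝕋 Γ (.tm t' T)

/-! ### Patterns and matching -/

/-- `IsPatt ς γ γ₀ K e` : the expression `e` of kind `K` in scope `γ.γ₀` is a (fully applied,
possibly non-linear) pattern whose flexible variables are exactly those of `γ` and whose rigid
variables are in `γ₀`.  In `snoc`, the spine `ts` lives in `γ₁.γ₁₂.γ₀` and is weakened to
`γ₁.γ₁₂.γ₂.γ₀`. -/
inductive IsPatt (ς : PreSig C S) : Scope S → Scope S → Kind S → Expr C → Prop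
  | rigid {γ γ₀ δ : Scope S} {s : S} {c : C} {ts : Expr C} :
      (c, δ, some s) ∈ ς → IsPatt ς γ γ₀ (.sp δ) ts → IsPatt ς γ γ₀ (.tm s) (.const c ts)
  | flex {γ₀ : Scope S} {s : S} :
      IsPatt ς (.snoc .nil γ₀ s) γ₀ (.tm s) (.var γ₀.length (idSp γ₀))
  | nil {γ₀ : Scope S} : IsPatt ς .nil γ₀ (.sp .nil) .nil
  | snoc {γ₁ γ₁₂ γ₂ γ₀ δ γx : Scope S} {s : S} {ts t : Expr C} {n : ℕ} :
      IsPatt ς (γ₁.append γ₁₂) γ₀ (.sp δ) ts → n = γx.length →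
      IsPatt ς (γ₁₂.append γ₂) (γ₀.append γx) (.tm s) t →
      IsPatt ς ((γ₁.append γ₁₂).append γ₂) γ₀ (.sp (δ.snoc γx s))
        (.snoc (ts.wk γ₂.length γ₀.length) n t)
  | ty {γ γ₀ δ : Scope S} {c : C} {ts : Expr C} :
      (c, δ, none) ∈ ς → IsPatt ς γ γ₀ (.sp δ) ts → IsPatt ς γ γ₀ .ty (.const c ts)

/-- The rigidity conditions on a pattern `e`: a constant appearing in `e` is not the head of a
rewrite rule, and its declaration has no erased arguments. -/
def IsRigid (𝕋 : Theory C S) (e : Expr C) : Prop :=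
  ∀ c : C, e.Occurs c →
    (∀ r ∈ 𝕋.rew, ∀ ts : Expr C, r.lhs ≠ .const c ts) ∧
    (∀ d ∈ 𝕋.sig, d.name = c → ∀ b ∈ d.erased, b = false)

/-- A reduction strategy: a functional relation on expressions, contained in many-step rewriting
and with the same normal forms as rewriting. -/
structure Strategy (ς : PreSig C S) (R : Set (Rule C S)) where
  /-- One step of the strategy. -/
  step : Scope S → Kind S → Expr C → Expr C → Prop
  functional : ∀ {γ K e e₁ e₂}, step γ K e e₁ → step γ K e e₂ → e₁ = e₂
  le_reds : ∀ {γ K e e'}, step γ K e e' → Reds ς R γ K e e'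
  normal_iff : ∀ {γ K e}, IsExpr ς γ K e →
    ((∃ e', step γ K e e') ↔ ∃ e', Red ς R γ K e e')

namespace Strategy

/-- Many steps of the strategy. -/
def steps {ς : PreSig C S} {R : Set (Rule C S)} (𝔖 : Strategy ς R) (γ : Scope S) (K : Kind S) :
    Expr C → Expr C → Prop :=
  Relation.ReflTransGen (𝔖.step γ K)

/-- `e'` is the normal form of `e` for the strategy. -/
def NF {ς : PreSig C S} {R : Set (Rule C S)} (𝔖 : Strategy ς R) (γ : Scope S) (K : Kind S)
    (e e' : Expr C) : Prop :=
  𝔖.steps γ K e e' ∧ ¬ ∃ e'', 𝔖.step γ K e' e''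

end Strategy

/-- The matching algorithm: `Match 𝔖 γf γ γ₀ K t u vs` states that matching the pattern `t` (with
flexible variables `γ` and rigid variables `γ₀`) against the expression `u` in scope `γf.γ₀` returns
the spine `vs` in scope `γf` for `γ`. -/
inductive Match {ς : PreSig C S} {R : Set (Rule C S)} (𝔖 : Strategy ς R) (γf : Scope S) :
    Scope S → Scope S → Kind S → Expr C → Expr C → Expr C → Prop
  | rigid {γ γ₀ δ : Scope S} {s : S} {c : C} {ts u us vs : Expr C} :
      (c, δ, some s) ∈ ς → 𝔖.steps (γf.append γ₀) (.tm s) u (.const c us) →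
      Match 𝔖 γf γ γ₀ (.sp δ) ts us vs →
      Match 𝔖 γf γ γ₀ (.tm s) (.const c ts) u vs
  | flex {γ₀ : Scope S} {s : S} {u : Expr C} :
      IsExpr ς (γf.append γ₀) (.tm s) u →
      Match 𝔖 γf (.snoc .nil γ₀ s) γ₀ (.tm s) (.var γ₀.length (idSp γ₀)) u
        (.snoc .nil γ₀.length u)
  | nil {γ₀ : Scope S} : Match 𝔖 γf .nil γ₀ (.sp .nil) .nil .nil .nil
  | snoc {γ₁ γ₁₂ γ₂ γ₀ δ γx : Scope S} {s : S} {n : ℕ}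
      {ts t us u vs₁ vs₁₂ vs₁₂' vs₁₂'' vs₂ : Expr C} :
      Match 𝔖 γf (γ₁.append γ₁₂) γ₀ (.sp δ) ts us (vs₁.append vs₁₂') →
      n = γx.length →
      Match 𝔖 γf (γ₁₂.append γ₂) (γ₀.append γx) (.tm s) t u (vs₁₂''.append vs₂) →
      IsExpr ς γf (.sp γ₁) vs₁ → IsExpr ς γf (.sp γ₁₂) vs₁₂' →
      IsExpr ς γf (.sp γ₁₂) vs₁₂'' → IsExpr ς γf (.sp γ₂) vs₂ →
      𝔖.NF γf (.sp γ₁₂) vs₁₂' vs₁₂ → 𝔖.NF γf (.sp γ₁₂) vs₁₂'' vs₁₂ →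
      Match 𝔖 γf ((γ₁.append γ₁₂).append γ₂) γ₀ (.sp (δ.snoc γx s))
        (.snoc (ts.wk γ₂.length γ₀.length) n t) (.snoc us n u)
        ((vs₁.append vs₁₂).append vs₂)
  | ty {γ γ₀ δ : Scope S} {c : C} {ts us vs : Expr C} :
      (c, δ, none) ∈ ς → Match 𝔖 γf γ γ₀ (.sp δ) ts us vs →
      Match 𝔖 γf γ γ₀ .ty (.const c ts) (.const c us) vs

/-! ### Moded theories -/

/-- The declarations of a moded signature. -/
inductive ModedDecl (C : Type u) : Type u
  /-- `c : Δ⁻ → □` -/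
  | type (c : C) (Δ : Ctx C) : ModedDecl C
  /-- `c⁺ : Δ⁻ → T` -/
  | infer (c : C) (Δ : Ctx C) (T : Ty C) : ModedDecl C
  /-- `c⁻ : {Δ'} Δ⁻ → T` -/
  | check (c : C) (Δ' Δ : Ctx C) (T : Ty C) : ModedDecl C
  /-- `c⁺ : Δ₁⁻ {Δ'} (x : Γx → T)⁺ Δ₂⁻ → U` -/
  | synth (c : C) (Δ₁ Δ' Γx : Ctx C) (T : Ty C) (Δ₂ : Ctx C) (U : Ty C) : ModedDecl C

/-- The context `Δ₁.Δ', x : Γx → T`.  Here `Γx` lives in `Δ₁` and is weakened to `Δ₁.Δ'`. -/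
def synthCtx (Δ₁ Δ' Γx : Ctx C) (T : Ty C) : Ctx C :=
  (Δ₁.append Δ').snoc (Γx.wk Δ'.length 0) T

/-- The underlying unmoded declaration.  In `check`, the type `T` lives in `Δ'` and is weakened to
`Δ'.Δ`. -/
def ModedDecl.decl : ModedDecl C → Decl C
  | type c Δ => ⟨c, Δ, List.replicate Δ.length false, none⟩
  | infer c Δ T => ⟨c, Δ, List.replicate Δ.length false, some T⟩
  | check c Δ' Δ T =>
    ⟨c, Δ'.append Δ, List.replicate Δ.length false ++ List.replicate Δ'.length true,
      some (T.wk Δ.length 0)⟩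
  | synth c Δ₁ Δ' Γx T Δ₂ U =>
    ⟨c, (synthCtx Δ₁ Δ' Γx T).append Δ₂,
      List.replicate Δ₂.length false ++ false ::
        (List.replicate Δ'.length true ++ List.replicate Δ₁.length false),
      some U⟩

/-- Raw moded signatures, the most recent declaration first. -/
abbrev ModedSig (C : Type u) := List (ModedDecl C)

/-- The underlying signature. -/
def ModedSig.sig (msig : ModedSig C) : Sig C := msig.map ModedDecl.decl

/-- Well-scoped moded declarations over a pre-signature. -/
def IsModedDecl (nrm : C ↪ S) (ς : PreSig C S) : ModedDecl C → Prop
  | .type _ Δ => IsCtx nrm ς .nil Δ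
  | .infer _ Δ T => IsCtx nrm ς .nil Δ ∧ IsTy ς (Δ.erase nrm) T
  | .check _ Δ' Δ T =>
    IsCtx nrm ς .nil Δ' ∧ IsCtx nrm ς (Δ'.erase nrm) Δ ∧
      IsPatt ς (Δ'.erase nrm) .nil .ty T.expr
  | .synth _ Δ₁ Δ' Γx T Δ₂ U =>
    IsCtx nrm ς .nil Δ₁ ∧ IsCtx nrm ς (Δ₁.erase nrm) Δ' ∧ IsCtx nrm ς (Δ₁.erase nrm) Γx ∧
      IsPatt ς (Δ'.erase nrm) (Γx.erase nrm) .ty T.expr ∧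
      IsCtx nrm ς ((synthCtx Δ₁ Δ' Γx T).erase nrm) Δ₂ ∧
      IsTy ς (((synthCtx Δ₁ Δ' Γx T).append Δ₂).erase nrm) U

/-- Well-scoped moded signatures: each declaration lives over the earlier ones, and each constant
is declared only once. -/
def IsModedSig (nrm : C ↪ S) : ModedSig C → Prop
  | [] => True
  | d :: msig =>
    IsModedSig nrm msig ∧ (∀ d' ∈ msig, d'.decl.name ≠ d.decl.name) ∧
      IsModedDecl nrm (Sig.erase nrm (ModedSig.sig msig)) d

/-- A raw moded theory: a moded signature and a set of rewrite rules. -/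
structure ModedTheory (C : Type u) (S : Type v) where
  /-- The moded signature. -/
  msig : ModedSig C
  /-- The rewrite system. -/
  rew : Set (Rule C S)

namespace ModedTheory

/-- The underlying theory. -/
def theory (M : ModedTheory C S) : Theory C S := ⟨ModedSig.sig M.msig, M.rew⟩

/-- `M` is a moded theory: its signature is a moded signature, and its rewrite system is over the
underlying pre-signature. -/
structure IsModedTheory (nrm : C ↪ S) (M : ModedTheory C S) : Prop where
  msig : IsModedSig nrm M.msig
  rew : ∀ r ∈ M.rew, IsRule (M.theory.presig nrm) r

/-- The typing condition on a declaration in `M`, where `𝕋` is the theory of what comes before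
it. -/
def DeclWellTyped (nrm : C ↪ S) (M : ModedTheory C S) (𝕋 : Theory C S) : ModedDecl C → Prop
  | .type _ Δ => Derives nrm 𝕋 Δ .ctx
  | .infer _ Δ T => Derives nrm 𝕋 Δ (.ty T)
  | .check _ Δ' Δ T =>
    Derives nrm 𝕋 (Δ'.append Δ) .ctx ∧ Derives nrm 𝕋 Δ' (.ty T) ∧ IsRigid M.theory T.expr
  | .synth _ Δ₁ Δ' Γx T Δ₂ U =>
    Derives nrm 𝕋 ((synthCtx Δ₁ Δ' Γx T).append Δ₂) (.ty U) ∧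
      Derives nrm 𝕋 (Δ₁.append Γx) .ctx ∧ IsRigid M.theory T.expr

/-- Well-typed moded theories: every declaration is well-typed in the theory formed by the
declarations before it and the rewrite rules over these. -/
def WellTyped (nrm : C ↪ S) (M : ModedTheory C S) : Prop :=
  ∀ (d : ModedDecl C) (before : ModedSig C), (d :: before) <:+ M.msig →
    M.DeclWellTyped nrm (M.theory.restrict nrm (ModedSig.sig before)) d

end ModedTheory

/-! ### The bidirectional typing algorithm -/

/-- The judgments `Γ ⊢ t ⇒ T`, `Γ ⊢ t ⇐ T`, `Γ ⊢ T ⇔ □` and `Γ ⊢ t ⇐ Δ` of the algorithm, without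
the context `Γ`. -/
inductive AlgJudgment (C : Type u) : Type u
  | infer (t : Expr C) (T : Ty C) : AlgJudgment C
  | check (t : Expr C) (T : Ty C) : AlgJudgment C
  | ty (T : Ty C) : AlgJudgment C
  | sp (ts : Expr C) (Δ : Ctx C) : AlgJudgment C

/-- The bidirectional typing algorithm of the moded theory `M` for the strategy `𝔖`. -/
inductive Alg (nrm : C ↪ S) (M : ModedTheory C S)
    (𝔖 : Strategy (M.theory.presig nrm) M.theory.rew) : Ctx C → AlgJudgment C → Prop
  | var {Γ Δ : Ctx C} {i : ℕ} {T : Ty C} {ts : Expr C} :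
      Γ.Has i Δ T → Alg nrm M 𝔖 Γ (.sp ts Δ) →
      Alg nrm M 𝔖 Γ (.infer (.var i ts) (T.subst (Δ.erase nrm) ts 0))
  | const {Γ Δ : Ctx C} {c : C} {T : Ty C} {ts : Expr C} :
      ModedDecl.infer c Δ T ∈ M.msig → Alg nrm M 𝔖 Γ (.sp ts Δ) →
      Alg nrm M 𝔖 Γ (.infer (.const c ts) (T.subst (Δ.erase nrm) ts 0))
  | constPlus {Γ Δ₁ Δ' Γx Δ₂ : Ctx C} {c : C} {T U V : Ty C} {ts t vs us : Expr C} :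
      ModedDecl.synth c Δ₁ Δ' Γx T Δ₂ U ∈ M.msig →
      Alg nrm M 𝔖 Γ (.sp ts Δ₁) →
      Alg nrm M 𝔖 (Γ.append (Γx.subst (Δ₁.erase nrm) ts 0)) (.infer t V) →
      Match 𝔖 (Γ.erase nrm) (Δ'.erase nrm) (Γx.erase nrm) .ty T.expr V.expr vs →
      Alg nrm M 𝔖 Γ (.sp us (Δ₂.subst ((synthCtx Δ₁ Δ' Γx T).erase nrm)
        ((ts.append vs).snoc Γx.length t) 0)) →
      Alg nrm M 𝔖 Γ (.infer (.const c ((ts.snoc Γx.length t).append us))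
        (U.subst (((synthCtx Δ₁ Δ' Γx T).append Δ₂).erase nrm)
          (((ts.append vs).snoc Γx.length t).append us) 0))
  | switch {Γ : Ctx C} {t W : Expr C} {T U : Ty C} :
      IsTy (M.theory.presig nrm) (Γ.erase nrm) T →
      (∀ (c : C) (Δ' Δ : Ctx C) (T' : Ty C), ModedDecl.check c Δ' Δ T' ∈ M.msig →
        ∀ ts : Expr C, t ≠ .const c ts) →
      Alg nrm M 𝔖 Γ (.infer t U) →
      𝔖.NF (Γ.erase nrm) .ty T.expr W → 𝔖.NF (Γ.erase nrm) .ty U.expr W →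
      Alg nrm M 𝔖 Γ (.check t T)
  | constMinus {Γ Δ' Δ : Ctx C} {c : C} {T V : Ty C} {ts vs : Expr C} :
      IsTy (M.theory.presig nrm) (Γ.erase nrm) V →
      ModedDecl.check c Δ' Δ T ∈ M.msig →
      Match 𝔖 (Γ.erase nrm) (Δ'.erase nrm) .nil .ty T.expr V.expr vs →
      Alg nrm M 𝔖 Γ (.sp ts (Δ.subst (Δ'.erase nrm) vs 0)) →
      Alg nrm M 𝔖 Γ (.check (.const c ts) V)
  | type {Γ Δ : Ctx C} {c : C} {ts : Expr C} :
      ModedDecl.type c Δ ∈ M.msig → Alg nrm M 𝔖 Γ (.sp ts Δ) →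
      Alg nrm M 𝔖 Γ (.ty ⟨c, ts⟩)
  | emptySp {Γ : Ctx C} : Alg nrm M 𝔖 Γ (.sp .nil .nil)
  | extSp {Γ Δ Γx : Ctx C} {T : Ty C} {ts t : Expr C} :
      IsCtx nrm (M.theory.presig nrm) (Γ.erase nrm) (Δ.snoc Γx T) →
      Alg nrm M 𝔖 Γ (.sp ts Δ) →
      Alg nrm M 𝔖 (Γ.append (Γx.subst (Δ.erase nrm) ts 0))
        (.check t (T.subst (Δ.erase nrm) ts Γx.length)) →
      Alg nrm M 𝔖 Γ (.sp (.snoc ts Γx.length t) (Δ.snoc Γx T))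

end CompLF

/-! The proof is an induction on algorithmic derivations (`Alg.sound`), where checking a term
presupposes a valid type and checking a spine presupposes a valid context. Apart from matching,
everything follows from the metatheory of the declarative system: substitution, weakening, validity
of the type of a typed term. The real issue is the arguments omitted from the syntax: matching
recovers them from a type, and it has to be shown that it returns a well-typed spine.

Matching is first studied without types: instantiating the pattern by the result `v` gives an
expression convertible to the matched one (`Match.conv`). Hence `v` can be used as a well-scoped
substitution before anything is known about its typing. `Match.typed` then descends through pattern
and expression together. At a constant, subject reduction types the reduct, and inversion at the
unique declaration of the constant gives both argument spines the same closed context; by rigidity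
nothing is erased, so these are exactly the spines being matched. No injectivity of conversion is
involved. Corresponding arguments of spines `ts` and `us` have types `T[ts]` and `T[us]`, which
become convertible under `v` because `ts[v]` is convertible to `us`.

At a flexible variable applied to an identity spine, typability of that spine forces the local
context to be convertible to the arity context of the variable (`Derives.ctxConv_of_idSp`). So the
matched expression has the required type, up to conversion of its type and of its context. As
judgments are stable under conversion of contexts (`CtxConv.derives`), the arguments can be
assembled into a typed spine (`ArgsTyped.derives`).

The laws of hereditary substitution are all derived for simultaneous substitutions (`Env`), of which
renamings and `subst` are special cases. The only recursion that is not structural enters the body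
put in place of a variable, to substitute for its arity, and this arity is smaller. Hence the
recurring scheme: an outer induction on a bound `N` for the arities of the instantiated variables,
an inner one on the expression or derivation (`IsExpr.hsLt`, `Expr.hs_comp_aux`, `Conv.hs_aux`,
`Derives.hs_aux`). -/

namespace CompLF

universe u v

/-! ### Raw syntax: renaming and simultaneous hereditary substitution -/

section

variable {C : Type u} {S : Type v}

/-! ### Scopes -/

namespace Scope

@[simp] theorem length_append (γ δ : Scope S) : (γ.append δ).length = γ.length + δ.length := by
  induction δ with
  | nil => rfl
  | snoc δ _ _ ih _ => simp only [append, length, ih]; omega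

theorem append_assoc (γ δ ξ : Scope S) : (γ.append δ).append ξ = γ.append (δ.append ξ) := by
  induction ξ with
  | nil => rfl
  | snoc ξ _ _ ih _ => simp only [append, ih]

@[simp] theorem nil_append (γ : Scope S) : Scope.nil.append γ = γ := by
  induction γ with
  | nil => rfl
  | snoc ξ _ _ ih _ => simp only [append, ih]

@[simp] theorem append_nil (γ : Scope S) : γ.append .nil = γ := rfl

theorem get?_append_of_lt (γ : Scope S) {δ : Scope S} {i : ℕ} (h : i < δ.length) :
    (γ.append δ).get? i = δ.get? i := by
  induction δ generalizing i with
  | nil => simp [length] at h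
  | snoc δ _ _ ih _ =>
    cases i with
    | zero => rfl
    | succ i => exact ih (by simpa [length] using h)

@[simp] theorem get?_append_add (γ δ : Scope S) (i : ℕ) :
    (γ.append δ).get? (i + δ.length) = γ.get? i := by
  induction δ with
  | nil => rfl
  | snoc δ _ _ ih _ => exact ih

theorem lt_of_get? {γ : Scope S} {i : ℕ} {x : Scope S × S} (h : γ.get? i = some x) :
    i < γ.length := by
  induction γ generalizing i with
  | nil => simp [get?] at h
  | snoc γ _ _ ih _ =>
    cases i with
    | zero => simp [length]
    | succ i => simpa [length] using ih h

theorem get?_append_of_some (γ : Scope S) {δ : Scope S} {i : ℕ} {x : Scope S × S}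
    (h : δ.get? i = some x) : (γ.append δ).get? i = some x := by
  rw [get?_append_of_lt _ (lt_of_get? h), h]

theorem get?_eq_none {γ : Scope S} {i : ℕ} (h : γ.length ≤ i) : γ.get? i = none := by
  cases hx : γ.get? i with
  | none => rfl
  | some x => exact absurd (lt_of_get? hx) (by omega)

theorem exists_get? {γ : Scope S} {i : ℕ} (h : i < γ.length) : ∃ δ s, γ.get? i = some (δ, s) := by
  induction γ generalizing i with
  | nil => simp [length] at h
  | snoc γ δ s ih _ =>
    cases i with
    | zero => exact ⟨δ, s, rfl⟩
    | succ i => exact ih (by simpa [length] using h)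

end Scope

/-! ### Renamings -/

theorem liftRen_liftRen (m n : ℕ) (ρ : ℕ → ℕ) :
    liftRen n (liftRen m ρ) = liftRen (m + n) ρ := by
  funext i
  simp only [liftRen]
  split_ifs <;> first | rfl | omega | skip
  rw [show i - n - m = i - (m + n) by omega]
  omega

theorem wkRen_eq (n k : ℕ) : wkRen n k = liftRen k (· + n) := by
  funext i
  simp only [wkRen, liftRen]
  split_ifs <;> omega

theorem liftRen_comp (n : ℕ) (ρ τ : ℕ → ℕ) : liftRen n (τ ∘ ρ) = liftRen n τ ∘ liftRen n ρ := by
  funext i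
  simp only [liftRen, Function.comp]
  split_ifs <;> first | rfl | omega | skip
  simp

theorem liftRen_of_lt {n i : ℕ} (ρ : ℕ → ℕ) (h : i < n) : liftRen n ρ i = i := if_pos h

@[simp] theorem liftRen_add (n i : ℕ) (ρ : ℕ → ℕ) : liftRen n ρ (i + n) = ρ i + n := by
  simp [liftRen]

/-! ### Environments -/

/-- A simultaneous hereditary substitution: a variable is sent to a variable, or to an expression
which lives under binders for its arity. -/
abbrev Env (C : Type u) (S : Type v) := ℕ → ℕ ⊕ (Scope S × Expr C)

namespace Env

/-- Extension of an environment under `n` binders. -/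
def lift (n : ℕ) (σ : Env C S) : Env C S := fun i =>
  if i < n then .inl i else
    match σ (i - n) with
    | .inl j => .inl (j + n)
    | .inr (δ, u) => .inr (δ, u.wk n δ.length)

/-- A renaming as an environment. -/
def ofRen (ρ : ℕ → ℕ) : Env C S := fun i => .inl (ρ i)

/-- The environment of a spine for the scope `γ`. -/
def inst (γ : Scope S) (us : Expr C) : Env C S := fun i =>
  match γ.get? i with
  | none => .inl (i - γ.length)
  | some (δ, _) => .inr (δ, (us.arg? i).getD .nil)

theorem lift_of_lt {n i : ℕ} (σ : Env C S) (h : i < n) : σ.lift n i = .inl i := if_pos h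

theorem lift_add_inl {n i j : ℕ} {σ : Env C S} (h : σ i = .inl j) :
    σ.lift n (i + n) = .inl (j + n) := by simp [lift, h]

theorem lift_add_inr {n i : ℕ} {σ : Env C S} {δ : Scope S} {u : Expr C} (h : σ i = .inr (δ, u)) :
    σ.lift n (i + n) = .inr (δ, u.wk n δ.length) := by simp [lift, h]

theorem lift_ofRen (n : ℕ) (ρ : ℕ → ℕ) :
    (ofRen ρ : Env C S).lift n = ofRen (liftRen n ρ) := by
  funext i
  simp only [lift, ofRen, liftRen]
  split_ifs <;> rfl

end Env

namespace Expr

/-- Action of an environment. -/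
def hs (σ : Env C S) : Expr C → Expr C
  | var i ts =>
    match σ i with
    | .inl j => var j (ts.hs σ)
    | .inr (δ, u) => subst δ (ts.hs σ) 0 u
  | const c ts => const c (ts.hs σ)
  | nil => nil
  | snoc ts n t => snoc (ts.hs σ) n (t.hs (σ.lift n))

theorem hs_var_inl {σ : Env C S} {i j : ℕ} (h : σ i = .inl j) (ts : Expr C) :
    (var i ts).hs σ = var j (ts.hs σ) := by simp [hs, h]

theorem hs_var_inr {σ : Env C S} {i : ℕ} {δ : Scope S} {u : Expr C} (h : σ i = .inr (δ, u))
    (ts : Expr C) : (var i ts).hs σ = subst δ (ts.hs σ) 0 u := by simp [hs, h]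

theorem ren_ren (ρ τ : ℕ → ℕ) (e : Expr C) : (e.ren ρ).ren τ = e.ren (τ ∘ ρ) := by
  induction e generalizing ρ τ with
  | var i ts ih => simp [ren, ih]
  | const c ts ih => simp [ren, ih]
  | nil => rfl
  | snoc ts n t ih ih' => simp [ren, ih, ih', liftRen_comp]

/-- Raw expressions do not mention sorts, so the type `S` of sorts is arbitrary and has to be given
explicitly; where sorts play no role, `C` itself is used for it. -/
theorem ren_eq_hs (S : Type v) (ρ : ℕ → ℕ) (e : Expr C) :
    e.ren ρ = e.hs (Env.ofRen ρ : Env C S) := by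
  induction e generalizing ρ with
  | var i ts ih => rw [hs_var_inl (σ := Env.ofRen ρ) rfl, ren, ih]
  | const c ts ih => simp [ren, hs, ih]
  | nil => rfl
  | snoc ts n t ih ih' => simp [ren, hs, ih, ih', Env.lift_ofRen]

theorem wk_wk_same (m n k : ℕ) (e : Expr C) : (e.wk m k).wk n k = e.wk (m + n) k := by
  simp only [wk, ren_ren, wkRen_eq, ← liftRen_comp]
  congr 2; funext i; simp [Function.comp]; omega

end Expr

theorem Env.lift_lift (m n : ℕ) (σ : Env C S) : (σ.lift m).lift n = σ.lift (m + n) := by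
  funext i
  by_cases h : i < n
  · rw [lift_of_lt _ h, lift_of_lt _ (by omega)]
  · obtain ⟨j, rfl⟩ := Nat.exists_eq_add_of_le' (not_lt.1 h)
    by_cases hj : j < m
    · rw [lift_add_inl (lift_of_lt _ hj), lift_of_lt _ (by omega)]
    · obtain ⟨k, rfl⟩ := Nat.exists_eq_add_of_le' (not_lt.1 hj)
      rw [add_assoc]
      cases hk : σ k with
      | inl x => rw [lift_add_inl hk, ← add_assoc, lift_add_inl (lift_add_inl hk), add_assoc]
      | inr x =>
        obtain ⟨δ, u⟩ := x
        rw [lift_add_inr hk, ← add_assoc, lift_add_inr (lift_add_inr hk), Expr.wk_wk_same]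

@[simp] theorem Env.lift_zero (σ : Env C S) : σ.lift 0 = σ := by
  funext i
  cases hk : σ i with
  | inl x => exact lift_add_inl (n := 0) hk
  | inr x =>
    obtain ⟨δ, u⟩ := x
    rw [show σ.lift 0 i = σ.lift 0 (i + 0) from rfl, lift_add_inr (n := 0) hk]
    have : ∀ (k : ℕ) (e : Expr C), e.wk 0 k = e := by
      intro k e
      rw [Expr.wk]
      have h : wkRen 0 k = id := by funext i; simp [wkRen]
      rw [h]
      have hl : ∀ n, liftRen n id = id := by
        intro n; funext i; simp only [liftRen, id]; split_ifs <;> omega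
      induction e with
      | var i ts ih => simp [Expr.ren, ih]
      | const c ts ih => simp [Expr.ren, ih]
      | nil => rfl
      | snoc ts n t ih ih' => simp [Expr.ren, ih, ih', hl]
    rw [this]

namespace Expr

@[simp] theorem ren_id (e : Expr C) : e.ren id = e := by
  have hl : ∀ n, liftRen n id = id := by
    intro n; funext i; simp only [liftRen, id]; split_ifs <;> omega
  induction e with
  | var i ts ih => simp [ren, ih]
  | const c ts ih => simp [ren, ih]
  | nil => rfl
  | snoc ts n t ih ih' => simp [ren, ih, ih', hl]

/-- A structural induction is enough: at an instantiated variable `hs` calls `subst` for the smaller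
arity, exactly as `subst` does, so no recursion on scopes is needed here. -/
theorem subst_eq_hs (γ : Scope S) (us : Expr C) (k : ℕ) (e : Expr C) :
    subst γ us k e = e.hs ((Env.inst γ us).lift k) := by
  induction e generalizing k with
  | var i ts ih =>
    rw [subst]
    split_ifs with h
    · rw [hs_var_inl (Env.lift_of_lt _ h), ih]
    · obtain ⟨j, rfl⟩ := Nat.exists_eq_add_of_le' (not_lt.1 h)
      have h' : j + k - k = j := by omega
      split
      · rename_i h2
        rw [h'] at h2
        have : γ.length ≤ j := by
          by_contra hlt
          obtain ⟨δ, s, hx⟩ := Scope.exists_get? (not_le.1 hlt)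
          simp [hx] at h2
        have h3 : Env.inst γ us j = .inl (j - γ.length) := by simp [Env.inst, h2]
        rw [hs_var_inl (Env.lift_add_inl h3), ih]
        congr 1; omega
      · rename_i δ s h2
        rw [h'] at h2
        have h3 : Env.inst γ us j = .inr (δ, (us.arg? j).getD .nil) := by simp [Env.inst, h2]
        rw [hs_var_inr (Env.lift_add_inr h3), ih, h']
        -- For a missing argument `subst` returns `nil`, and `hs` substitutes into the default `nil`
        -- chosen by `Env.inst`, with the same result.
        cases us.arg? j with
        | none => simp [wk, ren, subst]
        | some u => simp
  | const c ts ih => simp [subst, hs, ih]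
  | nil => simp [subst, hs]
  | snoc ts n t ih ih' => simp [subst, hs, ih, ih', Env.lift_lift]

theorem subst_zero_eq_hs (γ : Scope S) (us : Expr C) (e : Expr C) :
    subst γ us 0 e = e.hs (Env.inst γ us) := by
  rw [subst_eq_hs, Env.lift_zero]

/-- Renaming first only reindexes the environment, so this holds for all raw expressions. The
opposite order pushes the renaming through nested hereditary substitutions and requires
well-scopedness (`ren_hsLt`). -/
theorem hs_ren (ρ : ℕ → ℕ) (τ : Env C S) (e : Expr C) : (e.ren ρ).hs τ = e.hs (τ ∘ ρ) := by
  induction e generalizing ρ τ with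
  | var i ts ih =>
    cases h : τ (ρ i) with
    | inl j => rw [ren, hs_var_inl h, hs_var_inl (by exact h), ih]
    | inr x =>
      obtain ⟨δ, u⟩ := x
      rw [ren, hs_var_inr h, hs_var_inr (by exact h), ih]
  | const c ts ih => simp [ren, hs, ih]
  | nil => rfl
  | snoc ts n t ih ih' =>
    simp only [ren, hs, ih, ih']
    congr 2
    funext i
    by_cases hi : i < n
    · simp [Env.lift_of_lt _ hi, liftRen_of_lt _ hi]
    · obtain ⟨j, rfl⟩ := Nat.exists_eq_add_of_le' (not_lt.1 hi)
      simp [Env.lift]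

/-- Environments that agree on the variables of the scope have the same action. -/
theorem hs_congr_get {ς : PreSig C S} {γ : Scope S} {K : Kind S} {e : Expr C}
    (he : IsExpr ς γ K e) {σ τ : Env C S} (h : ∀ i < γ.length, σ i = τ i) :
    e.hs σ = e.hs τ := by
  induction he generalizing σ τ with
  | @var γ δ s i ts hi _ ih => simp only [hs, ih h, h i (Scope.lt_of_get? hi)]
  | const _ _ ih => simp only [hs, ih h]
  | ty _ _ ih => simp only [hs, ih h]
  | nil => rfl
  | @snoc γ δ γ' s ts t n _ hn _ ih ih' =>
    simp only [hs, ih h]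
    congr 1
    apply ih'
    intro i hi
    by_cases hin : i < n
    · simp [Env.lift_of_lt _ hin]
    · obtain ⟨j, rfl⟩ := Nat.exists_eq_add_of_le' (not_lt.1 hin)
      simp only [Env.lift, Nat.add_sub_cancel, h j (by simp at hi; omega)]

theorem ren_congr_get {ς : PreSig C S} {γ : Scope S} {K : Kind S} {e : Expr C}
    (he : IsExpr ς γ K e) {ρ τ : ℕ → ℕ} (h : ∀ i < γ.length, ρ i = τ i) :
    e.ren ρ = e.ren τ := by
  rw [ren_eq_hs S, ren_eq_hs S]
  exact hs_congr_get he fun i hi => by simp [Env.ofRen, h i hi]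

end Expr

/-- Renamings between scopes. -/
def IsRen (γ : Scope S) (ρ : ℕ → ℕ) (γ' : Scope S) : Prop :=
  ∀ i x, γ.get? i = some x → γ'.get? (ρ i) = some x

theorem IsRen.lift {γ γ' : Scope S} {ρ : ℕ → ℕ} (h : IsRen γ ρ γ') (ξ : Scope S) :
    IsRen (γ.append ξ) (liftRen ξ.length ρ) (γ'.append ξ) := by
  intro i x hx
  by_cases hi : i < ξ.length
  · rw [liftRen_of_lt _ hi, Scope.get?_append_of_lt _ hi]
    rwa [Scope.get?_append_of_lt _ hi] at hx
  · obtain ⟨j, rfl⟩ := Nat.exists_eq_add_of_le' (not_lt.1 hi)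
    rw [Scope.get?_append_add] at hx
    simpa using h j x hx

theorem isRen_shift (γ ξ : Scope S) : IsRen γ (· + ξ.length) (γ.append ξ) := by
  intro i x hx; simpa using hx

theorem isRen_id_append (γ ξ : Scope S) : IsRen ξ id (γ.append ξ) :=
  fun _ _ hx => Scope.get?_append_of_some _ hx

namespace IsExpr

variable {ς : PreSig C S}

theorem ren {γ γ' : Scope S} {K : Kind S} {e : Expr C} (he : IsExpr ς γ K e) {ρ : ℕ → ℕ}
    (h : IsRen γ ρ γ') : IsExpr ς γ' K (e.ren ρ) := by
  induction he generalizing γ' ρ with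
  | var hi _ ih => exact .var (h _ _ hi) (ih h)
  | const hc _ ih => exact .const hc (ih h)
  | ty hc _ ih => exact .ty hc (ih h)
  | nil => exact .nil
  | snoc _ hn _ ih ih' => subst hn; exact .snoc (ih h) rfl (ih' (h.lift _))

theorem wk {γ ξ δ : Scope S} {K : Kind S} {e : Expr C} (he : IsExpr ς (γ.append δ) K e) :
    IsExpr ς ((γ.append ξ).append δ) K (e.wk ξ.length δ.length) := by
  rw [Expr.wk, wkRen_eq]
  exact he.ren ((isRen_shift γ ξ).lift δ)

theorem wk_zero {γ ξ : Scope S} {K : Kind S} {e : Expr C} (he : IsExpr ς γ K e) :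
    IsExpr ς (γ.append ξ) K (e.wk ξ.length 0) :=
  IsExpr.wk (δ := .nil) he

theorem left_append {ξ : Scope S} {K : Kind S} {e : Expr C} (he : IsExpr ς ξ K e)
    (γ : Scope S) : IsExpr ς (γ.append ξ) K e := by
  simpa using he.ren (isRen_id_append γ ξ)

theorem mono {ς' : PreSig C S} (hς : ς ⊆ ς') {γ : Scope S} {K : Kind S} {e : Expr C}
    (he : IsExpr ς γ K e) : IsExpr ς' γ K e := by
  induction he with
  | var hi _ ih => exact .var hi ih
  | const hc _ ih => exact .const (hς hc) ih
  | ty hc _ ih => exact .ty (hς hc) ih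
  | nil => exact .nil
  | snoc _ hn _ ih ih' => exact .snoc ih hn ih'

/-- The arguments of a well-scoped spine. -/
theorem exists_arg {γ δ : Scope S} {us : Expr C} (h : IsExpr ς γ (.sp δ) us) {i : ℕ} {ξ : Scope S}
    {s : S} (hi : δ.get? i = some (ξ, s)) :
    ∃ u, us.arg? i = some u ∧ IsExpr ς (γ.append ξ) (.tm s) u := by
  induction δ generalizing us i with
  | nil => simp [Scope.get?] at hi
  | snoc δ ξ' s' ih _ =>
    cases h with
    | snoc hts hn ht =>
      cases i with
      | zero =>
        simp only [Scope.get?, Option.some.injEq, Prod.mk.injEq] at hi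
        obtain ⟨rfl, rfl⟩ := hi
        exact ⟨_, rfl, ht⟩
      | succ i => exact ih hts hi

end IsExpr

theorem Expr.arg?_ren {ς : PreSig C S} {γ δ : Scope S} {us : Expr C}
    (h : IsExpr ς γ (.sp δ) us) {i : ℕ} {ξ : Scope S} {s : S} (hi : δ.get? i = some (ξ, s))
    (ρ : ℕ → ℕ) : (us.ren ρ).arg? i = (us.arg? i).map (Expr.ren (liftRen ξ.length ρ)) := by
  induction δ generalizing us i with
  | nil => simp [Scope.get?] at hi
  | snoc δ ξ' s' ih _ =>
    cases h with
    | snoc hts hn ht =>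
      cases i with
      | zero =>
        simp only [Scope.get?, Option.some.injEq, Prod.mk.injEq] at hi
        obtain ⟨rfl, rfl⟩ := hi
        simp [Expr.ren, Expr.arg?, hn]
      | succ i => exact ih hts hi

theorem Expr.arg?_hs {ς : PreSig C S} {γ δ : Scope S} {us : Expr C}
    (h : IsExpr ς γ (.sp δ) us) {i : ℕ} {ξ : Scope S} {s : S} (hi : δ.get? i = some (ξ, s))
    (σ : Env C S) : (us.hs σ).arg? i = (us.arg? i).map (Expr.hs (σ.lift ξ.length)) := by
  induction δ generalizing us i with
  | nil => simp [Scope.get?] at hi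
  | snoc δ ξ' s' ih _ =>
    cases h with
    | snoc hts hn ht =>
      cases i with
      | zero =>
        simp only [Scope.get?, Option.some.injEq, Prod.mk.injEq] at hi
        obtain ⟨rfl, rfl⟩ := hi
        simp [Expr.hs, Expr.arg?, hn]
      | succ i => exact ih hts hi

end

/-! ### Well-scoped substitution: composition and identity laws -/

section

variable {C : Type u} {S : Type v}

/-! ### Well-scoped environments -/

/-- Well-scoped environments from `γ` to `γ'` whose instantiated variables have arities of size less
than `N`. -/
def WEnvLt (ς : PreSig C S) (N : ℕ) (γ : Scope S) (σ : Env C S) (γ' : Scope S) : Prop :=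
  ∀ i δ s, γ.get? i = some (δ, s) →
    (∃ j, σ i = .inl j ∧ γ'.get? j = some (δ, s)) ∨
    (∃ u, σ i = .inr (δ, u) ∧ sizeOf δ < N ∧ IsExpr ς (γ'.append δ) (.tm s) u)

/-- Well-scoped environments from `γ` to `γ'`. -/
def WEnv (ς : PreSig C S) (γ : Scope S) (σ : Env C S) (γ' : Scope S) : Prop :=
  WEnvLt ς (sizeOf γ) γ σ γ'

variable {ς : PreSig C S}

/-- The arity of a variable of `γ` is always smaller than `γ`, so `sizeOf γ` is a bound that costs
nothing. -/
theorem WEnvLt.toWEnv {N : ℕ} {γ γ' : Scope S} {σ : Env C S} (h : WEnvLt ς N γ σ γ') :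
    WEnv ς γ σ γ' := by
  intro i δ s hi
  rcases h i δ s hi with h | ⟨u, hu, -, h⟩
  · exact .inl h
  · exact .inr ⟨u, hu, Scope.sizeOf_lt_of_get? hi, h⟩

theorem WEnvLt.lift {N : ℕ} {γ γ' : Scope S} {σ : Env C S} (h : WEnvLt ς N γ σ γ') (ξ : Scope S) :
    WEnvLt ς N (γ.append ξ) (σ.lift ξ.length) (γ'.append ξ) := by
  intro i δ s hi
  by_cases hx : i < ξ.length
  · refine .inl ⟨i, Env.lift_of_lt _ hx, ?_⟩
    rw [Scope.get?_append_of_lt _ hx] at hi ⊢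
    exact hi
  · obtain ⟨j, rfl⟩ := Nat.exists_eq_add_of_le' (not_lt.1 hx)
    rw [Scope.get?_append_add] at hi
    rcases h j δ s hi with ⟨k, hk, hk'⟩ | ⟨u, hu, hN, hu'⟩
    · exact .inl ⟨_, Env.lift_add_inl hk, by simpa using hk'⟩
    · exact .inr ⟨_, Env.lift_add_inr hu, hN, hu'.wk⟩

theorem WEnv.lift {γ γ' : Scope S} {σ : Env C S} (h : WEnv ς γ σ γ') (ξ : Scope S) :
    WEnv ς (γ.append ξ) (σ.lift ξ.length) (γ'.append ξ) :=
  (WEnvLt.lift h ξ).toWEnv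

/-- A renaming instantiates no variable, so every bound holds, even `0`. -/
theorem IsRen.wEnvLt {γ γ' : Scope S} {ρ : ℕ → ℕ} (h : IsRen γ ρ γ') (N : ℕ) :
    WEnvLt ς N γ (Env.ofRen ρ) γ' :=
  fun _ _ _ hi => .inl ⟨_, rfl, h _ _ hi⟩

theorem IsRen.wEnv {γ γ' : Scope S} {ρ : ℕ → ℕ} (h : IsRen γ ρ γ') :
    WEnv ς γ (Env.ofRen ρ) γ' := h.wEnvLt _

/-- The bound is the size of `δ` alone, not of `γ.append δ`, since only the variables of `δ` are
instantiated. This is what makes the inductions on `N` decrease. -/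
theorem wEnvLt_inst {γ δ : Scope S} {us : Expr C} (h : IsExpr ς γ (.sp δ) us) :
    WEnvLt ς (sizeOf δ) (γ.append δ) (Env.inst δ us) γ := by
  intro i ξ s hi
  by_cases hx : i < δ.length
  · rw [Scope.get?_append_of_lt _ hx] at hi
    obtain ⟨u, hu, hu'⟩ := h.exists_arg hi
    exact .inr ⟨u, by simp [Env.inst, hi, hu], Scope.sizeOf_lt_of_get? hi, hu'⟩
  · obtain ⟨j, rfl⟩ := Nat.exists_eq_add_of_le' (not_lt.1 hx)
    rw [Scope.get?_append_add] at hi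
    exact .inl ⟨j, by simp [Env.inst, Scope.get?_eq_none], hi⟩

theorem wEnv_inst {γ δ : Scope S} {us : Expr C} (h : IsExpr ς γ (.sp δ) us) :
    WEnv ς (γ.append δ) (Env.inst δ us) γ := (wEnvLt_inst h).toWEnv

theorem Env.inst_snoc_succ (γ δ : Scope S) (s : S) (ts t : Expr C) (n i : ℕ) :
    Env.inst (γ.snoc δ s) (ts.snoc n t) (i + 1) = Env.inst γ ts i := by
  simp only [inst, Scope.get?, Expr.arg?, Scope.length, Nat.add_sub_add_right]

theorem Env.inst_of_get? {δ ξ : Scope S} {us u : Expr C} {i : ℕ} {s : S}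
    (hi : δ.get? i = some (ξ, s)) (hu : us.arg? i = some u) :
    Env.inst δ us i = .inr (ξ, u) := by simp [Env.inst, hi, hu]

@[simp] theorem Env.inst_add (δ : Scope S) (us : Expr C) (i : ℕ) :
    Env.inst δ us (i + δ.length) = .inl i := by simp [Env.inst, Scope.get?_eq_none]

/-- At a variable replaced by `u` of arity `δ`, the result is the instantiation of `δ` in `u`, an
environment whose bound `sizeOf δ` is below `N`. -/
theorem IsExpr.hsLt {N : ℕ} {γ γ' : Scope S} {K : Kind S} {e : Expr C} {σ : Env C S}
    (he : IsExpr ς γ K e) (h : WEnvLt ς N γ σ γ') : IsExpr ς γ' K (e.hs σ) := by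
  induction N using Nat.strong_induction_on generalizing γ γ' K e σ with
  | _ N ihN =>
    induction he generalizing γ' σ with
    | @var γ δ s i ts hi _ ih =>
      rcases h _ _ _ hi with ⟨j, hj, hj'⟩ | ⟨u, hu, hN, hu'⟩
      · rw [Expr.hs_var_inl hj]
        exact .var hj' (ih h)
      · rw [Expr.hs_var_inr hu, Expr.subst_zero_eq_hs]
        exact ihN _ hN hu' (wEnvLt_inst (ih h))
    | const hc _ ih => exact .const hc (ih h)
    | ty hc _ ih => exact .ty hc (ih h)
    | nil => exact .nil
    | snoc _ hn _ ih ih' => subst hn; exact .snoc (ih h) rfl (ih' (h.lift _))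

theorem IsExpr.hs {γ γ' : Scope S} {K : Kind S} {e : Expr C} {σ : Env C S}
    (he : IsExpr ς γ K e) (h : WEnv ς γ σ γ') : IsExpr ς γ' K (e.hs σ) := IsExpr.hsLt he h

theorem IsExpr.subst {γ δ ξ : Scope S} {K : Kind S} {e us : Expr C}
    (he : IsExpr ς ((γ.append δ).append ξ) K e) (hus : IsExpr ς γ (.sp δ) us) :
    IsExpr ς (γ.append ξ) K (Expr.subst δ us ξ.length e) := by
  rw [Expr.subst_eq_hs]
  exact he.hs ((wEnv_inst hus).lift ξ)

theorem IsExpr.subst_zero {γ δ : Scope S} {K : Kind S} {e us : Expr C}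
    (he : IsExpr ς (γ.append δ) K e) (hus : IsExpr ς γ (.sp δ) us) :
    IsExpr ς γ K (Expr.subst δ us 0 e) := IsExpr.subst (ξ := .nil) he hus

/-! ### Composition of environments -/

namespace Env

/-- The environment `σ` followed by `τ`. -/
def comp (σ τ : Env C S) : Env C S := fun i =>
  match σ i with
  | .inl j => τ j
  | .inr (δ, u) => .inr (δ, u.hs (τ.lift δ.length))

theorem comp_inl {σ τ : Env C S} {i j : ℕ} (h : σ i = .inl j) : comp σ τ i = τ j := by
  simp [comp, h]

theorem comp_inr {σ τ : Env C S} {i : ℕ} {δ : Scope S} {u : Expr C} (h : σ i = .inr (δ, u)) :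
    comp σ τ i = .inr (δ, u.hs (τ.lift δ.length)) := by simp [comp, h]

/-- Precomposition of an instantiation with the weakening by its scope. -/
theorem inst_comp_liftRen_shift (δ : Scope S) (us : Expr C) (k : ℕ) :
    (Env.inst δ us).lift k ∘ liftRen k (· + δ.length) = Env.ofRen id := by
  funext i
  simp only [Function.comp, ofRen, id]
  by_cases hi : i < k
  · rw [liftRen_of_lt _ hi, lift_of_lt _ hi]
  · obtain ⟨j, rfl⟩ := Nat.exists_eq_add_of_le' (not_lt.1 hi)
    rw [liftRen_add, lift_add_inl (inst_add δ us j)]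

end Env

theorem Expr.hs_id (S : Type v) (e : Expr C) : e.hs (Env.ofRen id : Env C S) = e := by
  rw [← ren_eq_hs, ren_id]

/-- Substitution cancels weakening. -/
theorem Expr.hs_inst_wk (δ : Scope S) (us e : Expr C) (k : ℕ) :
    (e.wk δ.length k).hs ((Env.inst δ us).lift k) = e := by
  rw [Expr.wk, wkRen_eq, Expr.hs_ren, Env.inst_comp_liftRen_shift, Expr.hs_id]

theorem Expr.ren_hsLt {N : ℕ} {γ γ' : Scope S} {K : Kind S} {e : Expr C} {σ : Env C S}
    (he : IsExpr ς γ K e) (h : WEnvLt ς N γ σ γ') (ρ : ℕ → ℕ) :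
    (e.hs σ).ren ρ = e.hs (Env.comp σ (Env.ofRen ρ)) := by
  induction N using Nat.strong_induction_on generalizing γ γ' K e σ ρ with
  | _ N ihN =>
    induction he generalizing γ' σ ρ with
    | @var γ δ s i ts hi hts ih =>
      rcases h _ _ _ hi with ⟨j, hj, hj'⟩ | ⟨u, hu, hN, hu'⟩
      · rw [Expr.hs_var_inl hj, Expr.ren, ih h, Expr.hs_var_inl]
        rw [Env.comp_inl hj]; rfl
      · have hts' := hts.hsLt h
        rw [Expr.hs_var_inr hu, Expr.subst_zero_eq_hs, Expr.hs_var_inr (Env.comp_inr hu),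
          Expr.subst_zero_eq_hs, ihN _ hN hu' (wEnvLt_inst hts'), Env.lift_ofRen,
          ← Expr.ren_eq_hs, Expr.hs_ren, ← ih h]
        -- Both sides are now actions on `u`, and two environments remain to be compared: on `δ`
        -- both give the renamed arguments, elsewhere both apply `ρ`.
        apply Expr.hs_congr_get hu'
        intro k hk
        by_cases hkδ : k < δ.length
        · obtain ⟨ξ, s', hx⟩ := Scope.exists_get? hkδ
          obtain ⟨v, hv, -⟩ := hts'.exists_arg hx
          rw [Env.comp_inr (Env.inst_of_get? hx hv), Env.lift_ofRen, ← Expr.ren_eq_hs]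
          simp only [Function.comp, liftRen_of_lt _ hkδ]
          rw [Env.inst_of_get? hx (u := v.ren (liftRen ξ.length ρ))]
          rw [Expr.arg?_ren hts' hx, hv]; rfl
        · obtain ⟨l, rfl⟩ := Nat.exists_eq_add_of_le' (not_lt.1 hkδ)
          rw [Env.comp_inl (Env.inst_add _ _ _)]
          simp [Env.ofRen]
    | const hc _ ih => simp [Expr.hs, Expr.ren, ih h]
    | ty hc _ ih => simp [Expr.hs, Expr.ren, ih h]
    | nil => rfl
    | @snoc γ δ γ'' s ts t n _ hn ht ih ih' =>
      subst hn
      simp only [Expr.hs, Expr.ren, ih h, ih' (h.lift _)]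
      congr 1
      apply Expr.hs_congr_get ht
      intro k hk
      by_cases hkδ : k < γ''.length
      · rw [Env.comp_inl (Env.lift_of_lt _ hkδ), Env.lift_of_lt _ hkδ, Env.ofRen,
          liftRen_of_lt _ hkδ]
      · obtain ⟨l, rfl⟩ := Nat.exists_eq_add_of_le' (not_lt.1 hkδ)
        cases hl : σ l with
        | inl j =>
          rw [Env.comp_inl (Env.lift_add_inl hl), Env.lift_add_inl (j := ρ j)]
          · simp [Env.ofRen]
          · rw [Env.comp_inl hl]; rfl
        | inr x =>
          obtain ⟨ξ, u⟩ := x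
          rw [Env.comp_inr (Env.lift_add_inr hl), Env.lift_add_inr (Env.comp_inr hl),
            Env.lift_ofRen, Env.lift_ofRen, ← Expr.ren_eq_hs, ← Expr.ren_eq_hs, Expr.wk, Expr.wk,
            Expr.ren_ren, Expr.ren_ren, wkRen_eq, ← liftRen_comp, ← liftRen_comp]
          congr 4
          funext i; simp

theorem Expr.ren_hs {γ γ' : Scope S} {K : Kind S} {e : Expr C} {σ : Env C S}
    (he : IsExpr ς γ K e) (h : WEnv ς γ σ γ') (ρ : ℕ → ℕ) :
    (e.hs σ).ren ρ = e.hs (Env.comp σ (Env.ofRen ρ)) := Expr.ren_hsLt he h ρ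

/-- Weakening by `ξ` under `δ` commutes with an environment. -/
theorem Expr.wk_hs {γ γ' δ : Scope S} {K : Kind S} {e : Expr C} {σ : Env C S}
    (he : IsExpr ς (γ.append δ) K e) (h : WEnv ς γ σ γ') (n : ℕ) :
    (e.hs (σ.lift δ.length)).wk n δ.length =
      (e.wk n δ.length).hs ((σ.lift n).lift δ.length) := by
  rw [Expr.wk, Expr.ren_hs he (h.lift δ), Expr.wk, Expr.hs_ren]
  apply Expr.hs_congr_get he
  intro k hk
  rw [wkRen_eq]
  by_cases hkδ : k < δ.length
  · simp only [Function.comp, liftRen_of_lt _ hkδ]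
    rw [Env.comp_inl (Env.lift_of_lt _ hkδ), Env.lift_of_lt _ hkδ, Env.ofRen,
      liftRen_of_lt _ hkδ]
  · obtain ⟨l, rfl⟩ := Nat.exists_eq_add_of_le' (not_lt.1 hkδ)
    simp only [Function.comp, liftRen_add]
    cases hl : σ l with
    | inl j =>
      rw [Env.comp_inl (Env.lift_add_inl hl), Env.lift_add_inl (Env.lift_add_inl hl)]
      simp [Env.ofRen]
    | inr x =>
      obtain ⟨ξ, u⟩ := x
      rw [Env.comp_inr (Env.lift_add_inr hl), Env.lift_add_inr (Env.lift_add_inr hl),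
        Env.lift_ofRen, ← Expr.ren_eq_hs, wk_wk_same, wk, wk, ren_ren, wkRen_eq, wkRen_eq,
        ← liftRen_comp]
      congr 4
      funext i; simp [Function.comp]; omega

/-- Restricted to the variables in scope: the entries of `σ` must be well-scoped for weakening to
commute with `τ`. -/
theorem Env.lift_comp {γ γ' γ'' ξ : Scope S} {σ τ : Env C S} (hσ : WEnv ς γ σ γ')
    (hτ : WEnv ς γ' τ γ'') {i : ℕ} (hi : i < (γ.append ξ).length) :
    (Env.comp σ τ).lift ξ.length i = Env.comp (σ.lift ξ.length) (τ.lift ξ.length) i := by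
  by_cases hk : i < ξ.length
  · rw [lift_of_lt _ hk, comp_inl (lift_of_lt _ hk), lift_of_lt _ hk]
  · obtain ⟨l, rfl⟩ := Nat.exists_eq_add_of_le' (not_lt.1 hk)
    obtain ⟨δ, s, hl⟩ := Scope.exists_get? (γ := γ) (i := l) (by simpa using hi)
    rcases hσ _ _ _ hl with ⟨j, hj, hj'⟩ | ⟨u, hu, -, hu'⟩
    · rw [comp_inl (lift_add_inl hj)]
      rcases hτ _ _ _ hj' with ⟨k, hk, -⟩ | ⟨w, hw, -, -⟩
      · rw [lift_add_inl hk, lift_add_inl (j := k)]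
        rw [comp_inl hj, hk]
      · rw [lift_add_inr hw, lift_add_inr (δ := δ) (u := w)]
        rw [comp_inl hj, hw]
    · rw [comp_inr (lift_add_inr hu), lift_add_inr (comp_inr hu), Expr.wk_hs hu' hτ]

/-- The induction is on the sum of the two bounds. When `σ` replaces a variable of arity `δ` by `u`,
one side instantiates `δ` in `u` and then applies `τ`, the other applies `τ` and then instantiates
`δ`. Both are compositions with `sizeOf δ` in place of `N`, so both can be fused by the induction
hypothesis and compared on `u`. -/
theorem Expr.hs_comp_aux {N M : ℕ} {γ γ' γ'' : Scope S} {K : Kind S} {e : Expr C} {σ τ : Env C S}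
    (he : IsExpr ς γ K e) (hσ : WEnvLt ς N γ σ γ') (hτ : WEnvLt ς M γ' τ γ'') :
    (e.hs σ).hs τ = e.hs (Env.comp σ τ) := by
  induction hL : N + M using Nat.strong_induction_on generalizing N M γ γ' γ'' K e σ τ with
  | _ L ihL =>
    induction he generalizing γ' γ'' σ τ with
    | @var γ δ s i ts hi hts ih =>
      have hts' := hts.hsLt hσ
      have hts'' := hts'.hsLt hτ
      rcases hσ _ _ _ hi with ⟨j, hj, hj'⟩ | ⟨u, hu, hN, hu'⟩
      · rw [Expr.hs_var_inl hj]
        simp only [Expr.hs, Env.comp_inl hj, ih hσ hτ]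
      · rw [Expr.hs_var_inr hu, Expr.hs_var_inr (Env.comp_inr hu), Expr.subst_zero_eq_hs,
          Expr.subst_zero_eq_hs, ihL _ (by omega) hu' (wEnvLt_inst hts') hτ rfl,
          ihL (M + sizeOf δ) (by omega) hu' (hτ.lift δ) (wEnvLt_inst (ih hσ hτ ▸ hts'')) rfl,
          ← ih hσ hτ]
        apply Expr.hs_congr_get hu'
        intro k hk
        by_cases hkδ : k < δ.length
        · obtain ⟨ξ, s', hx⟩ := Scope.exists_get? hkδ
          obtain ⟨v, hv, -⟩ := hts'.exists_arg hx
          rw [Env.comp_inr (Env.inst_of_get? hx hv), Env.comp_inl (Env.lift_of_lt _ hkδ),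
            Env.inst_of_get? hx]
          rw [Expr.arg?_hs hts' hx, hv]; rfl
        · obtain ⟨l, rfl⟩ := Nat.exists_eq_add_of_le' (not_lt.1 hkδ)
          rw [Env.comp_inl (Env.inst_add _ _ _)]
          cases hl : τ l with
          | inl j => rw [Env.comp_inl (Env.lift_add_inl hl), Env.inst_add]
          | inr x =>
            obtain ⟨ξ, w⟩ := x
            -- An entry of `τ` was weakened by `δ` when lifted, and instantiating `δ` undoes this.
            rw [Env.comp_inr (Env.lift_add_inr hl), Expr.hs_inst_wk]
    | const hc _ ih => simp [Expr.hs, ih hσ hτ]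
    | ty hc _ ih => simp [Expr.hs, ih hσ hτ]
    | nil => rfl
    | @snoc γ δ γ'' s ts t n _ hn ht ih ih' =>
      subst hn
      simp only [Expr.hs, ih hσ hτ, ih' (hσ.lift _) (hτ.lift _)]
      congr 1
      apply Expr.hs_congr_get ht
      intro k hk
      rw [Env.lift_comp hσ.toWEnv hτ.toWEnv hk]

/-- Composition of hereditary substitutions. -/
theorem Expr.hs_comp {γ γ' γ'' : Scope S} {K : Kind S} {e : Expr C} {σ τ : Env C S}
    (he : IsExpr ς γ K e) (hσ : WEnv ς γ σ γ') (hτ : WEnv ς γ' τ γ'') :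
    (e.hs σ).hs τ = e.hs (Env.comp σ τ) := Expr.hs_comp_aux he hσ hτ

theorem WEnv.comp {γ γ' γ'' : Scope S} {σ τ : Env C S} (hσ : WEnv ς γ σ γ')
    (hτ : WEnv ς γ' τ γ'') : WEnv ς γ (Env.comp σ τ) γ'' := by
  intro i δ s hi
  rcases hσ _ _ _ hi with ⟨j, hj, hj'⟩ | ⟨u, hu, hN, hu'⟩
  · rw [Env.comp_inl hj]
    rcases hτ _ _ _ hj' with h | ⟨w, hw, -, hw'⟩
    · exact .inl h
    · exact .inr ⟨w, hw, Scope.sizeOf_lt_of_get? hi, hw'⟩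
  · exact .inr ⟨_, Env.comp_inr hu, hN, hu'.hs (hτ.lift δ)⟩

/-! ### Identity spines -/

theorem isExpr_idSp (ς : PreSig C S) (γ : Scope S) : IsExpr ς γ (.sp γ) (idSp γ) := by
  induction γ with
  | nil => exact .nil
  | snoc γ δ s ih ih' =>
    refine .snoc (IsExpr.wk_zero (ξ := .snoc .nil δ s) ih) rfl (.var (δ := δ) ?_ ?_)
    · exact (congrArg _ (Nat.zero_add _).symm).trans (Scope.get?_append_add _ δ 0)
    · exact ih'.left_append _

/-- Identity spines contain no constants, so they are well-scoped over the empty pre-signature and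
no `ς` needs to be mentioned. -/
theorem idSp_ren (γ : Scope S) {ρ : ℕ → ℕ} (h : ∀ i < γ.length, ρ i = i) :
    (idSp γ : Expr C).ren ρ = idSp γ :=
  (Expr.ren_congr_get (isExpr_idSp [] γ) h).trans (Expr.ren_id _)

theorem idSp_hs (γ : Scope S) {σ : Env C S} (h : ∀ i < γ.length, σ i = .inl i) :
    (idSp γ : Expr C).hs σ = idSp γ :=
  (Expr.hs_congr_get (isExpr_idSp [] γ) h).trans (Expr.hs_id S _)

theorem arg?_idSp {γ δ : Scope S} {i : ℕ} {s : S} (hi : γ.get? i = some (δ, s)) :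
    (idSp γ : Expr C).arg? i = some (.var (i + δ.length) (idSp δ)) := by
  induction γ generalizing i with
  | nil => simp [Scope.get?] at hi
  | snoc γ δ' s' ih _ =>
    cases i with
    | zero =>
      simp only [Scope.get?, Option.some.injEq, Prod.mk.injEq] at hi
      obtain ⟨rfl, rfl⟩ := hi
      simp [idSp, Expr.arg?]
    | succ i =>
      simp only [idSp, Expr.arg?, Expr.wk]
      rw [Expr.arg?_ren (isExpr_idSp [] γ) hi, ih hi, wkRen_eq]
      simp only [Option.map_some, Expr.ren, liftRen_add]
      rw [idSp_ren _ (fun k hk => liftRen_of_lt _ hk)]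
      congr 2

namespace Env

/-- The expression, under binders for its arity, by which an environment replaces a variable. -/
def entry (δ : Scope S) : ℕ ⊕ (Scope S × Expr C) → Expr C
  | .inl j => .var (j + δ.length) (idSp δ)
  | .inr (_, u) => u

/-- Equality of environments on a scope up to eta-expansion of variables. -/
def Eqv (γ : Scope S) (σ τ : Env C S) : Prop :=
  ∀ i δ s, γ.get? i = some (δ, s) → entry δ (σ i) = entry δ (τ i)

theorem entry_lift {γ γ' : Scope S} {σ : Env C S} (hσ : WEnv ς γ σ γ') {i n : ℕ} {δ : Scope S}
    {s : S} (hi : γ.get? i = some (δ, s)) :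
    entry δ (σ.lift n (i + n)) = (entry δ (σ i)).wk n δ.length := by
  rcases hσ _ _ _ hi with ⟨j, hj, hj'⟩ | ⟨u, hu, hN, hu'⟩
  · rw [lift_add_inl hj, hj, entry, entry, Expr.wk, Expr.ren, wkRen_eq, liftRen_add,
      idSp_ren _ (fun k hk => liftRen_of_lt _ hk)]
  · rw [lift_add_inr hu, hu]; rfl

theorem Eqv.lift {γ γ' γ'' : Scope S} {σ τ : Env C S} (h : Eqv γ σ τ) (hσ : WEnv ς γ σ γ')
    (hτ : WEnv ς γ τ γ'') (ξ : Scope S) :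
    Eqv (γ.append ξ) (σ.lift ξ.length) (τ.lift ξ.length) := by
  intro i δ s hi
  by_cases hk : i < ξ.length
  · rw [lift_of_lt _ hk, lift_of_lt _ hk]
  · obtain ⟨l, rfl⟩ := Nat.exists_eq_add_of_le' (not_lt.1 hk)
    rw [Scope.get?_append_add] at hi
    rw [entry_lift hσ hi, entry_lift hτ hi, h _ _ _ hi]

end Env

/-- Substituting a spine into the identity spine. -/
theorem idSp_inst_aux {γ ξ : Scope S} {us : Expr C}
    (hid : ∀ ⦃δ : Scope S⦄, sizeOf δ < sizeOf γ → ∀ ⦃ξ' : Scope S⦄ ⦃K : Kind S⦄ ⦃e : Expr C⦄,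
      IsExpr ς (ξ'.append δ) K e →
      (e.wk δ.length δ.length).hs (Env.inst δ (idSp δ)) = e)
    (hus : IsExpr ς ξ (.sp γ) us) : (idSp γ).hs (Env.inst γ us) = us := by
  induction γ generalizing us with
  | nil => cases hus; rfl
  | snoc γ δ s ih _ =>
    cases hus with
    | @snoc _ _ _ _ ts t n hts hn ht =>
      subst hn
      simp only [idSp, Expr.hs]
      congr 1
      · rw [Expr.wk, Expr.hs_ren]
        refine Eq.trans ?_ (ih (fun δ' h => hid (by simp only [Scope.snoc.sizeOf_spec]; omega)) hts)
        congr 1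
        funext i
        exact Env.inst_snoc_succ _ _ _ _ _ _ i
      · have h0 : Env.inst (γ.snoc δ s) (ts.snoc δ.length t) 0 = .inr (δ, t) := rfl
        have h1 := Env.lift_add_inr (n := δ.length) h0
        rw [Nat.zero_add] at h1
        rw [h1]
        simp only
        rw [idSp_hs _ (fun k hk => Env.lift_of_lt _ hk), Expr.subst_zero_eq_hs]
        exact hid (by simp only [Scope.snoc.sizeOf_spec]; omega) ht

/-- The laws `id[us] = us` and `e[id] = e` depend on each other: the former for a scope uses the
latter for the arities in it, and conversely. The circle is broken by induction on the size of `δ`,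
`idSp_inst_aux` being stated relative to the latter law for smaller scopes. -/
theorem Expr.hs_idSp_aux (δ : Scope S) : ∀ (ξ : Scope S) (K : Kind S) (e : Expr C),
      IsExpr ς (ξ.append δ) K e →
      (e.wk δ.length δ.length).hs (Env.inst δ (idSp δ)) = e := by
  induction hN : sizeOf δ using Nat.strong_induction_on generalizing δ with
  | _ N ihN =>
    subst hN
    -- The statement is generalized to environments that send each variable to itself or to its own
    -- eta-expansion, a class closed under lifting.
    have key : ∀ (γ : Scope S) (K : Kind S) (e : Expr C) (σ : Env C S), IsExpr ς γ K e →
        (∀ i ξ s, γ.get? i = some (ξ, s) →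
          σ i = .inl i ∨ (sizeOf ξ < sizeOf δ ∧ σ i = .inr (ξ, .var (i + ξ.length) (idSp ξ)))) →
        e.hs σ = e := by
      intro γ K e σ he hσ
      induction he generalizing σ with
      | @var γ ξ s i ts hi hts ih =>
        rcases hσ _ _ _ hi with h | ⟨hlt, h⟩
        · rw [Expr.hs_var_inl h, ih σ hσ]
        · rw [Expr.hs_var_inr h, ih σ hσ, Expr.subst_zero_eq_hs,
            Expr.hs_var_inl (Env.inst_add _ _ _), idSp_inst_aux ?_ hts]
          intro δ' hlt' ξ' K e he
          exact ihN _ (hlt'.trans hlt) _ rfl _ _ _ he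
      | const hc _ ih => simp [Expr.hs, ih σ hσ]
      | ty hc _ ih => simp [Expr.hs, ih σ hσ]
      | nil => rfl
      | @snoc γ δ' γ'' s ts t n _ hn ht ih ih' =>
        subst hn
        simp only [Expr.hs, ih σ hσ]
        congr 1
        apply ih'
        intro i ξ s hi
        by_cases hk : i < γ''.length
        · exact .inl (Env.lift_of_lt _ hk)
        · obtain ⟨l, rfl⟩ := Nat.exists_eq_add_of_le' (not_lt.1 hk)
          rw [Scope.get?_append_add] at hi
          rcases hσ _ _ _ hi with h | ⟨hlt, h⟩
          · exact .inl (Env.lift_add_inl h)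
          · refine .inr ⟨hlt, ?_⟩
            rw [Env.lift_add_inr h, Expr.wk, Expr.ren, wkRen_eq, liftRen_add,
              idSp_ren _ (fun k hk => liftRen_of_lt _ hk)]
    intro ξ K e he
    rw [Expr.wk, Expr.hs_ren]
    refine key _ _ _ _ he ?_
    intro i ξ' s hi
    rw [wkRen_eq]
    by_cases hk : i < δ.length
    · rw [Scope.get?_append_of_lt _ hk] at hi
      refine .inr ⟨Scope.sizeOf_lt_of_get? hi, ?_⟩
      simp only [Function.comp, liftRen_of_lt _ hk]
      exact Env.inst_of_get? hi (arg?_idSp hi)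
    · obtain ⟨l, rfl⟩ := Nat.exists_eq_add_of_le' (not_lt.1 hk)
      left
      simp only [Function.comp, liftRen_add, Env.inst_add]

theorem idSp_inst {γ ξ : Scope S} {us : Expr C} (hus : IsExpr ς ξ (.sp γ) us) :
    (idSp γ).hs (Env.inst γ us) = us :=
  idSp_inst_aux (fun δ _ ξ' K e he => Expr.hs_idSp_aux δ ξ' K e he) hus

/-- Substituting an eta-expanded variable. -/
theorem hs_var_entry {γ γ' δ : Scope S} {σ : Env C S} (hσ : WEnv ς γ σ γ') {i : ℕ} {s : S}
    {ts : Expr C} (hi : γ.get? i = some (δ, s)) (hts : IsExpr ς γ (.sp δ) ts) :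
    (Expr.var i ts).hs σ = (Env.entry δ (σ i)).hs (Env.inst δ (ts.hs σ)) := by
  rcases hσ _ _ _ hi with ⟨j, hj, hj'⟩ | ⟨u, hu, hN, hu'⟩
  · rw [Expr.hs_var_inl hj, hj, Env.entry, Expr.hs_var_inl (Env.inst_add _ _ _),
      idSp_inst (hts.hs hσ)]
  · rw [Expr.hs_var_inr hu, hu, Expr.subst_zero_eq_hs]; rfl

/-- Environments that are equal up to eta-expansion have the same action. -/
theorem Expr.hs_congr {γ γ' γ'' : Scope S} {K : Kind S} {e : Expr C} {σ τ : Env C S}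
    (he : IsExpr ς γ K e) (hσ : WEnv ς γ σ γ') (hτ : WEnv ς γ τ γ'') (h : Env.Eqv γ σ τ) :
    e.hs σ = e.hs τ := by
  induction he generalizing γ' γ'' σ τ with
  | var hi hts ih =>
    rw [hs_var_entry hσ hi hts, hs_var_entry hτ hi hts, ih hσ hτ h, h _ _ _ hi]
  | const _ _ ih => simp only [hs, ih hσ hτ h]
  | ty _ _ ih => simp only [hs, ih hσ hτ h]
  | nil => rfl
  | snoc _ hn _ ih ih' =>
    subst hn
    simp only [hs, ih hσ hτ h, ih' (hσ.lift _) (hτ.lift _) (h.lift hσ hτ _)]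

end

/-! ### Substitution in types, contexts and spines -/

section

variable {C : Type u} {S : Type v}

/-! ### Types and contexts -/

namespace Ty

/-- Action of an environment. -/
def hs (σ : Env C S) (T : Ty C) : Ty C := ⟨T.head, T.args.hs σ⟩

@[simp] theorem expr_hs (σ : Env C S) (T : Ty C) : (T.hs σ).expr = T.expr.hs σ := rfl

@[simp] theorem erase_hs (nrm : C ↪ S) (σ : Env C S) (T : Ty C) :
    (T.hs σ).erase nrm = T.erase nrm := rfl

theorem ren_eq_hs (S : Type v) (ρ : ℕ → ℕ) (T : Ty C) :
    T.ren ρ = T.hs (Env.ofRen ρ : Env C S) := by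
  simp only [ren, hs, Expr.ren_eq_hs S]

theorem subst_eq_hs (γ : Scope S) (us : Expr C) (k : ℕ) (T : Ty C) :
    T.subst γ us k = T.hs ((Env.inst γ us).lift k) := by
  simp only [subst, hs, Expr.subst_eq_hs]

theorem wk_eq_hs (S : Type v) (n k : ℕ) (T : Ty C) :
    T.wk n k = T.hs ((Env.ofRen (· + n) : Env C S).lift k) := by
  rw [wk, ren_eq_hs S, wkRen_eq, Env.lift_ofRen]

theorem ext_expr {T U : Ty C} (h : T.expr = U.expr) : T = U := by
  cases T; cases U; cases h; rfl

end Ty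

theorem Expr.wk_eq_hs (S : Type v) (n k : ℕ) (e : Expr C) :
    e.wk n k = e.hs ((Env.ofRen (· + n) : Env C S).lift k) := by
  rw [wk, ren_eq_hs S, wkRen_eq, Env.lift_ofRen]

namespace Ctx

/-- Action of an environment. -/
def hs (σ : Env C S) : Ctx C → Ctx C
  | nil => nil
  | snoc Γ Δ T => snoc (Γ.hs σ) (Δ.hs (σ.lift Γ.length)) (T.hs ((σ.lift Γ.length).lift Δ.length))

@[simp] theorem length_append (Γ Δ : Ctx C) : (Γ.append Δ).length = Γ.length + Δ.length := by
  induction Δ with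
  | nil => rfl
  | snoc Δ _ _ ih _ => simp only [append, length, ih]; omega

theorem append_assoc (Γ Δ Ξ : Ctx C) : (Γ.append Δ).append Ξ = Γ.append (Δ.append Ξ) := by
  induction Ξ with
  | nil => rfl
  | snoc Ξ _ _ ih _ => simp only [append, ih]

@[simp] theorem nil_append (Γ : Ctx C) : Ctx.nil.append Γ = Γ := by
  induction Γ with
  | nil => rfl
  | snoc Ξ _ _ ih _ => simp only [append, ih]

@[simp] theorem append_nil (Γ : Ctx C) : Γ.append .nil = Γ := rfl

@[simp] theorem erase_append (nrm : C ↪ S) (Γ Δ : Ctx C) :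
    (Γ.append Δ).erase nrm = (Γ.erase nrm).append (Δ.erase nrm) := by
  induction Δ with
  | nil => rfl
  | snoc Δ _ _ ih _ => simp only [append, erase, ih, Scope.append]

@[simp] theorem length_erase (nrm : C ↪ S) (Γ : Ctx C) : (Γ.erase nrm).length = Γ.length := by
  induction Γ with
  | nil => rfl
  | snoc Γ _ _ ih _ => simp only [erase, length, Scope.length, ih]

@[simp] theorem length_hs (σ : Env C S) (Γ : Ctx C) : (Γ.hs σ).length = Γ.length := by
  induction Γ generalizing σ with
  | nil => rfl
  | snoc Γ _ _ ih _ => simp only [hs, length, ih]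

@[simp] theorem erase_hs (nrm : C ↪ S) (σ : Env C S) (Γ : Ctx C) :
    (Γ.hs σ).erase nrm = Γ.erase nrm := by
  induction Γ generalizing σ with
  | nil => rfl
  | snoc Γ _ _ ih ih' => simp only [hs, erase, ih, ih', Ty.erase_hs]

theorem hs_append (σ : Env C S) (Γ Δ : Ctx C) :
    (Γ.append Δ).hs σ = (Γ.hs σ).append (Δ.hs (σ.lift Γ.length)) := by
  induction Δ with
  | nil => rfl
  | snoc Δ _ _ ih _ => simp only [append, hs, ih, Env.lift_lift, length_append]

theorem ren_eq_hs (S : Type v) (ρ : ℕ → ℕ) (Γ : Ctx C) :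
    Γ.ren ρ = Γ.hs (Env.ofRen ρ : Env C S) := by
  induction Γ generalizing ρ with
  | nil => rfl
  | snoc Γ Δ T ih ih' =>
    simp only [ren, hs, ih, ih', Env.lift_ofRen, Ty.ren_eq_hs S, liftRen_liftRen]

theorem subst_eq_hs (γ : Scope S) (us : Expr C) (k : ℕ) (Γ : Ctx C) :
    Γ.subst γ us k = Γ.hs ((Env.inst γ us).lift k) := by
  induction Γ generalizing k with
  | nil => rfl
  | snoc Γ Δ T ih ih' => simp only [subst, hs, ih, ih', Ty.subst_eq_hs, Env.lift_lift]

theorem wk_eq_hs (S : Type v) (n k : ℕ) (Γ : Ctx C) :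
    Γ.wk n k = Γ.hs ((Env.ofRen (· + n) : Env C S).lift k) := by
  rw [wk, ren_eq_hs S, wkRen_eq, Env.lift_ofRen]

theorem _root_.CompLF.Env.lift_id (n : ℕ) : (Env.ofRen id : Env C S).lift n = Env.ofRen id := by
  rw [Env.lift_ofRen]
  congr 1; funext i; simp only [liftRen, id]; split_ifs <;> omega

theorem hs_id (S : Type v) (Γ : Ctx C) : Γ.hs (Env.ofRen id : Env C S) = Γ := by
  induction Γ with
  | nil => rfl
  | snoc Γ Δ T ih ih' => simp only [hs, Env.lift_id, ih, ih', Ty.hs, Expr.hs_id]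

end Ctx

@[simp] theorem Ty.hs_id (S : Type v) (T : Ty C) : T.hs (Env.ofRen id : Env C S) = T := by
  simp [Ty.hs, Expr.hs_id]

variable {ς : PreSig C S} {nrm : C ↪ S}

theorem IsTy.hs {γ γ' : Scope S} {T : Ty C} {σ : Env C S} (hT : IsTy ς γ T)
    (h : WEnv ς γ σ γ') : IsTy ς γ' (T.hs σ) := IsExpr.hs hT h

theorem IsCtx.hs {γ γ' : Scope S} {Γ : Ctx C} {σ : Env C S} (hΓ : IsCtx nrm ς γ Γ)
    (h : WEnv ς γ σ γ') : IsCtx nrm ς γ' (Γ.hs σ) := by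
  induction Γ generalizing γ γ' σ with
  | nil => trivial
  | snoc Γ Δ T ih ih' =>
    obtain ⟨h1, h2, h3⟩ := hΓ
    have hl := h.lift (Γ.erase nrm)
    have hl' := hl.lift (Δ.erase nrm)
    rw [Ctx.length_erase] at hl
    rw [Ctx.length_erase, Ctx.length_erase] at hl'
    refine ⟨ih h1 h, ?_, ?_⟩
    · rw [Ctx.erase_hs]; exact ih' h2 hl
    · rw [Ctx.erase_hs, Ctx.erase_hs]; exact h3.hs hl'

theorem IsCtx.append {γ : Scope S} {Γ Δ : Ctx C} :
    IsCtx nrm ς γ (Γ.append Δ) ↔ IsCtx nrm ς γ Γ ∧ IsCtx nrm ς (γ.append (Γ.erase nrm)) Δ := by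
  induction Δ with
  | nil => simp [IsCtx]
  | snoc Δ Ξ T ih _ =>
    simp only [Ctx.append, IsCtx, ih, Ctx.erase_append, Scope.append_assoc, and_assoc]

theorem IsCtx.mono {ς' : PreSig C S} (hς : ς ⊆ ς') {γ : Scope S} {Γ : Ctx C}
    (h : IsCtx nrm ς γ Γ) : IsCtx nrm ς' γ Γ := by
  induction Γ generalizing γ with
  | nil => trivial
  | snoc Γ Δ T ih ih' => exact ⟨ih h.1, ih' h.2.1, IsExpr.mono hς h.2.2⟩

theorem IsCtx.left_append {ξ : Scope S} {Γ : Ctx C} (h : IsCtx nrm ς ξ Γ) (γ : Scope S) :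
    IsCtx nrm ς (γ.append ξ) Γ := by
  have := h.hs (isRen_id_append γ ξ).wEnv
  rwa [Ctx.hs_id] at this

/-- Environments `σ`, `σ'` with equal actions on the scope `γ`. -/
def Env.Same (ς : PreSig C S) (γ : Scope S) (σ σ' : Env C S) : Prop :=
  ∃ γ₁ γ₂, WEnv ς γ σ γ₁ ∧ WEnv ς γ σ' γ₂ ∧ Env.Eqv γ σ σ'

/-- Pairs of environments whose compositions have equal actions on the scope `γ`. -/
def Env.Comm (ς : PreSig C S) (γ : Scope S) (σ τ σ' τ' : Env C S) : Prop :=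
  ∃ γ₁ γ₂ γ₁' γ₂', WEnv ς γ σ γ₁ ∧ WEnv ς γ₁ τ γ₂ ∧ WEnv ς γ σ' γ₁' ∧ WEnv ς γ₁' τ' γ₂' ∧
    Env.Eqv γ (Env.comp σ τ) (Env.comp σ' τ')

namespace Env

theorem Eqv.trans {γ : Scope S} {σ τ ρ : Env C S} (h : Eqv γ σ τ) (h' : Eqv γ τ ρ) :
    Eqv γ σ ρ :=
  fun i δ s hi => (h i δ s hi).trans (h' i δ s hi)

theorem Eqv.of_eq {γ : Scope S} {σ τ : Env C S} (h : ∀ i < γ.length, σ i = τ i) : Eqv γ σ τ :=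
  fun i _ _ hi => by rw [h i (Scope.lt_of_get? hi)]

theorem Same.lift {γ : Scope S} {σ σ' : Env C S} (h : Same ς γ σ σ') (ξ : Scope S) :
    Same ς (γ.append ξ) (σ.lift ξ.length) (σ'.lift ξ.length) := by
  obtain ⟨γ₁, γ₂, h1, h2, h⟩ := h
  exact ⟨_, _, h1.lift ξ, h2.lift ξ, h.lift h1 h2 ξ⟩

/-- Closure under binders allows a commutation to be checked once, on variables, and then used for
expressions, types and contexts alike. -/
theorem Comm.lift {γ : Scope S} {σ τ σ' τ' : Env C S} (h : Comm ς γ σ τ σ' τ') (ξ : Scope S) :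
    Comm ς (γ.append ξ) (σ.lift ξ.length) (τ.lift ξ.length) (σ'.lift ξ.length)
      (τ'.lift ξ.length) := by
  obtain ⟨γ₁, γ₂, γ₁', γ₂', h1, h2, h1', h2', h⟩ := h
  refine ⟨_, _, _, _, h1.lift ξ, h2.lift ξ, h1'.lift ξ, h2'.lift ξ, ?_⟩
  refine (Eqv.of_eq fun i hi => (lift_comp h1 h2 hi).symm).trans ?_
  refine (h.lift (h1.comp h2) (h1'.comp h2') ξ).trans ?_
  exact Eqv.of_eq fun i hi => lift_comp h1' h2' hi

theorem Same.expr {γ : Scope S} {σ σ' : Env C S} (h : Same ς γ σ σ') {K : Kind S} {e : Expr C}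
    (he : IsExpr ς γ K e) : e.hs σ = e.hs σ' := by
  obtain ⟨γ₁, γ₂, h1, h2, h⟩ := h
  exact Expr.hs_congr he h1 h2 h

theorem Comm.expr {γ : Scope S} {σ τ σ' τ' : Env C S} (h : Comm ς γ σ τ σ' τ') {K : Kind S}
    {e : Expr C} (he : IsExpr ς γ K e) : (e.hs σ).hs τ = (e.hs σ').hs τ' := by
  obtain ⟨γ₁, γ₂, γ₁', γ₂', h1, h2, h1', h2', h⟩ := h
  rw [Expr.hs_comp he h1 h2, Expr.hs_comp he h1' h2']
  exact Expr.hs_congr he (h1.comp h2) (h1'.comp h2') h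

theorem Same.ty {γ : Scope S} {σ σ' : Env C S} (h : Same ς γ σ σ') {T : Ty C}
    (hT : IsTy ς γ T) : T.hs σ = T.hs σ' := Ty.ext_expr (h.expr hT)

theorem Comm.ty {γ : Scope S} {σ τ σ' τ' : Env C S} (h : Comm ς γ σ τ σ' τ') {T : Ty C}
    (hT : IsTy ς γ T) : (T.hs σ).hs τ = (T.hs σ').hs τ' := Ty.ext_expr (h.expr hT)

theorem Same.ctx {γ : Scope S} {σ σ' : Env C S} (h : Same ς γ σ σ') {Γ : Ctx C}
    (hΓ : IsCtx nrm ς γ Γ) : Γ.hs σ = Γ.hs σ' := by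
  induction Γ generalizing γ σ σ' with
  | nil => rfl
  | snoc Γ Δ T ih ih' =>
    obtain ⟨h1, h2, h3⟩ := hΓ
    simp only [Ctx.hs]
    have hl := h.lift (Γ.erase nrm)
    have hl' := hl.lift (Δ.erase nrm)
    simp only [Ctx.length_erase] at hl hl'
    rw [ih h h1, ih' hl h2, hl'.ty h3]

theorem Comm.ctx {γ : Scope S} {σ τ σ' τ' : Env C S} (h : Comm ς γ σ τ σ' τ') {Γ : Ctx C}
    (hΓ : IsCtx nrm ς γ Γ) : (Γ.hs σ).hs τ = (Γ.hs σ').hs τ' := by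
  induction Γ generalizing γ σ τ σ' τ' with
  | nil => rfl
  | snoc Γ Δ T ih ih' =>
    obtain ⟨h1, h2, h3⟩ := hΓ
    simp only [Ctx.hs]
    have hl := h.lift (Γ.erase nrm)
    have hl' := hl.lift (Δ.erase nrm)
    simp only [Ctx.length_erase] at hl hl'
    rw [ih h h1]
    simp only [Ctx.length_hs]
    rw [ih' hl h2, hl'.ty h3]

theorem comp_ofRen (ρ : ℕ → ℕ) (σ : Env C S) (i : ℕ) : comp (ofRen ρ) σ i = σ (ρ i) := rfl

theorem comp_ofRen_id (σ : Env C S) : comp (ofRen id) σ = σ := rfl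

theorem wEnv_id (ς : PreSig C S) (γ : Scope S) : WEnv ς γ (ofRen id) γ :=
  IsRen.wEnv fun _ _ h => h

theorem wEnv_shift (ς : PreSig C S) (γ ξ : Scope S) :
    WEnv ς γ (ofRen (· + ξ.length)) (γ.append ξ) := (isRen_shift γ ξ).wEnv

/-- An instantiation followed by an environment. -/
theorem comm_inst {γ γ' δ : Scope S} {us : Expr C} {σ : Env C S} (hus : IsExpr ς γ (.sp δ) us)
    (hσ : WEnv ς γ σ γ') :
    Comm ς (γ.append δ) (inst δ us) σ (σ.lift δ.length) (inst δ (us.hs σ)) := by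
  refine ⟨_, _, _, _, wEnv_inst hus, hσ, hσ.lift δ, wEnv_inst (hus.hs hσ), Eqv.of_eq ?_⟩
  intro i hi
  by_cases hk : i < δ.length
  · obtain ⟨ξ, s', hx⟩ := Scope.exists_get? hk
    obtain ⟨v, hv, -⟩ := hus.exists_arg hx
    rw [comp_inr (inst_of_get? hx hv), comp_inl (lift_of_lt _ hk), inst_of_get? hx]
    rw [Expr.arg?_hs hus hx, hv]; rfl
  · obtain ⟨l, rfl⟩ := Nat.exists_eq_add_of_le' (not_lt.1 hk)
    rw [comp_inl (inst_add _ _ _)]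
    cases hl : σ l with
    | inl j => rw [comp_inl (lift_add_inl hl), inst_add]
    | inr x =>
      obtain ⟨ξ, w⟩ := x
      rw [comp_inr (lift_add_inr hl), Expr.hs_inst_wk]

/-- A weakening followed by an environment. -/
theorem comm_shift {γ γ' : Scope S} {σ : Env C S} (hσ : WEnv ς γ σ γ') (ξ : Scope S) :
    Comm ς γ (ofRen (· + ξ.length)) (σ.lift ξ.length) σ (ofRen (· + ξ.length)) := by
  refine ⟨_, _, _, _, wEnv_shift ς γ ξ, hσ.lift ξ, hσ, wEnv_shift ς γ' ξ, Eqv.of_eq ?_⟩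
  intro i _
  rw [comp_ofRen]
  cases hl : σ i with
  | inl j => rw [comp_inl hl, lift_add_inl hl]; rfl
  | inr x =>
    obtain ⟨δ, w⟩ := x
    rw [comp_inr hl, lift_add_inr hl, Expr.wk_eq_hs S]

/-- The identity spine has no effect. -/
theorem comm_idSp (ς : PreSig C S) (γ δ : Scope S) :
    Comm ς (γ.append δ) ((ofRen (· + δ.length)).lift δ.length) (inst δ (idSp δ)) (ofRen id)
      (ofRen id) := by
  have hid : IsExpr ς (γ.append δ) (.sp δ) (idSp δ) := (isExpr_idSp ς δ).left_append _
  refine ⟨_, _, _, _, (wEnv_shift ς γ δ).lift δ, wEnv_inst hid, wEnv_id ς _, wEnv_id ς _, ?_⟩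
  -- Equality holds only up to eta: a variable of `δ` is replaced by its eta-expansion, not by
  -- itself.
  intro i ξ s hi
  rw [lift_ofRen, comp_ofRen, comp_ofRen]
  by_cases hk : i < δ.length
  · rw [Scope.get?_append_of_lt _ hk] at hi
    rw [liftRen_of_lt _ hk, inst_of_get? hi (arg?_idSp hi)]
    rfl
  · obtain ⟨l, rfl⟩ := Nat.exists_eq_add_of_le' (not_lt.1 hk)
    rw [liftRen_add, inst_add]
    rfl

end Env

/-! ### Concatenation of spines -/

@[simp] theorem Expr.append_nil (ts : Expr C) : ts.append .nil = ts := by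
  cases ts <;> rfl

theorem IsExpr.append {γ δ ξ : Scope S} {us vs : Expr C} (hus : IsExpr ς γ (.sp δ) us)
    (hvs : IsExpr ς γ (.sp ξ) vs) : IsExpr ς γ (.sp (δ.append ξ)) (us.append vs) := by
  induction ξ generalizing vs with
  | nil => cases hvs; simpa using hus
  | snoc ξ _ _ ih _ =>
    cases hvs with
    | snoc hts hn ht => exact .snoc (ih hts) hn ht

theorem Expr.arg?_append_add {γ ξ : Scope S} {us vs : Expr C} (hvs : IsExpr ς γ (.sp ξ) vs)
    (i : ℕ) : (us.append vs).arg? (i + ξ.length) = us.arg? i := by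
  induction ξ generalizing vs with
  | nil => cases hvs; simp [Scope.length]
  | snoc ξ _ _ ih _ =>
    cases hvs with
    | snoc hts hn ht => exact ih hts

theorem Expr.arg?_append_of_lt {γ ξ : Scope S} {us vs : Expr C} (hvs : IsExpr ς γ (.sp ξ) vs)
    {i : ℕ} (hi : i < ξ.length) : (us.append vs).arg? i = vs.arg? i := by
  induction ξ generalizing vs i with
  | nil => simp [Scope.length] at hi
  | snoc ξ _ _ ih _ =>
    cases hvs with
    | snoc hts hn ht =>
      cases i with
      | zero => rfl
      | succ i => exact ih hts (by simpa [Scope.length] using hi)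

theorem Env.inst_append_add {γ δ ξ : Scope S} {us vs : Expr C} (hvs : IsExpr ς γ (.sp ξ) vs)
    (i : ℕ) : inst (δ.append ξ) (us.append vs) (i + ξ.length) = inst δ us i := by
  simp only [inst, Scope.get?_append_add, Expr.arg?_append_add hvs, Scope.length_append]
  split
  · congr 1; omega
  · rfl

/-- Instantiation by a concatenation, after weakening. -/
theorem Env.comm_shift_inst_append {γ δ ξ : Scope S} {us vs : Expr C}
    (hus : IsExpr ς γ (.sp δ) us) (hvs : IsExpr ς γ (.sp ξ) vs) :
    Comm ς (γ.append δ) (ofRen (· + ξ.length)) (inst (δ.append ξ) (us.append vs))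
      (ofRen id) (inst δ us) := by
  refine ⟨_, γ, _, _, wEnv_shift ς _ ξ, ?_, wEnv_id ς _, wEnv_inst hus, Eqv.of_eq ?_⟩
  · rw [Scope.append_assoc]; exact wEnv_inst (hus.append hvs)
  · intro i _
    rw [comp_ofRen, comp_ofRen]
    exact inst_append_add hvs i

/-- Instantiation by a concatenation in two steps. -/
theorem Env.comm_inst_append {γ δ ξ : Scope S} {us vs : Expr C}
    (hus : IsExpr ς γ (.sp δ) us) (hvs : IsExpr ς γ (.sp ξ) vs) :
    Comm ς ((γ.append δ).append ξ) ((inst δ us).lift ξ.length) (inst ξ vs)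
      (ofRen id) (inst (δ.append ξ) (us.append vs)) := by
  refine ⟨_, _, _, γ, (wEnv_inst hus).lift ξ, wEnv_inst hvs, wEnv_id ς _, ?_, Eqv.of_eq ?_⟩
  · rw [Scope.append_assoc]; exact wEnv_inst (hus.append hvs)
  · intro i _
    rw [comp_ofRen_id]
    by_cases hk : i < ξ.length
    · rw [comp_inl (lift_of_lt _ hk)]
      obtain ⟨δ', s', hx⟩ := Scope.exists_get? hk
      obtain ⟨v, hv, -⟩ := hvs.exists_arg hx
      rw [inst_of_get? hx hv,
        inst_of_get? (Scope.get?_append_of_some _ hx)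
          ((Expr.arg?_append_of_lt hvs hk).trans hv)]
    · obtain ⟨l, rfl⟩ := Nat.exists_eq_add_of_le' (not_lt.1 hk)
      rw [inst_append_add hvs]
      cases hl : inst δ us l with
      | inl j => rw [comp_inl (lift_add_inl hl), inst_add]
      | inr x =>
        obtain ⟨ξ', w⟩ := x
        rw [comp_inr (lift_add_inr hl), Expr.hs_inst_wk]

/-! ### Entries of contexts -/

namespace Ctx.Has

theorem lt_length {Γ Δ : Ctx C} {T : Ty C} {i : ℕ} (h : Γ.Has i Δ T) : i < Γ.length := by
  induction h with
  | here => simp [Ctx.length]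
  | there _ ih => simpa [Ctx.length] using ih

theorem unique {Γ Δ Δ' : Ctx C} {T T' : Ty C} {i : ℕ} (h : Γ.Has i Δ T) (h' : Γ.Has i Δ' T') :
    Δ = Δ' ∧ T = T' := by
  induction h generalizing Δ' T' with
  | here => cases h'; exact ⟨rfl, rfl⟩
  | there _ ih =>
    cases h' with
    | there h' => obtain ⟨rfl, rfl⟩ := ih h'; exact ⟨rfl, rfl⟩

theorem _root_.CompLF.Ctx.exists_has {Γ : Ctx C} {i : ℕ} (h : i < Γ.length) :
    ∃ Δ T, Γ.Has i Δ T := by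
  induction Γ generalizing i with
  | nil => simp [Ctx.length] at h
  | snoc Γ Δ T ih _ =>
    cases i with
    | zero => exact ⟨_, _, .here⟩
    | succ i =>
      obtain ⟨_, _, h⟩ := ih (by simpa [Ctx.length] using h)
      exact ⟨_, _, .there h⟩

theorem _root_.CompLF.Ctx.erase_wk (nrm : C ↪ S) (n k : ℕ) (Γ : Ctx C) :
    (Γ.wk n k).erase nrm = Γ.erase nrm := by rw [Ctx.wk_eq_hs S, Ctx.erase_hs]

@[simp] theorem _root_.CompLF.Ctx.length_wk (n k : ℕ) (Γ : Ctx C) :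
    (Γ.wk n k).length = Γ.length := by rw [Ctx.wk_eq_hs C, Ctx.length_hs]

theorem get? {Γ Δ : Ctx C} {T : Ty C} {i : ℕ} (h : Γ.Has i Δ T) (nrm : C ↪ S) :
    (Γ.erase nrm).get? i = some (Δ.erase nrm, T.erase nrm) := by
  induction h with
  | here => simp only [Ctx.erase, Scope.get?, Ctx.erase_wk]; rfl
  | there _ ih => simp only [Ctx.erase, Scope.get?, ih, Ctx.erase_wk]; rfl

theorem isCtx {γ : Scope S} {Γ Δ : Ctx C} {T : Ty C} {i : ℕ} (h : Γ.Has i Δ T)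
    (hΓ : IsCtx nrm ς γ Γ) : IsCtx nrm ς (γ.append (Γ.erase nrm)) Δ ∧
      IsTy ς ((γ.append (Γ.erase nrm)).append (Δ.erase nrm)) T := by
  -- Both constructors of `Has` weaken by one entry; this step serves the two cases.
  have key : ∀ {Γ Δ Δ' : Ctx C} {T T' : Ty C}, IsCtx nrm ς (γ.append (Γ.erase nrm)) Δ →
      IsTy ς ((γ.append (Γ.erase nrm)).append (Δ.erase nrm)) T →
      IsCtx nrm ς (γ.append ((Γ.snoc Δ' T').erase nrm)) (Δ.wk 1 0) ∧
      IsTy ς ((γ.append ((Γ.snoc Δ' T').erase nrm)).append ((Δ.wk 1 0).erase nrm))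
        (T.wk 1 Δ.length) := by
    intro Γ Δ Δ' T T' h1 h2
    have hs := Env.wEnv_shift ς (γ.append (Γ.erase nrm)) (.snoc .nil (Δ'.erase nrm) (T'.erase nrm))
    refine ⟨?_, ?_⟩
    · rw [Ctx.wk_eq_hs S, Env.lift_zero]
      exact h1.hs hs
    · have := h2.hs (hs.lift (Δ.erase nrm))
      rw [Ty.wk_eq_hs S, Ctx.erase_wk]
      rwa [Ctx.length_erase] at this
  induction h with
  | here => exact key hΓ.2.1 hΓ.2.2
  | there _ ih => exact key (ih hΓ.1).1 (ih hΓ.1).2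

theorem append_right {Γ Δ : Ctx C} {T : Ty C} {i : ℕ} (h : Γ.Has i Δ T) (Ξ : Ctx C) :
    (Ξ.append Γ).Has i Δ T := by
  induction h with
  | here => exact .here
  | there _ ih => exact .there ih

theorem _root_.CompLF.Ctx.wk_wk_same (m n k : ℕ) (Γ : Ctx C) :
    (Γ.wk m k).wk n k = Γ.wk (m + n) k := by
  induction Γ generalizing k with
  | nil => rfl
  | snoc Γ Δ T ih ih' =>
    have h : ∀ n k l, liftRen l (wkRen n k) = wkRen n (k + l) := by
      intro n k l; simp only [wkRen_eq, liftRen_liftRen]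
    have hl : ∀ ρ : ℕ → ℕ, (Δ.ren ρ).length = Δ.length := fun ρ => by
      rw [Ctx.ren_eq_hs C, Ctx.length_hs]
    have hl' : ∀ ρ : ℕ → ℕ, (Γ.ren ρ).length = Γ.length := fun ρ => by
      rw [Ctx.ren_eq_hs C, Ctx.length_hs]
    simp only [Ctx.wk, Ctx.ren, h, hl, hl'] at ih ih' ⊢
    rw [ih, ih']
    congr 1
    exact congrArg (Ty.mk _) (Expr.wk_wk_same m n _ _)

theorem _root_.CompLF.Ctx.wk_zero' (k : ℕ) (Γ : Ctx C) : Γ.wk 0 k = Γ := by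
  rw [Ctx.wk_eq_hs C, ← Ctx.hs_id C Γ]
  congr 1
  rw [Env.lift_ofRen]
  congr 1
  · funext i; simp [liftRen]; omega
  · rw [Ctx.hs_id]

theorem _root_.CompLF.Ty.wk_zero' (k : ℕ) (T : Ty C) : T.wk 0 k = T := by
  rw [Ty.wk_eq_hs C, ← Ty.hs_id C T]
  congr 1
  rw [Env.lift_ofRen]
  congr 1
  · funext i; simp [liftRen]; omega
  · rw [Ty.hs_id]

theorem append_left {Γ Δ : Ctx C} {T : Ty C} {i : ℕ} (h : Γ.Has i Δ T) (Ξ : Ctx C) :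
    (Γ.append Ξ).Has (i + Ξ.length) (Δ.wk Ξ.length 0) (T.wk Ξ.length Δ.length) := by
  induction Ξ with
  | nil =>
    simp only [Ctx.length, Ctx.append, Ctx.wk_zero', Ty.wk_zero']
    exact h
  | snoc Ξ Δ' T' ih _ =>
    have := ih.there (Δ' := Δ') (T' := T')
    rw [Ctx.wk_wk_same, Ctx.length_wk] at this
    have e : (T.wk Ξ.length Δ.length).wk 1 Δ.length = T.wk (Ξ.length + 1) Δ.length :=
      congrArg (Ty.mk _) (Expr.wk_wk_same _ _ _ _)
    rw [e] at this
    exact this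

theorem hs {γ γ' : Scope S} {Γ Δ : Ctx C} {T : Ty C} {i : ℕ} {σ : Env C S} (h : Γ.Has i Δ T)
    (hΓ : IsCtx nrm ς γ Γ) (hσ : WEnv ς γ σ γ') :
    (Γ.hs σ).Has i (Δ.hs (σ.lift Γ.length)) (T.hs ((σ.lift Γ.length).lift Δ.length)) := by
  have key : ∀ {Γ Δ Δ' : Ctx C} {T T' : Ty C}, IsCtx nrm ς (γ.append (Γ.erase nrm)) Δ →
      IsTy ς ((γ.append (Γ.erase nrm)).append (Δ.erase nrm)) T →
      (Δ.wk 1 0).hs (σ.lift (Γ.snoc Δ' T').length) = (Δ.hs (σ.lift Γ.length)).wk 1 0 ∧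
      (T.wk 1 Δ.length).hs ((σ.lift (Γ.snoc Δ' T').length).lift (Δ.wk 1 0).length) =
        (T.hs ((σ.lift Γ.length).lift Δ.length)).wk 1 (Δ.hs (σ.lift Γ.length)).length := by
    intro Γ Δ Δ' T T' h1 h2
    have hc := Env.comm_shift (hσ.lift (Γ.erase nrm))
      (.snoc .nil (Δ'.erase nrm) (T'.erase nrm))
    have hc' := hc.lift (Δ.erase nrm)
    simp only [Ctx.length_erase, Scope.length, Nat.zero_add] at hc hc'
    simp only [Ctx.length, Ctx.length_hs, ← Env.lift_lift, Ctx.wk_eq_hs S,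
      Ty.wk_eq_hs S, Env.lift_zero]
    exact ⟨hc.ctx h1, hc'.ty h2⟩
  induction h with
  | here =>
    obtain ⟨h1, h2⟩ := key (Δ' := _) (T' := _) hΓ.2.1 hΓ.2.2
    rw [h1, h2]
    exact .here
  | there hh ih =>
    obtain ⟨h1, h2⟩ := hh.isCtx hΓ.1
    obtain ⟨h1, h2⟩ := key (Δ' := _) (T' := _) h1 h2
    rw [h1, h2]
    exact .there (ih hΓ.1)

end Ctx.Has

end

/-! ### Conversion of expressions and of contexts -/

section

variable {C : Type u} {S : Type v}

/-! ### Rewriting and conversion -/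

variable {ς : PreSig C S} {R : Set (Rule C S)} {nrm : C ↪ S}

theorem Red.isExpr (hR : ∀ r ∈ R, IsRule ς r) {γ : Scope S} {K : Kind S} {e e' : Expr C}
    (h : Red ς R γ K e e') : IsExpr ς γ K e ∧ IsExpr ς γ K e' := by
  induction h with
  | @rule γ r vs hr hvs =>
    exact ⟨((hR r hr).lhs.left_append γ).subst_zero hvs,
      ((hR r hr).rhs.left_append γ).subst_zero hvs⟩
  | var hi _ ih => exact ⟨.var hi ih.1, .var hi ih.2⟩
  | const hc _ ih => exact ⟨.const hc ih.1, .const hc ih.2⟩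
  | ty hc _ ih => exact ⟨.ty hc ih.1, .ty hc ih.2⟩
  | snocLeft _ hn hu ih => exact ⟨.snoc ih.1 hn hu, .snoc ih.2 hn hu⟩
  | snocRight hts hn _ ih => exact ⟨.snoc hts hn ih.1, .snoc hts hn ih.2⟩

theorem Red.mono {ς' : PreSig C S} {R' : Set (Rule C S)} (hς : ς ⊆ ς') (hR : R ⊆ R') {γ : Scope S}
    {K : Kind S} {e e' : Expr C} (h : Red ς R γ K e e') : Red ς' R' γ K e e' := by
  induction h with
  | rule hr hvs => exact .rule (hR hr) (hvs.mono hς)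
  | var hi _ ih => exact .var hi ih
  | const hc _ ih => exact .const (hς hc) ih
  | ty hc _ ih => exact .ty (hς hc) ih
  | snocLeft _ hn hu ih => exact .snocLeft ih hn (hu.mono hς)
  | snocRight hts hn _ ih => exact .snocRight (hts.mono hς) hn ih

namespace Conv

theorem refl {γ : Scope S} {K : Kind S} (e : Expr C) : Conv ς R γ K e e := Relation.EqvGen.refl e

theorem symm {γ : Scope S} {K : Kind S} {e e' : Expr C} (h : Conv ς R γ K e e') :
    Conv ς R γ K e' e := Relation.EqvGen.symm _ _ h

theorem trans {γ : Scope S} {K : Kind S} {e e' e'' : Expr C} (h : Conv ς R γ K e e')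
    (h' : Conv ς R γ K e' e'') : Conv ς R γ K e e'' := Relation.EqvGen.trans _ _ _ h h'

theorem of_red {γ : Scope S} {K : Kind S} {e e' : Expr C} (h : Red ς R γ K e e') :
    Conv ς R γ K e e' := .rel _ _ h

theorem of_reds {γ : Scope S} {K : Kind S} {e e' : Expr C} (h : Reds ς R γ K e e') :
    Conv ς R γ K e e' := by
  induction h with
  | refl => exact refl _
  | tail _ h ih => exact ih.trans (of_red h)

theorem mono {ς' : PreSig C S} {R' : Set (Rule C S)} (hς : ς ⊆ ς') (hR : R ⊆ R') {γ : Scope S}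
    {K : Kind S} {e e' : Expr C} (h : Conv ς R γ K e e') : Conv ς' R' γ K e e' := by
  induction h with
  | rel _ _ h => exact of_red (h.mono hς hR)
  | refl => exact refl _
  | symm _ _ _ ih => exact ih.symm
  | trans _ _ _ _ _ ih ih' => exact ih.trans ih'

theorem isExpr_iff (hR : ∀ r ∈ R, IsRule ς r) {γ : Scope S} {K : Kind S} {e e' : Expr C}
    (h : Conv ς R γ K e e') : IsExpr ς γ K e ↔ IsExpr ς γ K e' := by
  induction h with
  | rel _ _ h => exact ⟨fun _ => (h.isExpr hR).2, fun _ => (h.isExpr hR).1⟩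
  | refl => exact Iff.rfl
  | symm _ _ _ ih => exact ih.symm
  | trans _ _ _ _ _ ih ih' => exact ih.trans ih'

theorem map {γ γ' : Scope S} {K K' : Kind S} (f : Expr C → Expr C)
    (hf : ∀ e e', Red ς R γ K e e' → Conv ς R γ' K' (f e) (f e')) {e e' : Expr C}
    (h : Conv ς R γ K e e') : Conv ς R γ' K' (f e) (f e') := by
  induction h with
  | rel _ _ h => exact hf _ _ h
  | refl => exact refl _
  | symm _ _ _ ih => exact ih.symm
  | trans _ _ _ _ _ ih ih' => exact ih.trans ih'

theorem var {γ δ : Scope S} {s : S} {i : ℕ} {ts us : Expr C} (hi : γ.get? i = some (δ, s))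
    (h : Conv ς R γ (.sp δ) ts us) : Conv ς R γ (.tm s) (.var i ts) (.var i us) :=
  h.map (Expr.var i) fun _ _ h => of_red (.var hi h)

theorem const {γ δ : Scope S} {s : S} {c : C} {ts us : Expr C} (hc : (c, δ, some s) ∈ ς)
    (h : Conv ς R γ (.sp δ) ts us) : Conv ς R γ (.tm s) (.const c ts) (.const c us) :=
  h.map (Expr.const c) fun _ _ h => of_red (.const hc h)

theorem ty {γ δ : Scope S} {c : C} {ts us : Expr C} (hc : (c, δ, none) ∈ ς)
    (h : Conv ς R γ (.sp δ) ts us) : Conv ς R γ .ty (.const c ts) (.const c us) :=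
  h.map (Expr.const c) fun _ _ h => of_red (.ty hc h)

/-- The last argument is converted first, beside `ts`, and then the rest, beside `u'`; hence the
scoping hypotheses on precisely these two. -/
theorem snoc {γ δ γ' : Scope S} {s : S} {ts ts' u u' : Expr C} (hts : IsExpr ς γ (.sp δ) ts)
    (hu : IsExpr ς (γ.append γ') (.tm s) u') (h : Conv ς R γ (.sp δ) ts ts')
    (h' : Conv ς R (γ.append γ') (.tm s) u u') :
    Conv ς R γ (.sp (δ.snoc γ' s)) (.snoc ts γ'.length u) (.snoc ts' γ'.length u') :=
  (h'.map (fun u => Expr.snoc ts γ'.length u) fun _ _ h => of_red (.snocRight hts rfl h)).trans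
    (h.map (fun ts => Expr.snoc ts γ'.length u') fun _ _ h => of_red (.snocLeft h rfl hu))

/-- Separate from stability under environments, whose proof needs it: lifting convertible
environments weakens their entries. -/
theorem ren {γ γ' : Scope S} {K : Kind S} {ρ : ℕ → ℕ} (hR : ∀ r ∈ R, IsRule ς r)
    (hρ : IsRen γ ρ γ') {e e' : Expr C} (h : Conv ς R γ K e e') :
    Conv ς R γ' K (e.ren ρ) (e'.ren ρ) := by
  refine h.map (Expr.ren ρ) fun e e' h => ?_
  clear * - hR hρ h
  refine of_red ?_
  induction h generalizing γ' ρ with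
  | @rule γ r vs hr hvs =>
    -- The sides of a rule contain only variables of the scope of the rule, and the renaming lifted
    -- past this scope fixes them. So a renamed instance is again an instance.
    have key : ∀ e, IsExpr ς r.scope (.tm r.sort) e →
        (Expr.subst r.scope vs 0 e).ren ρ = Expr.subst r.scope (vs.ren ρ) 0 e := by
      intro e he
      have hc := (Env.comm_inst hvs hρ.wEnv).expr (he.left_append γ)
      rw [Expr.subst_zero_eq_hs, Expr.subst_zero_eq_hs, Expr.ren_eq_hs S, hc, ← Expr.ren_eq_hs S,
        Env.lift_ofRen, ← Expr.ren_eq_hs S]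
      congr 1
      exact (Expr.ren_congr_get he fun i hi => liftRen_of_lt _ hi).trans (Expr.ren_id _)
    rw [key _ (hR r hr).lhs, key _ (hR r hr).rhs]
    exact .rule hr (hvs.ren hρ)
  | var hi _ ih => exact .var (hρ _ _ hi) (ih hρ)
  | const hc _ ih => exact .const hc (ih hρ)
  | ty hc _ ih => exact .ty hc (ih hρ)
  | snocLeft _ hn hu ih => subst hn; exact .snocLeft (ih hρ) rfl (hu.ren (hρ.lift _))
  | snocRight hts hn _ ih => subst hn; exact .snocRight (hts.ren hρ) rfl (ih (hρ.lift _))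

end Conv

/-- The conclusion is about `Reds` because the step may take place in another argument. -/
theorem Red.exists_arg {γ δ : Scope S} {us vs : Expr C} (h : Red ς R γ (.sp δ) us vs) {i : ℕ}
    {ξ : Scope S} {s : S} (hi : δ.get? i = some (ξ, s)) :
    ∃ u v, us.arg? i = some u ∧ vs.arg? i = some v ∧ Reds ς R (γ.append ξ) (.tm s) u v := by
  induction δ generalizing us vs i with
  | nil => simp [Scope.get?] at hi
  | snoc δ ξ' s' ih _ =>
    cases h with
    | snocLeft h hn hu =>
      cases i with
      | zero => exact ⟨_, _, rfl, rfl, .refl⟩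
      | succ i => exact ih h hi
    | snocRight hts hn h =>
      cases i with
      | zero =>
        simp only [Scope.get?, Option.some.injEq, Prod.mk.injEq] at hi
        obtain ⟨rfl, rfl⟩ := hi
        exact ⟨_, _, rfl, rfl, .single h⟩
      | succ i =>
        obtain ⟨u, hu, -⟩ := hts.exists_arg hi
        exact ⟨u, u, hu, hu, .refl⟩

/-- Arguments of convertible spines are convertible. -/
theorem Conv.exists_arg (hR : ∀ r ∈ R, IsRule ς r) {γ δ : Scope S} {us vs : Expr C}
    (h : Conv ς R γ (.sp δ) us vs) (hus : IsExpr ς γ (.sp δ) us)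
    {i : ℕ} {ξ : Scope S} {s : S} (hi : δ.get? i = some (ξ, s)) :
    ∃ u v, us.arg? i = some u ∧ vs.arg? i = some v ∧ Conv ς R (γ.append ξ) (.tm s) u v := by
  obtain ⟨u, hu, -⟩ := hus.exists_arg hi
  obtain ⟨v, hv, -⟩ := ((h.isExpr_iff hR).1 hus).exists_arg hi
  refine ⟨u, v, hu, hv, ?_⟩
  -- The default value turns selection of an argument into a total function, to which `Conv.map`
  -- applies.
  have : Conv ς R (γ.append ξ) (.tm s) ((us.arg? i).getD .nil) ((vs.arg? i).getD .nil) := by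
    refine h.map (fun us => (us.arg? i).getD .nil) fun a b hab => ?_
    obtain ⟨x, y, hx, hy, hxy⟩ := hab.exists_arg hi
    simpa only [hx, hy, Option.getD_some] using of_reds hxy
  simpa [hu, hv] using this

/-- Environments with convertible entries. -/
def Env.ConvOn (ς : PreSig C S) (R : Set (Rule C S)) (γ : Scope S) (σ τ : Env C S) (γ' : Scope S) :
    Prop :=
  ∀ i δ s, γ.get? i = some (δ, s) →
    (σ i = τ i) ∨ ∃ u u', σ i = .inr (δ, u) ∧ τ i = .inr (δ, u') ∧
      Conv ς R (γ'.append δ) (.tm s) u u'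

theorem Env.ConvOn.lift (hR : ∀ r ∈ R, IsRule ς r) {γ γ' : Scope S} {σ τ : Env C S}
    (h : Env.ConvOn ς R γ σ τ γ') (ξ : Scope S) :
    Env.ConvOn ς R (γ.append ξ) (σ.lift ξ.length) (τ.lift ξ.length) (γ'.append ξ) := by
  intro i δ s hi
  by_cases hk : i < ξ.length
  · exact .inl (by rw [lift_of_lt _ hk, lift_of_lt _ hk])
  · obtain ⟨l, rfl⟩ := Nat.exists_eq_add_of_le' (not_lt.1 hk)
    rw [Scope.get?_append_add] at hi
    rcases h _ _ _ hi with h | ⟨u, u', hu, hu', h⟩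
    · left
      simp only [Env.lift, Nat.add_sub_cancel, h]
    · refine .inr ⟨_, _, lift_add_inr hu, lift_add_inr hu', ?_⟩
      rw [Expr.wk, Expr.wk, wkRen_eq]
      exact h.ren hR ((isRen_shift γ' ξ).lift δ)

theorem Env.convOn_inst (hR : ∀ r ∈ R, IsRule ς r) {γ δ : Scope S} {us vs : Expr C}
    (h : Conv ς R γ (.sp δ) us vs) (hus : IsExpr ς γ (.sp δ) us) :
    Env.ConvOn ς R (γ.append δ) (Env.inst δ us) (Env.inst δ vs) γ := by
  intro i ξ s hi
  by_cases hk : i < δ.length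
  · rw [Scope.get?_append_of_lt _ hk] at hi
    obtain ⟨u, v, hu, hv, huv⟩ := h.exists_arg hR hus hi
    exact .inr ⟨u, v, inst_of_get? hi hu, inst_of_get? hi hv, huv⟩
  · obtain ⟨l, rfl⟩ := Nat.exists_eq_add_of_le' (not_lt.1 hk)
    exact .inl (by rw [inst_add, inst_add])

/-- The two statements are proved together. A reduction inside the spine of an instantiated variable
becomes a change of the spine substituted into its body, which is the second statement at a smaller
arity. When the bodies differ as well, the second statement uses the first at that arity. -/
theorem Conv.hs_aux (hR : ∀ r ∈ R, IsRule ς r) (N : ℕ) :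
    (∀ (γ γ' : Scope S) (σ : Env C S) (K : Kind S) (e e' : Expr C), WEnvLt ς N γ σ γ' →
      Conv ς R γ K e e' → Conv ς R γ' K (e.hs σ) (e'.hs σ)) ∧
    (∀ (γ γ' : Scope S) (σ τ : Env C S) (K : Kind S) (e : Expr C), WEnvLt ς N γ σ γ' →
      WEnvLt ς N γ τ γ' → Env.ConvOn ς R γ σ τ γ' → IsExpr ς γ K e →
      Conv ς R γ' K (e.hs σ) (e.hs τ)) := by
  induction N using Nat.strong_induction_on with
  | _ N ihN =>
    constructor
    · intro γ γ' σ K e e' hσ h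
      refine h.map (Expr.hs σ) fun e e' h => ?_
      clear * - hR ihN hσ h
      induction h generalizing γ' σ with
      | @rule γ r vs hr hvs =>
        have key : ∀ e, IsExpr ς r.scope (.tm r.sort) e →
            (Expr.subst r.scope vs 0 e).hs σ = Expr.subst r.scope (vs.hs σ) 0 e := by
          intro e he
          rw [Expr.subst_zero_eq_hs, Expr.subst_zero_eq_hs,
            (Env.comm_inst hvs hσ.toWEnv).expr (he.left_append γ)]
          congr 1
          exact (Expr.hs_congr_get he fun i hi => Env.lift_of_lt _ hi).trans (Expr.hs_id S _)
        rw [key _ (hR r hr).lhs, key _ (hR r hr).rhs]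
        exact of_red (.rule hr (hvs.hsLt hσ))
      | @var γ δ s i ts us hi h ih =>
        rcases hσ _ _ _ hi with ⟨j, hj, hj'⟩ | ⟨u, hu, hN, hu'⟩
        · rw [Expr.hs_var_inl hj, Expr.hs_var_inl hj]
          exact .var hj' (ih γ' σ hσ)
        · rw [Expr.hs_var_inr hu, Expr.hs_var_inr hu, Expr.subst_zero_eq_hs, Expr.subst_zero_eq_hs]
          have h1 := (h.isExpr hR).1.hsLt hσ
          have h2 := (h.isExpr hR).2.hsLt hσ
          exact (ihN _ hN).2 _ _ _ _ _ _ (wEnvLt_inst h1) (wEnvLt_inst h2)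
            (Env.convOn_inst hR (ih γ' σ hσ) h1) hu'
      | const hc _ ih => exact .const hc (ih γ' σ hσ)
      | ty hc _ ih => exact .ty hc (ih γ' σ hσ)
      | snocLeft h hn hu ih =>
        subst hn
        exact .snoc ((h.isExpr hR).1.hsLt hσ) (hu.hsLt (hσ.lift _)) (ih γ' σ hσ) (refl _)
      | snocRight hts hn h ih =>
        subst hn
        exact .snoc (hts.hsLt hσ) ((h.isExpr hR).2.hsLt (hσ.lift _)) (refl _)
          (ih _ _ (hσ.lift _))
    · intro γ γ' σ τ K e hσ hτ hc he
      induction he generalizing γ' σ τ with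
      | @var γ δ s i ts hi hts ih =>
        have hts' := ih γ' σ τ hσ hτ hc
        rcases hσ _ _ _ hi with ⟨j, hj, hj'⟩ | ⟨u, hu, hN, hu'⟩
        · rcases hc _ _ _ hi with h | ⟨w, w', hw, -, -⟩
          · rw [Expr.hs_var_inl hj, Expr.hs_var_inl (h ▸ hj)]
            exact .var hj' hts'
          · rw [hj] at hw; cases hw
        · have h1 := hts.hsLt hσ
          have h2 := hts.hsLt hτ
          have h3 := (ihN _ hN).2 _ _ _ _ _ _ (wEnvLt_inst h1) (wEnvLt_inst h2)
            (Env.convOn_inst hR hts' h1) hu'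
          rcases hc _ _ _ hi with h | ⟨w, w', hw, hw', h⟩
          · rw [Expr.hs_var_inr hu, Expr.hs_var_inr (h ▸ hu), Expr.subst_zero_eq_hs,
              Expr.subst_zero_eq_hs]
            exact h3
          · rw [hu] at hw
            cases hw
            rw [Expr.hs_var_inr hu, Expr.hs_var_inr hw', Expr.subst_zero_eq_hs,
              Expr.subst_zero_eq_hs]
            -- First the spine changes inside `u`, then `u` changes to `w'` under the new spine.
            exact h3.trans ((ihN _ hN).1 _ _ _ _ _ _ (wEnvLt_inst h2) h)
      | const hc' _ ih => exact .const hc' (ih γ' σ τ hσ hτ hc)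
      | ty hc' _ ih => exact .ty hc' (ih γ' σ τ hσ hτ hc)
      | nil => exact refl _
      | snoc hts hn ht ih ih' =>
        subst hn
        exact .snoc (hts.hsLt hσ) (ht.hsLt (hτ.lift _)) (ih γ' σ τ hσ hτ hc)
          (ih' _ _ _ (hσ.lift _) (hτ.lift _) (hc.lift hR _))

/-- Conversion is stable under hereditary substitution. -/
theorem Conv.hs (hR : ∀ r ∈ R, IsRule ς r) {γ γ' : Scope S} {σ : Env C S} {K : Kind S}
    {e e' : Expr C} (h : Conv ς R γ K e e') (hσ : WEnv ς γ σ γ') :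
    Conv ς R γ' K (e.hs σ) (e'.hs σ) :=
  (Conv.hs_aux hR _).1 _ _ _ _ _ _ hσ h

/-- Convertible environments have convertible actions. -/
theorem IsExpr.hs_conv (hR : ∀ r ∈ R, IsRule ς r) {γ γ' : Scope S} {σ τ : Env C S} {K : Kind S}
    {e : Expr C} (he : IsExpr ς γ K e) (hσ : WEnv ς γ σ γ') (hτ : WEnv ς γ τ γ')
    (h : Env.ConvOn ς R γ σ τ γ') : Conv ς R γ' K (e.hs σ) (e.hs τ) :=
  (Conv.hs_aux hR _).2 _ _ _ _ _ _ hσ hτ h he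

/-- Convertible types have the same head. -/
theorem Conv.head_eq {γ : Scope S} {T U : Ty C} (h : Conv ς R γ .ty T.expr U.expr) :
    T.head = U.head := by
  have key : ∀ e e', Conv ς R γ .ty e e' →
      ∀ c, (∃ us, e = .const c us) ↔ (∃ us, e' = .const c us) := by
    intro e e' h
    induction h with
    | rel _ _ h => cases h; simp
    | refl => simp
    | symm _ _ _ ih => exact fun c => (ih c).symm
    | trans _ _ _ _ _ ih ih' => exact fun c => (ih c).trans (ih' c)
  obtain ⟨us, hus⟩ := (key _ _ h T.head).1 ⟨_, rfl⟩
  exact (Expr.const.inj hus).1.symm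

theorem Conv.erase_eq (nrm : C ↪ S) {γ : Scope S} {T U : Ty C}
    (h : Conv ς R γ .ty T.expr U.expr) : T.erase nrm = U.erase nrm :=
  congrArg nrm h.head_eq

/-! ### Convertible contexts -/

/-- Contexts over `γ` with the same erasure whose entries are convertible in the scope extended by
the whole context (rather than by the entries before them). -/
inductive CtxConv (nrm : C ↪ S) (ς : PreSig C S) (R : Set (Rule C S)) :
    Scope S → Ctx C → Ctx C → Prop
  | mk {γ : Scope S} {Γ Γ' : Ctx C} :
      Γ.erase nrm = Γ'.erase nrm →
      (∀ i Δ T Δ' T', Γ.Has i Δ T → Γ'.Has i Δ' T' →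
        CtxConv nrm ς R (γ.append (Γ.erase nrm)) Δ Δ') →
      (∀ i Δ T Δ' T', Γ.Has i Δ T → Γ'.Has i Δ' T' →
        Conv ς R ((γ.append (Γ.erase nrm)).append (Δ.erase nrm)) .ty T.expr T'.expr) →
      CtxConv nrm ς R γ Γ Γ'

namespace CtxConv

theorem erase_eq {γ : Scope S} {Γ Γ' : Ctx C} (h : CtxConv nrm ς R γ Γ Γ') :
    Γ.erase nrm = Γ'.erase nrm := by cases h; assumption

theorem length_eq {γ : Scope S} {Γ Γ' : Ctx C} (h : CtxConv nrm ς R γ Γ Γ') :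
    Γ.length = Γ'.length := by
  rw [← Ctx.length_erase nrm, h.erase_eq, Ctx.length_erase]

theorem entry {γ : Scope S} {Γ Γ' Δ Δ' : Ctx C} {T T' : Ty C} {i : ℕ}
    (h : CtxConv nrm ς R γ Γ Γ') (hi : Γ.Has i Δ T) (hi' : Γ'.Has i Δ' T') :
    CtxConv nrm ς R (γ.append (Γ.erase nrm)) Δ Δ' ∧
      Conv ς R ((γ.append (Γ.erase nrm)).append (Δ.erase nrm)) .ty T.expr T'.expr := by
  cases h with
  | mk _ h h' => exact ⟨h _ _ _ _ _ hi hi', h' _ _ _ _ _ hi hi'⟩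

theorem symm {γ : Scope S} {Γ Γ' : Ctx C} (h : CtxConv nrm ς R γ Γ Γ') :
    CtxConv nrm ς R γ Γ' Γ := by
  induction h with
  | mk he hc hT ih =>
    refine .mk he.symm ?_ ?_
    · intro i Δ T Δ' T' h h'
      rw [← he]
      exact ih _ _ _ _ _ h' h
    · intro i Δ T Δ' T' h h'
      rw [← he, ← (hc _ _ _ _ _ h' h).erase_eq]
      exact (hT _ _ _ _ _ h' h).symm

theorem trans {γ : Scope S} {Γ Γ' Γ'' : Ctx C} (h : CtxConv nrm ς R γ Γ Γ')
    (h' : CtxConv nrm ς R γ Γ' Γ'') : CtxConv nrm ς R γ Γ Γ'' := by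
  induction h generalizing Γ'' with
  | @mk γ Γ Γ' he hc hT ih =>
    have key : ∀ {i Δ T}, Γ.Has i Δ T → ∃ Δ' T', Γ'.Has i Δ' T' := by
      intro i Δ T h
      apply Ctx.exists_has
      rw [← Ctx.length_erase nrm, ← he, Ctx.length_erase]
      exact h.lt_length
    refine .mk (he.trans h'.erase_eq) ?_ ?_
    · intro i Δ T Δ'' T'' hi hi''
      obtain ⟨Δ', T', hi'⟩ := key hi
      exact ih _ _ _ _ _ hi hi' (he ▸ (h'.entry hi' hi'').1)
    · intro i Δ T Δ'' T'' hi hi''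
      obtain ⟨Δ', T', hi'⟩ := key hi
      refine (hT _ _ _ _ _ hi hi').trans ?_
      rw [he, (hc _ _ _ _ _ hi hi').erase_eq]
      exact (h'.entry hi' hi'').2

/-- Entries are weakened and thus are not subterms of `Γ`. Their erasures are unaffected by
weakening and get smaller, so the induction is on these. -/
theorem refl (γ : Scope S) (Γ : Ctx C) : CtxConv nrm ς R γ Γ Γ := by
  induction hN : sizeOf (Γ.erase nrm) using Nat.strong_induction_on generalizing γ Γ with
  | _ N ihN =>
    subst hN
    refine .mk rfl ?_ ?_
    · intro i Δ T Δ' T' h h'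
      obtain ⟨rfl, rfl⟩ := h.unique h'
      exact ihN _ (Scope.sizeOf_lt_of_get? (h.get? nrm)) _ _ rfl
    · intro i Δ T Δ' T' h h'
      obtain ⟨rfl, rfl⟩ := h.unique h'
      exact Conv.refl _

/-- The entry of a substituted context. -/
theorem _root_.CompLF.Ctx.Has.of_hs {γ γ' : Scope S} {Γ Δ : Ctx C} {T : Ty C} {i : ℕ} {σ : Env C S}
    (h : (Γ.hs σ).Has i Δ T) (hΓ : IsCtx nrm ς γ Γ) (hσ : WEnv ς γ σ γ') :
    ∃ Δ₀ T₀, Γ.Has i Δ₀ T₀ ∧ Δ = Δ₀.hs (σ.lift Γ.length) ∧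
      T = T₀.hs ((σ.lift Γ.length).lift Δ₀.length) := by
  obtain ⟨Δ₀, T₀, h₀⟩ := Ctx.exists_has (Γ := Γ) (i := i) (by simpa using h.lt_length)
  obtain ⟨h1, h2⟩ := h.unique (h₀.hs hΓ hσ)
  exact ⟨_, _, h₀, h1, h2⟩

theorem hs (hR : ∀ r ∈ R, IsRule ς r) {γ γ' : Scope S} {Γ Γ' : Ctx C} {σ : Env C S}
    (h : CtxConv nrm ς R γ Γ Γ') (hΓ : IsCtx nrm ς γ Γ) (hΓ' : IsCtx nrm ς γ Γ')
    (hσ : WEnv ς γ σ γ') : CtxConv nrm ς R γ' (Γ.hs σ) (Γ'.hs σ) := by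
  induction h generalizing γ' σ with
  | @mk γ Γ Γ' he hc hT ih =>
    have hl : Γ.length = Γ'.length := by
      rw [← Ctx.length_erase nrm, he, Ctx.length_erase]
    have hσ' := hσ.lift (Γ.erase nrm)
    rw [Ctx.length_erase] at hσ'
    refine .mk (by simpa using he) ?_ ?_
    · intro i Δ T Δ' T' hi hi'
      obtain ⟨Δ₀, T₀, h₀, rfl, rfl⟩ := hi.of_hs hΓ hσ
      obtain ⟨Δ₀', T₀', h₀', rfl, rfl⟩ := hi'.of_hs hΓ' hσ
      rw [Ctx.erase_hs, ← hl]
      exact ih _ _ _ _ _ h₀ h₀' (h₀.isCtx hΓ).1 (he ▸ (h₀'.isCtx hΓ').1) hσ'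
    · intro i Δ T Δ' T' hi hi'
      obtain ⟨Δ₀, T₀, h₀, rfl, rfl⟩ := hi.of_hs hΓ hσ
      obtain ⟨Δ₀', T₀', h₀', rfl, rfl⟩ := hi'.of_hs hΓ' hσ
      have hσ'' := hσ'.lift (Δ₀.erase nrm)
      rw [Ctx.length_erase] at hσ''
      rw [Ctx.erase_hs, Ctx.erase_hs, ← hl, ← (hc _ _ _ _ _ h₀ h₀').length_eq]
      exact (hT _ _ _ _ _ h₀ h₀').hs hR hσ''

/-- Convertible environments send a context to convertible contexts. -/
theorem of_convOn (hR : ∀ r ∈ R, IsRule ς r) {γ γ' : Scope S} {Γ : Ctx C} {σ τ : Env C S}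
    (hΓ : IsCtx nrm ς γ Γ) (hσ : WEnv ς γ σ γ') (hτ : WEnv ς γ τ γ')
    (h : Env.ConvOn ς R γ σ τ γ') : CtxConv nrm ς R γ' (Γ.hs σ) (Γ.hs τ) := by
  induction hN : sizeOf (Γ.erase nrm) using Nat.strong_induction_on generalizing γ γ' Γ σ τ with
  | _ N ihN =>
    subst hN
    have hσ' := hσ.lift (Γ.erase nrm)
    have hτ' := hτ.lift (Γ.erase nrm)
    have h' := h.lift hR (Γ.erase nrm)
    rw [Ctx.length_erase] at hσ' hτ' h'
    refine .mk (by simp) ?_ ?_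
    · intro i Δ T Δ' T' hi hi'
      obtain ⟨Δ₀, T₀, h₀, rfl, rfl⟩ := hi.of_hs hΓ hσ
      obtain ⟨Δ₀', T₀', h₀', rfl, rfl⟩ := hi'.of_hs hΓ hτ
      obtain ⟨rfl, rfl⟩ := h₀.unique h₀'
      rw [Ctx.erase_hs]
      exact ihN _ (Scope.sizeOf_lt_of_get? (h₀.get? nrm)) (h₀.isCtx hΓ).1 hσ' hτ' h' rfl
    · intro i Δ T Δ' T' hi hi'
      obtain ⟨Δ₀, T₀, h₀, rfl, rfl⟩ := hi.of_hs hΓ hσ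
      obtain ⟨Δ₀', T₀', h₀', rfl, rfl⟩ := hi'.of_hs hΓ hτ
      obtain ⟨rfl, rfl⟩ := h₀.unique h₀'
      have hσ'' := hσ'.lift (Δ₀.erase nrm)
      have hτ'' := hτ'.lift (Δ₀.erase nrm)
      have h'' := h'.lift hR (Δ₀.erase nrm)
      rw [Ctx.length_erase] at hσ'' hτ'' h''
      rw [Ctx.erase_hs, Ctx.erase_hs]
      exact IsExpr.hs_conv hR (h₀.isCtx hΓ).2 hσ'' hτ'' h''

/-- Entries of the right part are unchanged. Those of the left part appear weakened by the right
one, so stability of conversion under weakening is needed. -/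
theorem append (hR : ∀ r ∈ R, IsRule ς r) {γ : Scope S} {Γ Γ' Ξ Ξ' : Ctx C}
    (h : CtxConv nrm ς R γ Γ Γ') (hΓ : IsCtx nrm ς γ Γ) (hΓ' : IsCtx nrm ς γ Γ')
    (h' : CtxConv nrm ς R (γ.append (Γ.erase nrm)) Ξ Ξ') :
    CtxConv nrm ς R γ (Γ.append Ξ) (Γ'.append Ξ') := by
  have key : ∀ {i Δ T Δ' T'}, (Γ.append Ξ).Has i Δ T → (Γ'.append Ξ').Has i Δ' T' →
      CtxConv nrm ς R (γ.append ((Γ.append Ξ).erase nrm)) Δ Δ' ∧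
        Conv ς R ((γ.append ((Γ.append Ξ).erase nrm)).append (Δ.erase nrm)) .ty T.expr T'.expr := by
    intro i Δ T Δ' T' hi hi'
    rw [Ctx.erase_append, ← Scope.append_assoc]
    by_cases hk : i < Ξ.length
    · obtain ⟨Δ₀, T₀, h₀⟩ := Ctx.exists_has hk
      obtain ⟨Δ₀', T₀', h₀'⟩ := Ctx.exists_has (h'.length_eq ▸ hk)
      obtain ⟨rfl, rfl⟩ := hi.unique (h₀.append_right _)
      obtain ⟨rfl, rfl⟩ := hi'.unique (h₀'.append_right _)
      exact h'.entry h₀ h₀'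
    · obtain ⟨l, rfl⟩ := Nat.exists_eq_add_of_le' (not_lt.1 hk)
      have hl : l < Γ.length := by
        have := hi.lt_length
        rw [Ctx.length_append] at this
        omega
      obtain ⟨Δ₀, T₀, h₀⟩ := Ctx.exists_has hl
      obtain ⟨Δ₀', T₀', h₀'⟩ := Ctx.exists_has (h.length_eq ▸ hl)
      obtain ⟨rfl, rfl⟩ := hi.unique (h₀.append_left _)
      rw [h'.length_eq] at hi'
      obtain ⟨rfl, rfl⟩ := hi'.unique (h₀'.append_left _)
      obtain ⟨h1, h2⟩ := h.entry h₀ h₀'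
      have hs := Env.wEnv_shift ς (γ.append (Γ.erase nrm)) (Ξ.erase nrm)
      have hs' := hs.lift (Δ₀.erase nrm)
      have h3 := h1.hs hR (h₀.isCtx hΓ).1 (h.erase_eq ▸ (h₀'.isCtx hΓ').1) hs
      have h4 := h2.hs hR hs'
      rw [Ctx.length_erase] at h3
      rw [Ctx.length_erase, Ctx.length_erase] at h4
      rw [← h'.length_eq, ← h1.length_eq, Ctx.erase_wk, Ctx.wk_eq_hs S, Ctx.wk_eq_hs S,
        Ty.wk_eq_hs S, Ty.wk_eq_hs S, Env.lift_zero]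
      exact ⟨h3, h4⟩
  refine .mk (by simp [h.erase_eq, h'.erase_eq]) ?_ ?_
  · intro i Δ T Δ' T' hi hi'
    exact (key hi hi').1
  · intro i Δ T Δ' T' hi hi'
    exact (key hi hi').2

end CtxConv

end

/-! ### Typing: scoping, typed environments and the substitution lemma -/

section

variable {C : Type u} {S : Type v}

/-! ### Well-scoped theories -/

variable {ς : PreSig C S} {nrm : C ↪ S} {𝕋 : Theory C S}

/-- Theories with well-scoped declarations and well-formed rules. -/
structure Theory.WellScoped (nrm : C ↪ S) (𝕋 : Theory C S) : Prop where
  rew : ∀ r ∈ 𝕋.rew, IsRule (𝕋.presig nrm) r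
  ctx : ∀ d ∈ 𝕋.sig, IsCtx nrm (𝕋.presig nrm) .nil d.ctx
  erased : ∀ d ∈ 𝕋.sig, d.erased.length = d.ctx.length
  result : ∀ d ∈ 𝕋.sig, ∀ T ∈ d.result, IsTy (𝕋.presig nrm) (d.ctx.erase nrm) T
  unique : ∀ d ∈ 𝕋.sig, ∀ d' ∈ 𝕋.sig, d.name = d'.name → d = d'

theorem Theory.mem_presig {d : Decl C} (h : d ∈ 𝕋.sig) :
    (d.name, d.ctx.eraseBy nrm d.erased, d.result.map (Ty.erase nrm)) ∈ 𝕋.presig nrm :=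
  List.mem_map.2 ⟨d, h, rfl⟩

theorem keep_hs {γ δ : Scope S} {ts : Expr C} (h : IsExpr ς γ (.sp δ) ts) (ν : List Bool)
    (σ : Env C S) : (keep ν ts).hs σ = keep ν (ts.hs σ) := by
  induction ν generalizing ts δ with
  | nil => cases h <;> rfl
  | cons b ν ih =>
    cases h with
    | nil => rfl
    | snoc hts hn ht => cases b <;> simp [keep, Expr.hs, ih hts]

theorem isExpr_keep {γ : Scope S} {Δ : Ctx C} {ts : Expr C}
    (h : IsExpr ς γ (.sp (Δ.erase nrm)) ts) (ν : List Bool) :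
    IsExpr ς γ (.sp (Δ.eraseBy nrm ν)) (keep ν ts) := by
  induction Δ generalizing ts ν with
  | nil =>
    cases h
    cases ν <;> exact .nil
  | snoc Δ Γ T ih _ =>
    cases h with
    | snoc hts hn ht =>
      cases ν with
      | nil => exact .nil
      | cons b ν =>
        cases b with
        | true => exact ih hts ν
        | false => exact .snoc (ih hts ν) hn ht

theorem Ty.subst_zero_eq_hs (γ : Scope S) (us : Expr C) (T : Ty C) :
    T.subst γ us 0 = T.hs (Env.inst γ us) := by
  rw [subst_eq_hs, Env.lift_zero]

theorem IsTy.subst_zero {γ δ : Scope S} {T : Ty C} {us : Expr C}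
    (hT : IsTy ς (γ.append δ) T) (hus : IsExpr ς γ (.sp δ) us) : IsTy ς γ (T.subst δ us 0) := by
  rw [Ty.subst_zero_eq_hs]
  exact hT.hs (wEnv_inst hus)

theorem Ctx.subst_zero_eq_hs (γ : Scope S) (us : Expr C) (Γ : Ctx C) :
    Γ.subst γ us 0 = Γ.hs (Env.inst γ us) := by
  rw [subst_eq_hs, Env.lift_zero]

theorem Ctx.wk_zero_eq_hs (S : Type v) (n : ℕ) (Γ : Ctx C) :
    Γ.wk n 0 = Γ.hs (Env.ofRen (· + n) : Env C S) := by
  rw [wk_eq_hs S, Env.lift_zero]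

theorem Ty.wk_zero_eq_hs (S : Type v) (n : ℕ) (T : Ty C) :
    T.wk n 0 = T.hs (Env.ofRen (· + n) : Env C S) := by
  rw [wk_eq_hs S, Env.lift_zero]

/-- A closed context is not affected by environments. -/
theorem IsCtx.hs_closed {Γ : Ctx C} (h : IsCtx nrm ς .nil Γ) (σ : Env C S) : Γ.hs σ = Γ := by
  have hs : Env.Same ς .nil σ (Env.ofRen id) :=
    ⟨.nil, .nil, fun i δ s hi => by simp [Scope.get?] at hi, Env.wEnv_id _ _,
      fun i δ s hi => by simp [Scope.get?] at hi⟩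
  rw [hs.ctx h, Ctx.hs_id]

theorem Env.same_lift_id (ς : PreSig C S) (γ : Scope S) (σ : Env C S) :
    Env.Same ς γ (σ.lift γ.length) (Env.ofRen id) := by
  refine ⟨γ, γ, ?_, Env.wEnv_id _ _, Env.Eqv.of_eq fun i hi => Env.lift_of_lt _ hi⟩
  intro i δ s hi
  exact .inl ⟨i, Env.lift_of_lt _ (Scope.lt_of_get? hi), hi⟩

/-- A type over `γ` is not affected by environments lifted to `γ`. -/
theorem IsTy.hs_lift {γ : Scope S} {T : Ty C} (h : IsTy ς γ T) (σ : Env C S) :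
    T.hs (σ.lift γ.length) = T := by
  rw [(Env.same_lift_id ς γ σ).ty h, Ty.hs_id]

/-! ### Judgments -/

namespace Judgment

/-- Action of an environment. -/
def hs (σ : Env C S) : Judgment C → Judgment C
  | ctx => ctx
  | ty T => ty (T.hs σ)
  | tm t T => tm (t.hs σ) (T.hs σ)
  | sp ts Δ => sp (ts.hs σ) (Δ.hs σ)

/-- Well-scoped judgments. -/
def IsIn (nrm : C ↪ S) (ς : PreSig C S) (γ : Scope S) : Judgment C → Prop
  | ctx => True
  | ty T => IsTy ς γ T
  | tm t T => IsTy ς γ T ∧ IsExpr ς γ (.tm (T.erase nrm)) t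
  | sp ts Δ => IsCtx nrm ς γ Δ ∧ IsExpr ς γ (.sp (Δ.erase nrm)) ts

@[simp] theorem hs_id (S : Type v) (J : Judgment C) : J.hs (Env.ofRen id : Env C S) = J := by
  cases J <;> simp [hs, Expr.hs_id, Ctx.hs_id]

theorem _root_.CompLF.Env.Same.judgment {γ : Scope S} {σ σ' : Env C S} (h : Env.Same ς γ σ σ')
    {J : Judgment C} (hJ : J.IsIn nrm ς γ) : J.hs σ = J.hs σ' := by
  cases J with
  | ctx => rfl
  | ty T => exact congrArg _ (h.ty hJ)
  | tm t T => exact congrArg₂ Judgment.tm (h.expr hJ.2) (h.ty hJ.1)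
  | sp ts Δ => exact congrArg₂ Judgment.sp (h.expr hJ.2) (h.ctx hJ.1)

end Judgment

/-- This supplies the scoping hypotheses of all the syntactic laws from typing derivations. -/
theorem Theory.WellScoped.derives (h𝕋 : 𝕋.WellScoped nrm) {Γ : Ctx C} {J : Judgment C}
    (h : Derives nrm 𝕋 Γ J) :
    IsCtx nrm (𝕋.presig nrm) .nil Γ ∧ J.IsIn nrm (𝕋.presig nrm) (Γ.erase nrm) := by
  induction h with
  | emptyCtx => exact ⟨trivial, trivial⟩
  | extCtx _ ih =>
    obtain ⟨h1, h2⟩ := ih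
    rw [IsCtx.append] at h1
    refine ⟨⟨h1.1, h1.2, ?_⟩, trivial⟩
    simpa [Judgment.IsIn] using h2
  | @type Γ Δ ν c ts hc _ ih =>
    exact ⟨ih.1, .ty (Theory.mem_presig hc) (isExpr_keep ih.2.2 ν)⟩
  | @const Γ Δ ν c T ts hc _ ih =>
    have hT : IsTy (𝕋.presig nrm) (Δ.erase nrm) T := h𝕋.result _ hc T rfl
    refine ⟨ih.1, ?_, .const (Theory.mem_presig hc) (isExpr_keep ih.2.2 ν)⟩
    exact IsTy.subst_zero (IsExpr.left_append hT _) ih.2.2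
  | @var Γ Δ i T ts hi _ ih =>
    refine ⟨ih.1, ?_, .var (hi.get? nrm) ih.2.2⟩
    have := (hi.isCtx ih.1).2
    rw [Scope.nil_append] at this
    exact IsTy.subst_zero this ih.2.2
  | @conv Γ T U t hc _ _ ih ih' =>
    exact ⟨ih.1, ih'.2, (hc.erase_eq nrm) ▸ ih.2.2⟩
  | emptySpine _ ih => exact ⟨ih.1, trivial, .nil⟩
  | @extSpine Γ Δ Γ' T ts t hΔ _ _ ih ih' =>
    refine ⟨ih.1, hΔ, .snoc ih.2.2 (by simp) ?_⟩
    have := ih'.2.2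
    rwa [Ctx.erase_append, Ctx.subst_zero_eq_hs, Ctx.erase_hs] at this

theorem Derives.ctx {Γ : Ctx C} {J : Judgment C} (h : Derives nrm 𝕋 Γ J) :
    Derives nrm 𝕋 Γ .ctx := by
  induction h with
  | emptyCtx => exact .emptyCtx
  | extCtx h _ => exact .extCtx h
  | type _ _ ih => exact ih
  | const _ _ ih => exact ih
  | var _ _ ih => exact ih
  | conv _ _ _ ih _ => exact ih
  | emptySpine _ ih => exact ih
  | extSpine _ _ _ ih _ => exact ih

theorem Derives.of_snoc {Γ Δ : Ctx C} {T : Ty C} (h : Derives nrm 𝕋 (Γ.snoc Δ T) .ctx) :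
    Derives nrm 𝕋 (Γ.append Δ) (.ty T) := by
  cases h; assumption

theorem Derives.of_append {Γ Ξ : Ctx C} (h : Derives nrm 𝕋 (Γ.append Ξ) .ctx) :
    Derives nrm 𝕋 Γ .ctx := by
  induction Ξ generalizing Γ with
  | nil => exact h
  | snoc Ξ Δ T ih ih' => exact ih (ih' (of_snoc h).ctx)

theorem Derives.mono {𝕋' : Theory C S} (hsig : 𝕋.sig ⊆ 𝕋'.sig) (hrew : 𝕋.rew ⊆ 𝕋'.rew)
    {Γ : Ctx C} {J : Judgment C} (h : Derives nrm 𝕋 Γ J) : Derives nrm 𝕋' Γ J := by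
  have hς : 𝕋.presig nrm ⊆ 𝕋'.presig nrm := List.map_subset _ hsig
  induction h with
  | emptyCtx => exact .emptyCtx
  | extCtx _ ih => exact .extCtx ih
  | type hc _ ih => exact .type (hsig hc) ih
  | const hc _ ih => exact .const (hsig hc) ih
  | var hi _ ih => exact .var hi ih
  | conv hc _ _ ih ih' => exact .conv (hc.mono hς hrew) ih ih'
  | emptySpine _ ih => exact .emptySpine ih
  | extSpine hΔ _ _ ih ih' => exact .extSpine (hΔ.mono hς) ih ih'

/-! ### Typed environments -/

/-- Typed environments from `Γ` to `Γ'` whose instantiated variables have arities of size less than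
`N`. -/
def TEnvLt (nrm : C ↪ S) (𝕋 : Theory C S) (N : ℕ) (Γ : Ctx C) (σ : Env C S) (Γ' : Ctx C) : Prop :=
  ∀ i Δ T, Γ.Has i Δ T →
    (∃ j, σ i = .inl j ∧ Γ'.Has j (Δ.hs σ) (T.hs (σ.lift Δ.length))) ∨
    (∃ u, σ i = .inr (Δ.erase nrm, u) ∧ sizeOf (Δ.erase nrm) < N ∧
      Derives nrm 𝕋 (Γ'.append (Δ.hs σ)) (.tm u (T.hs (σ.lift Δ.length))))

/-- Typed environments from `Γ` to `Γ'`. -/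
def TEnv (nrm : C ↪ S) (𝕋 : Theory C S) (Γ : Ctx C) (σ : Env C S) (Γ' : Ctx C) : Prop :=
  TEnvLt nrm 𝕋 (sizeOf (Γ.erase nrm)) Γ σ Γ'

theorem TEnvLt.toTEnv {N : ℕ} {Γ Γ' : Ctx C} {σ : Env C S} (h : TEnvLt nrm 𝕋 N Γ σ Γ') :
    TEnv nrm 𝕋 Γ σ Γ' := by
  intro i Δ T hi
  rcases h i Δ T hi with h | ⟨u, hu, -, h⟩
  · exact .inl h
  · exact .inr ⟨u, hu, Scope.sizeOf_lt_of_get? (hi.get? nrm), h⟩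

theorem TEnvLt.wEnvLt (h𝕋 : 𝕋.WellScoped nrm) {N : ℕ} {Γ Γ' : Ctx C} {σ : Env C S}
    (h : TEnvLt nrm 𝕋 N Γ σ Γ') :
    WEnvLt (𝕋.presig nrm) N (Γ.erase nrm) σ (Γ'.erase nrm) := by
  intro i δ s hi
  have hl := Scope.lt_of_get? hi
  rw [Ctx.length_erase] at hl
  obtain ⟨Δ, T, hT⟩ := Ctx.exists_has hl
  have := (hT.get? nrm).symm.trans hi
  simp only [Option.some.injEq, Prod.mk.injEq] at this
  obtain ⟨rfl, rfl⟩ := this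
  rcases h i Δ T hT with ⟨j, hj, hj'⟩ | ⟨u, hu, hN, h⟩
  · exact .inl ⟨j, hj, by simpa using hj'.get? nrm⟩
  · exact .inr ⟨u, hu, hN, by simpa using (h𝕋.derives h).2.2⟩

theorem TEnvLt.wEnv (h𝕋 : 𝕋.WellScoped nrm) {N : ℕ} {Γ Γ' : Ctx C} {σ : Env C S}
    (h : TEnvLt nrm 𝕋 N Γ σ Γ') :
    WEnv (𝕋.presig nrm) (Γ.erase nrm) σ (Γ'.erase nrm) := (h.wEnvLt h𝕋).toWEnv

/-- Valid for every `N`, including `0`, which is how weakening gets proved before substitution. -/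
theorem tEnvLt_shift (N : ℕ) (Γ Ξ : Ctx C) :
    TEnvLt nrm 𝕋 N Γ (Env.ofRen (· + Ξ.length)) (Γ.append Ξ) := by
  intro i Δ T hi
  refine .inl ⟨_, rfl, ?_⟩
  have := hi.append_left Ξ
  rwa [Ctx.wk_zero_eq_hs S, Ty.wk_eq_hs S] at this

/-- Weakening by one entry is admissible. -/
def Weakens (nrm : C ↪ S) (𝕋 : Theory C S) : Prop :=
  ∀ (Γ Ξ Δ : Ctx C) (T : Ty C) (J : Judgment C), Derives nrm 𝕋 (Γ.append Ξ) J →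
    Derives nrm 𝕋 (Γ.snoc Δ T) .ctx →
    Derives nrm 𝕋 ((Γ.snoc Δ T).append (Ξ.hs (Env.ofRen (· + 1) : Env C S)))
      (J.hs ((Env.ofRen (· + 1) : Env C S).lift Ξ.length))

/-- Lifting weakens the instantiated expressions, so it needs weakening to be admissible, unless
nothing is instantiated. The disjunction covers both situations and avoids a separate proof of
weakening. -/
theorem TEnvLt.lift_snoc (h𝕋 : 𝕋.WellScoped nrm) {N : ℕ} (hN : N = 0 ∨ Weakens nrm 𝕋)
    {Γ Γ' Δ : Ctx C} {T : Ty C} {σ : Env C S}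
    (h : TEnvLt nrm 𝕋 N Γ σ Γ') (hΓ : IsCtx nrm (𝕋.presig nrm) .nil (Γ.snoc Δ T))
    (hΓ' : Derives nrm 𝕋 (Γ'.snoc (Δ.hs σ) (T.hs (σ.lift Δ.length))) .ctx) :
    TEnvLt nrm 𝕋 N (Γ.snoc Δ T) (σ.lift 1) (Γ'.snoc (Δ.hs σ) (T.hs (σ.lift Δ.length))) := by
  have hc := Env.comm_shift (h.wEnv h𝕋) (.snoc .nil (Δ.erase nrm) (T.erase nrm))
  simp only [Scope.length, Nat.zero_add] at hc
  have key : ∀ {Δ₀ : Ctx C} {T₀ : Ty C}, IsCtx nrm (𝕋.presig nrm) (Γ.erase nrm) Δ₀ →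
      IsTy (𝕋.presig nrm) ((Γ.erase nrm).append (Δ₀.erase nrm)) T₀ →
      (Δ₀.wk 1 0).hs (σ.lift 1) = (Δ₀.hs σ).wk 1 0 ∧
      (T₀.wk 1 Δ₀.length).hs ((σ.lift 1).lift (Δ₀.wk 1 0).length) =
        (T₀.hs (σ.lift Δ₀.length)).wk 1 (Δ₀.hs σ).length := by
    intro Δ₀ T₀ h1 h2
    have hc' := hc.lift (Δ₀.erase nrm)
    simp only [Ctx.length_erase] at hc'
    simp only [Ctx.wk_zero_eq_hs S, Ty.wk_eq_hs S, Ctx.length_hs]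
    exact ⟨hc.ctx h1, hc'.ty h2⟩
  intro i Δ₀ T₀ hi
  cases hi with
  | here =>
    obtain ⟨h1, h2, h3⟩ := hΓ
    rw [Scope.nil_append] at h2 h3
    obtain ⟨h1, h2⟩ := key h2 h3
    refine .inl ⟨0, Env.lift_of_lt _ Nat.zero_lt_one, ?_⟩
    rw [h1, h2]
    exact .here
  | @there _ Δ₀ _ T₀ _ i hi =>
    obtain ⟨h1, h2⟩ := hi.isCtx hΓ.1
    rw [Scope.nil_append] at h1 h2
    obtain ⟨h1, h2⟩ := key h1 h2
    rw [h1, h2]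
    rcases h i _ _ hi with ⟨j, hj, hj'⟩ | ⟨u, hu, hlt, h'⟩
    · exact .inl ⟨j + 1, Env.lift_add_inl hj, .there hj'⟩
    · refine .inr ⟨u.wk 1 Δ₀.length, ?_, ?_, ?_⟩
      · rw [Env.lift_add_inr hu, Ctx.erase_wk, Ctx.length_erase]
      · rwa [Ctx.erase_wk]
      · rcases hN with rfl | hW
        · omega
        · have := hW _ _ _ _ _ h' hΓ'
          simp only [Judgment.hs] at this
          rw [Ctx.wk_zero_eq_hs S, Ty.wk_eq_hs S, Expr.wk_eq_hs S]
          simpa using this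

theorem TEnvLt.lift (h𝕋 : 𝕋.WellScoped nrm) {N : ℕ} (hN : N = 0 ∨ Weakens nrm 𝕋)
    {Γ Γ' Ξ : Ctx C} {σ : Env C S}
    (h : TEnvLt nrm 𝕋 N Γ σ Γ') (hΓ : IsCtx nrm (𝕋.presig nrm) .nil (Γ.append Ξ))
    (hΓ' : Derives nrm 𝕋 (Γ'.append (Ξ.hs σ)) .ctx) :
    TEnvLt nrm 𝕋 N (Γ.append Ξ) (σ.lift Ξ.length) (Γ'.append (Ξ.hs σ)) := by
  induction Ξ with
  | nil => simpa [Ctx.length, Ctx.hs] using h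
  | snoc Ξ Δ T ih _ =>
    have h1 := ih hΓ.1 (Derives.of_append (Derives.of_snoc hΓ').ctx)
    have := h1.lift_snoc h𝕋 hN hΓ hΓ'
    rwa [Env.lift_lift] at this

theorem Env.comm_shift_inst_snoc {γ δ ξ : Scope S} {s : S} {us u : Expr C}
    (hus : IsExpr ς γ (.sp δ) us) (hu : IsExpr ς (γ.append ξ) (.tm s) u) :
    Env.Comm ς (γ.append δ) (Env.ofRen (· + 1)) (Env.inst (δ.snoc ξ s) (us.snoc ξ.length u))
      (Env.ofRen id) (Env.inst δ us) :=
  ⟨_, _, _, _, Env.wEnv_shift ς _ (.snoc .nil ξ s),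
    wEnv_inst (δ := δ.snoc ξ s) (.snoc hus rfl hu), Env.wEnv_id ς _, wEnv_inst hus,
    Env.Eqv.of_eq fun i _ => Env.inst_snoc_succ _ _ _ _ _ _ i⟩

theorem Env.hs_inst_snoc_wk {γ : Scope S} {Δ Γ' Δ₀ : Ctx C} {T T₀ : Ty C} {ts t : Expr C}
    (hts : IsExpr ς γ (.sp (Δ.erase nrm)) ts)
    (ht : IsExpr ς (γ.append (Γ'.erase nrm)) (.tm (T.erase nrm)) t)
    (hΔ₀ : IsCtx nrm ς (γ.append (Δ.erase nrm)) Δ₀)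
    (hT₀ : IsTy ς ((γ.append (Δ.erase nrm)).append (Δ₀.erase nrm)) T₀) :
    (Δ₀.wk 1 0).hs (Env.inst ((Δ.snoc Γ' T).erase nrm) (ts.snoc Γ'.length t)) =
        Δ₀.hs (Env.inst (Δ.erase nrm) ts) ∧
      (T₀.wk 1 Δ₀.length).hs ((Env.inst ((Δ.snoc Γ' T).erase nrm) (ts.snoc Γ'.length t)).lift
        (Δ₀.wk 1 0).length) = T₀.hs ((Env.inst (Δ.erase nrm) ts).lift Δ₀.length) := by
  have hc := Env.comm_shift_inst_snoc hts ht
  have hc' := hc.lift (Δ₀.erase nrm)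
  simp only [Ctx.length_erase] at hc hc'
  simp only [Ctx.wk_zero_eq_hs S, Ty.wk_eq_hs S, Ctx.length_hs]
  exact ⟨(hc.ctx hΔ₀).trans (by rw [Ctx.hs_id]), (hc'.ty hT₀).trans (by rw [Env.lift_id, Ty.hs_id])⟩

/-- The typed environment of a spine. -/
theorem Derives.tEnvLt_inst (h𝕋 : 𝕋.WellScoped nrm) {Γ Δ : Ctx C} {ts : Expr C}
    (h : Derives nrm 𝕋 Γ (.sp ts Δ)) :
    TEnvLt nrm 𝕋 (sizeOf (Δ.erase nrm)) (Γ.append Δ) (Env.inst (Δ.erase nrm) ts) Γ := by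
  induction Δ generalizing ts with
  | nil =>
    have : (Env.inst .nil ts : Env C S) = Env.ofRen id := rfl
    intro i D X hi
    refine .inl ⟨i, rfl, ?_⟩
    simp only [Ctx.erase, this, Env.lift_id, Ctx.hs_id, Ty.hs_id]
    exact hi
  | snoc Δ Γ' T ih _ =>
    obtain ⟨hΓ, hΔ, hts⟩ := h𝕋.derives h
    cases h with
    | @extSpine _ _ _ _ ts t _ h1 h2 =>
      have ih := ih h1
      rw [Ctx.subst_zero_eq_hs, Ty.subst_eq_hs] at h2
      cases hts with
      | @snoc _ _ _ _ _ _ _ hts hn ht =>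
      intro i D X hi
      cases hi with
      | here =>
        obtain ⟨h3, h4⟩ := Env.hs_inst_snoc_wk hts ht hΔ.2.1 hΔ.2.2
        refine .inr ⟨t, ?_, ?_, ?_⟩
        · rw [Ctx.erase_wk]; rfl
        · rw [Ctx.erase_wk]
          simp only [Ctx.erase, Scope.snoc.sizeOf_spec]
          omega
        · rw [h3, h4]
          exact h2
      | @there _ D _ X _ i hi =>
        obtain ⟨h3, h4⟩ := hi.isCtx (IsCtx.append.2 ⟨hΓ, by simpa using hΔ.1⟩)
        rw [Scope.nil_append, Ctx.erase_append] at h3 h4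
        obtain ⟨h3, h4⟩ := Env.hs_inst_snoc_wk hts ht h3 h4
        have he : Env.inst ((Δ.snoc Γ' T).erase nrm) (ts.snoc Γ'.length t) (i + 1) =
          Env.inst (Δ.erase nrm) ts i := Env.inst_snoc_succ _ _ _ _ _ _ i
        rw [h3, h4, he]
        rcases ih i _ _ hi with h | ⟨u, hu, hN, h⟩
        · exact .inl h
        · refine .inr ⟨u, ?_, ?_, h⟩
          · rw [Ctx.erase_wk, hu]
          · rw [Ctx.erase_wk]
            simp only [Ctx.erase, Scope.snoc.sizeOf_spec]
            omega

/-! ### Substitution -/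

/-- Outer induction on `N`, inner induction on the derivation. The trailing context `Ξ` is needed
because the premises for context entries and for arguments extend the context, while the environment
acts on the left part only. -/
theorem Derives.hs_aux (h𝕋 : 𝕋.WellScoped nrm) (N : ℕ) : ∀ {Γ : Ctx C} {J : Judgment C},
    Derives nrm 𝕋 Γ J → ∀ {Γ₁ Ξ Γ' : Ctx C} {σ : Env C S}, Γ = Γ₁.append Ξ →
    TEnvLt nrm 𝕋 N Γ₁ σ Γ' → Derives nrm 𝕋 Γ' .ctx →
    Derives nrm 𝕋 (Γ'.append (Ξ.hs σ)) (J.hs (σ.lift Ξ.length)) := by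
  induction N using Nat.strong_induction_on with
  | _ N ihN =>
    -- Weakening is the statement for `N = 0` applied to a shift, hence available from the induction
    -- hypothesis whenever `N` is positive.
    have hW : N = 0 ∨ Weakens nrm 𝕋 := by
      rcases Nat.eq_zero_or_pos N with h | h
      · exact .inl h
      · refine .inr fun Γ Ξ Δ T J hJ hΓ => ?_
        exact ihN 0 h hJ rfl (tEnvLt_shift 0 Γ (.snoc .nil Δ T)) hΓ
    intro Γ J hJ
    have hwe : ∀ {Γ₁ Ξ Γ' : Ctx C} {σ : Env C S}, TEnvLt nrm 𝕋 N Γ₁ σ Γ' →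
        WEnv (𝕋.presig nrm) ((Γ₁.append Ξ).erase nrm) (σ.lift Ξ.length)
          ((Γ'.append (Ξ.hs σ)).erase nrm) := by
      intro Γ₁ Ξ Γ' σ h
      have := (h.wEnv h𝕋).lift (Ξ.erase nrm)
      simpa using this
    induction hJ with
    | emptyCtx =>
      intro Γ₁ Ξ Γ' σ he hσ hΓ'
      cases Ξ with
      | nil => exact hΓ'
      | snoc => cases he
    | @extCtx Γ Δ T _ ih =>
      intro Γ₁ Ξ Γ' σ he hσ hΓ'
      cases Ξ with
      | nil => exact hΓ'
      | snoc Ξ Δ T =>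
        cases he
        have := ih (Ξ := Ξ.append Δ) (Ctx.append_assoc _ _ _) hσ hΓ'
        rw [Ctx.hs_append, ← Ctx.append_assoc, Ctx.length_append, ← Env.lift_lift] at this
        exact .extCtx this
    | @type Γ Δ ν c ts hc hts ih =>
      intro Γ₁ Ξ Γ' σ he hσ hΓ'
      have h1 := ih he hσ hΓ'
      have h2 := (h𝕋.derives hts).2.2
      simp only [Judgment.hs, Ty.hs] at h1 ⊢
      rw [(h𝕋.ctx _ hc).hs_closed] at h1
      rw [keep_hs h2]
      exact .type hc h1
    | @const Γ Δ ν c T ts hc hts ih =>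
      intro Γ₁ Ξ Γ' σ he hσ hΓ'
      subst he
      have h1 := ih rfl hσ hΓ'
      have h2 := (h𝕋.derives hts).2.2
      have hT : IsTy (𝕋.presig nrm) (Δ.erase nrm) T := h𝕋.result _ hc T rfl
      simp only [Judgment.hs] at h1 ⊢
      rw [(h𝕋.ctx _ hc).hs_closed] at h1
      rw [Expr.hs, keep_hs h2, Ty.subst_zero_eq_hs,
        (Env.comm_inst h2 (hwe hσ)).ty (IsExpr.left_append hT _), hT.hs_lift,
        ← Ty.subst_zero_eq_hs]
      exact .const hc h1
    | @var Γ Δ i T ts hi hts ih =>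
      intro Γ₁ Ξ Γ' σ he hσ hΓ'
      subst he
      have h1 := ih rfl hσ hΓ'
      obtain ⟨hΓ, h2⟩ := h𝕋.derives hts
      have hT := (hi.isCtx hΓ).2
      rw [Scope.nil_append] at hT
      simp only [Judgment.hs] at h1 ⊢
      have hσ' := hσ.lift h𝕋 hW hΓ h1.ctx
      have hc := (Env.comm_inst h2.2 (hwe hσ)).ty hT
      rw [Ty.subst_zero_eq_hs, hc, Ctx.length_erase]
      rcases hσ' i Δ T hi with ⟨j, hj, hj'⟩ | ⟨u, hu, hN, hu'⟩
      · rw [Expr.hs_var_inl hj, ← Ty.subst_zero_eq_hs]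
        have := Derives.var hj' h1
        rwa [Ctx.erase_hs] at this
      · rw [Expr.hs_var_inr hu, Expr.subst_zero_eq_hs]
        have h3 := h1.tEnvLt_inst h𝕋
        rw [Ctx.erase_hs] at h3
        -- `u` is typed under the image of `Δ`. Substituting the typed spine `h1` for this context
        -- is an environment bounded by the size of `Δ`, which is less than `N`.
        have := ihN _ hN hu' (Ξ := .nil) rfl h3 h1.ctx
        simp only [Ctx.hs, Ctx.length, Env.lift_zero] at this
        exact this
    | @conv Γ T U t hc ht hU ih ih' =>
      intro Γ₁ Ξ Γ' σ he hσ hΓ'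
      subst he
      exact .conv (T := T.hs (σ.lift Ξ.length)) (hc.hs h𝕋.rew (hwe hσ)) (ih rfl hσ hΓ') (ih' rfl hσ hΓ')
    | emptySpine _ ih =>
      intro Γ₁ Ξ Γ' σ he hσ hΓ'
      exact .emptySpine (ih he hσ hΓ')
    | @extSpine Γ Δ Θ T ts t hΔ hts ht ih ih' =>
      intro Γ₁ Ξ Γ' σ he hσ hΓ'
      subst he
      have h1 := ih rfl hσ hΓ'
      -- The context of the last argument is regrouped so that its local entries join the trailing
      -- context.
      have h2 := ih' (Ξ := Ξ.append (Θ.subst (Δ.erase nrm) ts 0)) (Ctx.append_assoc _ _ _) hσ hΓ'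
      have h3 := (h𝕋.derives hts).2.2
      have hc := Env.comm_inst h3 (hwe hσ)
      have hc' := hc.lift (Θ.erase nrm)
      simp only [Ctx.length_erase] at hc hc'
      have hΔ' := hΔ.hs (hwe hσ)
      simp only [Judgment.hs, Ctx.hs, Expr.hs] at h1 hΔ' ⊢
      rw [← Ctx.length_hs ((σ.lift Ξ.length).lift Δ.length) Θ] at hΔ' ⊢
      refine .extSpine ?_ h1 ?_
      · exact hΔ'
      · rw [Ctx.hs_append, ← Ctx.append_assoc, Ctx.subst_zero_eq_hs, hc.ctx hΔ.2.1,
          Ctx.length_append, ← Env.lift_lift] at h2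
        simp only [Judgment.hs, Ty.subst_eq_hs, Ctx.length_hs] at h2 ⊢
        rw [hc'.ty hΔ.2.2] at h2
        rw [Ctx.subst_zero_eq_hs, Ctx.erase_hs]
        exact h2

/-- Typed environments preserve derivability. -/
theorem Derives.hs (h𝕋 : 𝕋.WellScoped nrm) {Γ₁ Ξ Γ' : Ctx C} {σ : Env C S} {J : Judgment C}
    (h : Derives nrm 𝕋 (Γ₁.append Ξ) J) (hσ : TEnv nrm 𝕋 Γ₁ σ Γ') (hΓ' : Derives nrm 𝕋 Γ' .ctx) :
    Derives nrm 𝕋 (Γ'.append (Ξ.hs σ)) (J.hs (σ.lift Ξ.length)) :=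
  Derives.hs_aux h𝕋 _ h rfl hσ hΓ'

theorem Theory.WellScoped.weakens (h𝕋 : 𝕋.WellScoped nrm) : Weakens nrm 𝕋 :=
  fun Γ _ Δ T _ hJ hΓ => hJ.hs h𝕋 (tEnvLt_shift 0 Γ (.snoc .nil Δ T)).toTEnv hΓ

/-- Substitution of a spine. -/
theorem Derives.inst (h𝕋 : 𝕋.WellScoped nrm) {Γ Δ Ξ : Ctx C} {ts : Expr C} {J : Judgment C}
    (h : Derives nrm 𝕋 ((Γ.append Δ).append Ξ) J) (hts : Derives nrm 𝕋 Γ (.sp ts Δ)) :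
    Derives nrm 𝕋 (Γ.append (Ξ.hs (Env.inst (Δ.erase nrm) ts)))
      (J.hs ((Env.inst (Δ.erase nrm) ts).lift Ξ.length)) :=
  h.hs h𝕋 (hts.tEnvLt_inst h𝕋).toTEnv hts.ctx

theorem Derives.inst_nil (h𝕋 : 𝕋.WellScoped nrm) {Γ Δ : Ctx C} {ts : Expr C} {J : Judgment C}
    (h : Derives nrm 𝕋 (Γ.append Δ) J) (hts : Derives nrm 𝕋 Γ (.sp ts Δ)) :
    Derives nrm 𝕋 Γ (J.hs (Env.inst (Δ.erase nrm) ts)) := by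
  have := Derives.inst (Ξ := .nil) h𝕋 h hts
  simpa [Ctx.length, Ctx.hs] using this

/-- Weakening. -/
theorem Derives.wk (h𝕋 : 𝕋.WellScoped nrm) {Γ Ξ Θ : Ctx C} {J : Judgment C}
    (h : Derives nrm 𝕋 (Γ.append Ξ) J) (hΘ : Derives nrm 𝕋 (Γ.append Θ) .ctx) :
    Derives nrm 𝕋 ((Γ.append Θ).append (Ξ.hs (Env.ofRen (· + Θ.length) : Env C S)))
      (J.hs ((Env.ofRen (· + Θ.length) : Env C S).lift Ξ.length)) :=
  h.hs h𝕋 (tEnvLt_shift 0 Γ Θ).toTEnv hΘ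

theorem Derives.wk_nil (h𝕋 : 𝕋.WellScoped nrm) {Γ Θ : Ctx C} {J : Judgment C}
    (h : Derives nrm 𝕋 Γ J) (hΘ : Derives nrm 𝕋 (Γ.append Θ) .ctx) :
    Derives nrm 𝕋 (Γ.append Θ) (J.hs (Env.ofRen (· + Θ.length) : Env C S)) := by
  have := Derives.wk (Ξ := .nil) h𝕋 h hΘ
  simpa [Ctx.length, Ctx.hs] using this

theorem Judgment.IsIn.hs_lift {γ : Scope S} {J : Judgment C} (h : J.IsIn nrm ς γ)
    (σ : Env C S) : J.hs (σ.lift γ.length) = J := by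
  rw [(Env.same_lift_id ς γ σ).judgment h, Judgment.hs_id]

/-- Weakening on the left of a closed context. -/
theorem Derives.left_append (h𝕋 : 𝕋.WellScoped nrm) {Γ Ξ : Ctx C} {J : Judgment C}
    (h : Derives nrm 𝕋 Ξ J) (hΓ : Derives nrm 𝕋 Γ .ctx) : Derives nrm 𝕋 (Γ.append Ξ) J := by
  -- As an environment from the empty context the identity is vacuously typed into any `Γ`.
  have hσ : TEnv nrm 𝕋 .nil (Env.ofRen id) Γ := fun i Δ T hi => by cases hi
  have h' : Derives nrm 𝕋 (Ctx.nil.append Ξ) J := by simpa using h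
  have := h'.hs h𝕋 hσ hΓ
  obtain ⟨h1, h2⟩ := h𝕋.derives h
  rwa [h1.hs_closed, ← Ctx.length_erase nrm, h2.hs_lift] at this

/-- The type of an entry of a valid context. -/
theorem Ctx.Has.derives (h𝕋 : 𝕋.WellScoped nrm) {Γ Δ : Ctx C} {T : Ty C} {i : ℕ}
    (h : Γ.Has i Δ T) (hΓ : Derives nrm 𝕋 Γ .ctx) : Derives nrm 𝕋 (Γ.append Δ) (.ty T) := by
  induction h with
  | @here Γ Δ T =>
    have := h𝕋.weakens _ _ _ _ _ hΓ.of_snoc hΓ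
    rwa [← Ctx.wk_zero_eq_hs, Judgment.hs, ← Ty.wk_eq_hs] at this
  | @there Γ Δ Δ' T T' i _ ih =>
    have := h𝕋.weakens _ _ _ _ _ (ih (hΓ.of_append (Ξ := .snoc .nil _ _))) hΓ
    rwa [← Ctx.wk_zero_eq_hs, Judgment.hs, ← Ty.wk_eq_hs] at this

/-- Theories in which every declaration is well-typed. -/
structure Theory.WellFormed (nrm : C ↪ S) (𝕋 : Theory C S) : Prop extends 𝕋.WellScoped nrm where
  ctx_derives : ∀ d ∈ 𝕋.sig, Derives nrm 𝕋 d.ctx .ctx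
  result_derives : ∀ d ∈ 𝕋.sig, ∀ T ∈ d.result, Derives nrm 𝕋 d.ctx (.ty T)

/-- The type of a typed term is valid. -/
theorem Derives.ty_of_tm (h𝕋 : 𝕋.WellFormed nrm) {Γ : Ctx C} {t : Expr C} {T : Ty C}
    (h : Derives nrm 𝕋 Γ (.tm t T)) : Derives nrm 𝕋 Γ (.ty T) := by
  cases h with
  | const hc hts =>
    rw [Ty.subst_zero_eq_hs]
    exact Derives.inst_nil h𝕋.toWellScoped
      ((h𝕋.result_derives _ hc _ rfl).left_append h𝕋.toWellScoped hts.ctx) hts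
  | var hi hts =>
    rw [Ty.subst_zero_eq_hs]
    exact Derives.inst_nil h𝕋.toWellScoped (hi.derives h𝕋.toWellScoped hts.ctx) hts
  | conv _ _ hU => exact hU

end

/-! ### Identity spines and change of context -/

section

variable {C : Type u} {S : Type v} {ς : PreSig C S} {nrm : C ↪ S} {𝕋 : Theory C S}

/-! ### Inversion -/

theorem Derives.inv_var {Γ : Ctx C} {i : ℕ} {ts : Expr C} {T : Ty C}
    (h : Derives nrm 𝕋 Γ (.tm (.var i ts) T)) :
    ∃ Δ X, Γ.Has i Δ X ∧ Derives nrm 𝕋 Γ (.sp ts Δ) ∧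
      Conv (𝕋.presig nrm) 𝕋.rew (Γ.erase nrm) .ty (X.subst (Δ.erase nrm) ts 0).expr T.expr := by
  generalize hJ : Judgment.tm (.var i ts) T = J at h
  induction h generalizing T with
  | var hi hts _ => cases hJ; exact ⟨_, _, hi, hts, Conv.refl _⟩
  | conv hc _ _ ih _ =>
    cases hJ
    obtain ⟨Δ, X, hi, hts, hX⟩ := ih rfl
    exact ⟨Δ, X, hi, hts, hX.trans hc⟩
  | _ => cases hJ

theorem Derives.inv_const {Γ : Ctx C} {c : C} {us : Expr C} {T : Ty C}
    (h : Derives nrm 𝕋 Γ (.tm (.const c us) T)) :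
    ∃ Δ ν X ts, (⟨c, Δ, ν, some X⟩ : Decl C) ∈ 𝕋.sig ∧ us = keep ν ts ∧
      Derives nrm 𝕋 Γ (.sp ts Δ) ∧
      Conv (𝕋.presig nrm) 𝕋.rew (Γ.erase nrm) .ty (X.subst (Δ.erase nrm) ts 0).expr T.expr := by
  generalize hJ : Judgment.tm (.const c us) T = J at h
  induction h generalizing T with
  | const hi hts _ => cases hJ; exact ⟨_, _, _, _, hi, rfl, hts, Conv.refl _⟩
  | conv hc _ _ ih _ =>
    cases hJ
    obtain ⟨Δ, ν, X, ts, hi, hus, hts, hX⟩ := ih rfl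
    exact ⟨Δ, ν, X, ts, hi, hus, hts, hX.trans hc⟩
  | _ => cases hJ

/-! ### Identity spines -/

/-- The identity spine, weakened, after a weakening. -/
theorem Env.comm_idSp_wk (ς : PreSig C S) (γ δ ξ : Scope S) :
    Env.Comm ς (γ.append δ) ((Env.ofRen (· + (δ.append ξ).length)).lift δ.length)
      (Env.inst δ ((idSp δ).wk ξ.length 0)) (Env.ofRen (· + ξ.length)) (Env.ofRen id) := by
  have hid : IsExpr ς (γ.append (δ.append ξ)) (.sp δ) ((idSp δ).wk ξ.length 0) := by
    rw [← Scope.append_assoc]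
    exact IsExpr.wk_zero ((isExpr_idSp ς δ).left_append _)
  refine ⟨_, _, _, _, (Env.wEnv_shift ς γ (δ.append ξ)).lift δ, wEnv_inst hid,
    Env.wEnv_shift ς _ ξ, Env.wEnv_id ς _, ?_⟩
  intro i ξ' s hi
  rw [lift_ofRen, comp_ofRen, comp_ofRen]
  by_cases hk : i < δ.length
  · rw [Scope.get?_append_of_lt _ hk] at hi
    have h := Expr.arg?_ren (isExpr_idSp ς δ) hi (wkRen ξ.length 0)
    rw [arg?_idSp hi] at h
    rw [liftRen_of_lt _ hk, Expr.wk, inst_of_get? hi h]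
    simp only [Expr.ren, entry, ofRen, id, liftRen_add]
    rw [idSp_ren _ fun k hk => liftRen_of_lt _ hk]
    simp [wkRen]
  · obtain ⟨l, rfl⟩ := Nat.exists_eq_add_of_le' (not_lt.1 hk)
    rw [liftRen_add, inst_add, Scope.length_append]
    simp only [entry, ofRen, id]
    congr 1
    omega

/-- `Ξ` is only required to have the erasure of `Δ`, so that it may be a context merely convertible
to `Δ`. -/
theorem Derives.var_idSp {Γ Ξ Δ : Ctx C} {T : Ty C} {i : ℕ}
    (hΓ : IsCtx nrm (𝕋.presig nrm) .nil Γ) (hi : Γ.Has i Δ T) (hΞ : Ξ.erase nrm = Δ.erase nrm)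
    (h : Derives nrm 𝕋 (Γ.append Ξ) (.sp (idSp (Δ.erase nrm)) (Δ.wk Ξ.length 0))) :
    Derives nrm 𝕋 (Γ.append Ξ) (.tm (.var (i + Ξ.length) (idSp (Δ.erase nrm))) T) := by
  have := Derives.var (hi.append_left Ξ) (by exact h)
  have hT := (hi.isCtx hΓ).2
  rw [Scope.nil_append] at hT
  have hc := (Env.comm_idSp (𝕋.presig nrm) (Γ.erase nrm) (Δ.erase nrm)).ty hT
  have hl : Ξ.length = Δ.length := by
    rw [← Ctx.length_erase nrm, hΞ, Ctx.length_erase]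
  rw [Ctx.erase_wk, Ty.subst_zero_eq_hs, Ty.wk_eq_hs S, hl] at this
  simp only [Ctx.length_erase, Ty.hs_id] at hc
  rw [hc, ← hl] at this
  exact this

/-- Induction on the erasure: the prefix yields the spine up to the last argument, after weakening,
and the context of the last entry yields the identity spine to which the last variable is applied.
Both have smaller erasure. -/
theorem Derives.idSp (h𝕋 : 𝕋.WellScoped nrm) {Γ Δ : Ctx C}
    (h : Derives nrm 𝕋 (Γ.append Δ) .ctx) :
    Derives nrm 𝕋 (Γ.append Δ) (.sp (idSp (Δ.erase nrm)) (Δ.wk Δ.length 0)) := by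
  induction hN : sizeOf (Δ.erase nrm) using Nat.strong_induction_on generalizing Γ Δ with
  | _ N ihN =>
    subst hN
    cases Δ with
    | nil => exact .emptySpine h
    | snoc Δ Γ' T =>
      have hT : Derives nrm 𝕋 ((Γ.append Δ).append Γ') (.ty T) := Derives.of_snoc h
      have hΔ := hT.ctx.of_append
      obtain ⟨hΓs, hTs⟩ := h𝕋.derives hT
      rw [IsCtx.append, IsCtx.append] at hΓs
      obtain ⟨⟨hΓ0, hΔ0⟩, hΓ'0⟩ := hΓs
      simp only [Scope.nil_append, Ctx.erase_append] at hΓ0 hΔ0 hΓ'0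
      simp only [Judgment.IsIn, Ctx.erase_append] at hTs
      have h1 := ihN (sizeOf (Δ.erase nrm))
        (by simp only [Ctx.erase, Scope.snoc.sizeOf_spec]; omega) hΔ rfl
      have h1' := h1.wk_nil h𝕋 (Θ := .snoc .nil Γ' T) h
      have h2 := h𝕋.weakens _ _ _ _ _ hT.ctx h
      rw [← Ctx.wk_zero_eq_hs S] at h2
      have h3 := ihN (sizeOf ((Γ'.wk 1 0).erase nrm))
        (by simp only [Ctx.erase, Scope.snoc.sizeOf_spec, Ctx.erase_wk]; omega) h2 rfl
      have h4 := Derives.var_idSp (h𝕋.derives h).1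
        (Ctx.Has.here (Γ := Γ.append Δ) (Δ := Γ') (T := T)) rfl h3
      have hc := Env.comm_idSp_wk (𝕋.presig nrm) (Γ.erase nrm) (Δ.erase nrm)
        (.snoc .nil (Γ'.erase nrm) (T.erase nrm))
      have hc' := hc.lift (Γ'.erase nrm)
      simp only [Ctx.length_erase, Scope.length_append, Scope.length, Nat.zero_add] at hc hc'
      simp only [Judgment.hs, Ctx.length, ← Ctx.wk_zero_eq_hs, Nat.zero_add, Ctx.wk_wk_same] at h1'
      have hΔwk : IsCtx nrm (𝕋.presig nrm) ((Γ.append (Δ.snoc Γ' T)).erase nrm)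
          ((Δ.snoc Γ' T).wk (Δ.length + 1) 0) := by
        rw [Ctx.wk_zero_eq_hs S]
        have hs := Env.wEnv_shift (𝕋.presig nrm) (Γ.erase nrm) ((Δ.snoc Γ' T).erase nrm)
        rw [Ctx.length_erase] at hs
        rw [Ctx.erase_append]
        exact IsCtx.hs ⟨hΔ0, hΓ'0, hTs⟩ hs
      simp only [Ctx.length, CompLF.idSp, Ctx.erase]
      rw [Ctx.wk_zero_eq_hs S] at hΔwk ⊢
      rw [Ctx.hs] at hΔwk ⊢
      rw [Expr.wk_eq_hs S, Env.lift_zero, Ctx.length_erase,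
        ← Ctx.length_hs ((Env.ofRen (· + (Δ.length + 1)) : Env C S).lift Δ.length) Γ']
      refine .extSpine (by rw [Ctx.length_hs]; exact hΔwk) ?_ ?_
      · rw [← Ctx.wk_zero_eq_hs]; exact h1'
      · rw [Ctx.subst_zero_eq_hs, Ty.subst_eq_hs, Ctx.erase_hs, Ctx.length_hs]
        rw [Expr.wk_eq_hs S, Env.lift_zero] at hc hc'
        rw [hc.ctx hΓ'0, hc'.ty hTs, Env.lift_id, Ctx.hs_id, Ty.hs_id, ← Ctx.wk_zero_eq_hs,
          ← Ty.wk_eq_hs]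
        rw [Ctx.erase_wk, Ctx.length_wk, Nat.zero_add] at h4
        exact h4

/-! ### Conversion of contexts -/

namespace Env

/-- Weakening by `n`, with the variables of `γ` eta-expanded. -/
def eta (C : Type u) (γ : Scope S) (n : ℕ) : Env C S := fun i =>
  match γ.get? i with
  | none => .inl (i + n)
  | some (δ, _) => .inr (δ, .var (i + n + δ.length) (idSp δ))

theorem eta_nil (n : ℕ) : eta C (.nil : Scope S) n = ofRen (· + n) := rfl

theorem eta_snoc_succ (γ δ : Scope S) (s : S) (n i : ℕ) :
    eta C (γ.snoc δ s) n (i + 1) = eta C γ (n + 1) i := by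
  simp only [eta, Scope.get?, show i + 1 + n = i + (n + 1) by omega]

theorem wEnv_eta (ς : PreSig C S) (γ δ ξ : Scope S) :
    WEnv ς (γ.append δ) (eta C δ ξ.length) ((γ.append δ).append ξ) := by
  intro i δ' s hi
  have h : ((γ.append δ).append ξ).get? (i + ξ.length) = some (δ', s) := by simpa using hi
  by_cases hk : i < δ.length
  · have hi' := hi
    rw [Scope.get?_append_of_lt _ hk] at hi
    refine .inr ⟨.var (i + ξ.length + δ'.length) (idSp δ'), by simp only [eta, hi],
      Scope.sizeOf_lt_of_get? hi', .var (δ := δ') ?_ ?_⟩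
    · simpa using h
    · exact (isExpr_idSp ς δ').left_append _
  · exact .inl ⟨_, by simp only [eta, Scope.get?_eq_none (not_lt.1 hk)], h⟩

/-- A typed environment may send a variable to a variable only if the types match on the nose,
whereas an instantiated expression may be retyped by conversion. Replacing variables by their
eta-expansions gains this freedom without changing the action. -/
theorem same_eta (ς : PreSig C S) (γ δ ξ : Scope S) :
    Same ς (γ.append δ) (eta C δ ξ.length) (ofRen (· + ξ.length)) := by
  refine ⟨_, _, wEnv_eta ς γ δ ξ, wEnv_shift ς _ ξ, ?_⟩
  intro i δ' s hi
  by_cases hk : i < δ.length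
  · rw [Scope.get?_append_of_lt _ hk] at hi
    simp only [eta, hi, entry, ofRen]
  · simp only [eta, Scope.get?_eq_none (not_lt.1 hk), ofRen]

end Env

/-- Judgments are stable under conversion of contexts. -/
theorem CtxConv.derives (h𝕋 : 𝕋.WellScoped nrm) {Γ Γ₀ Γ₁ : Ctx C} {J : Judgment C}
    (hc : CtxConv nrm (𝕋.presig nrm) 𝕋.rew (Γ.erase nrm) Γ₀ Γ₁)
    (hΓ₁ : Derives nrm 𝕋 (Γ.append Γ₁) .ctx) (hJ : Derives nrm 𝕋 (Γ.append Γ₀) J) :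
    Derives nrm 𝕋 (Γ.append Γ₁) J := by
  induction hN : sizeOf (Γ₀.erase nrm) using Nat.strong_induction_on
    generalizing Γ Γ₀ Γ₁ J with
  | _ N ihN =>
    subst hN
    have hΓ₁s := (h𝕋.derives hΓ₁).1
    have hl := hc.length_eq
    -- The typed environment is built along the prefixes `P` of `Γ₀`: validity of the next entry is
    -- transported to `Γ.append Γ₁` by the part already built.
    have key : ∀ P Q : Ctx C, Γ₀ = P.append Q →
        TEnv nrm 𝕋 (Γ.append P) (Env.eta C (P.erase nrm) Q.length) (Γ.append Γ₁) := by
      intro P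
      induction P with
      | nil =>
        intro Q hQ
        rw [Ctx.nil_append] at hQ
        subst hQ
        rw [Ctx.erase, Env.eta_nil, hl]
        exact (tEnvLt_shift 0 Γ Γ₁).toTEnv
      | snoc P Δ T ih _ =>
        intro Q hQ
        have ih := ih ((Ctx.nil.snoc Δ T).append Q) (by rw [hQ, ← Ctx.append_assoc]; rfl)
        rw [Ctx.length_append] at ih
        simp only [Ctx.length, Nat.zero_add, Nat.add_comm 1] at ih
        have hP : Derives nrm 𝕋 ((Γ.append P).append Δ) (.ty T) := by
          have := hJ.ctx
          rw [hQ, ← Ctx.append_assoc] at this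
          exact Derives.of_snoc this.of_append
        have hPs := h𝕋.derives hP
        have hs := Env.same_eta (𝕋.presig nrm) (Γ.erase nrm) (P.erase nrm)
          (((Ctx.nil.snoc Δ T).append Q).erase nrm)
        rw [Ctx.length_erase, Ctx.length_append] at hs
        simp only [Ctx.length, Nat.zero_add, Nat.add_comm 1] at hs
        have hctx : ∀ {D : Ctx C} {X : Ty C},
            IsCtx nrm (𝕋.presig nrm) ((Γ.append P).erase nrm) D →
            IsTy (𝕋.presig nrm) (((Γ.append P).erase nrm).append (D.erase nrm)) X →
            D.hs (Env.eta C (P.erase nrm) (Q.length + 1)) = D.wk (Q.length + 1) 0 ∧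
            (D.wk 1 0).hs (Env.eta C ((P.snoc Δ T).erase nrm) Q.length) = D.wk (Q.length + 1) 0 ∧
            X.hs ((Env.eta C (P.erase nrm) (Q.length + 1)).lift D.length) =
              X.wk (Q.length + 1) D.length ∧
            (X.wk 1 D.length).hs
              ((Env.eta C ((P.snoc Δ T).erase nrm) Q.length).lift (D.wk 1 0).length) =
              X.wk (Q.length + 1) D.length := by
          intro D X hD hX
          rw [Ctx.erase_append] at hD hX
          have hs2 := Env.same_eta (𝕋.presig nrm) (Γ.erase nrm) ((P.snoc Δ T).erase nrm)
            (Q.erase nrm)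
          have hD' : IsCtx nrm (𝕋.presig nrm)
              ((Γ.erase nrm).append ((P.snoc Δ T).erase nrm)) (D.wk 1 0) := by
            rw [Ctx.wk_zero_eq_hs S]
            exact hD.hs (Env.wEnv_shift _ _ (.snoc .nil (Δ.erase nrm) (T.erase nrm)))
          have hX' : IsTy (𝕋.presig nrm)
              (((Γ.erase nrm).append ((P.snoc Δ T).erase nrm)).append (D.erase nrm))
              (X.wk 1 D.length) := by
            rw [Ty.wk_eq_hs S, ← Ctx.length_erase nrm]
            exact hX.hs ((Env.wEnv_shift _ _ (.snoc .nil (Δ.erase nrm) (T.erase nrm))).lift _)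
          have hsl := hs.lift (D.erase nrm)
          have hs2l := hs2.lift (D.erase nrm)
          simp only [Ctx.length_erase] at hsl hs2 hs2l
          refine ⟨?_, ?_, ?_, ?_⟩
          · rw [hs.ctx hD, Ctx.wk_zero_eq_hs S]
          · rw [hs2.ctx hD', ← Ctx.wk_zero_eq_hs S, Ctx.wk_wk_same, Nat.add_comm 1]
          · rw [hsl.ty hX, Ty.wk_eq_hs S]
          · rw [Ctx.length_wk, hs2l.ty hX', ← Ty.wk_eq_hs S, Nat.add_comm _ 1]
            exact congrArg (Ty.mk _) (Expr.wk_wk_same _ _ _ _)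
        intro i D X hi
        cases hi with
        | here =>
          have hΔs := (IsCtx.append.1 hPs.1).2
          rw [Scope.nil_append] at hΔs
          have hTs := hPs.2
          simp only [Judgment.IsIn] at hTs
          rw [Ctx.erase_append] at hTs
          obtain ⟨e1, e2, e3, e4⟩ := hctx hΔs hTs
          refine .inr ⟨.var (0 + Q.length + (Δ.erase nrm).length) (idSp (Δ.erase nrm)), ?_, ?_, ?_⟩
          · rw [Ctx.erase_wk]; rfl
          · exact Scope.sizeOf_lt_of_get? ((Ctx.Has.here).get? nrm)
          · rw [e2, e4]
            have hT := hP.hs h𝕋 ih hΓ₁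
            rw [e1, Judgment.hs, e3] at hT
            obtain ⟨Δ₁, T₁, h₁⟩ := Ctx.exists_has (Γ := Γ₁) (i := Q.length) (by
              rw [← hl, hQ, Ctx.length_append, Ctx.length]; omega)
            have h₀ : Γ₀.Has (0 + Q.length) _ _ := hQ ▸ (Ctx.Has.here).append_left Q
            rw [Nat.zero_add, Ctx.wk_wk_same, Ctx.length_wk, Nat.add_comm 1] at h₀
            have e5 : (T.wk 1 Δ.length).wk Q.length Δ.length = T.wk (Q.length + 1) Δ.length := by
              rw [Nat.add_comm]
              exact congrArg (Ty.mk _) (Expr.wk_wk_same _ _ _ _)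
            rw [e5] at h₀
            obtain ⟨hc1, hc2⟩ := hc.entry h₀ h₁
            have hB : (Γ.append Γ₁).erase nrm = (Γ.erase nrm).append (Γ₀.erase nrm) := by
              rw [Ctx.erase_append, hc.erase_eq]
            have h₁' := h₁.append_right Γ
            have hid := Derives.idSp h𝕋 (h₁'.derives h𝕋 hΓ₁).ctx
            have hlt : sizeOf (Δ₁.erase nrm) < sizeOf (Γ₀.erase nrm) := by
              rw [hc.erase_eq]
              exact Scope.sizeOf_lt_of_get? (h₁.get? nrm)
            -- The identity spine is typed in the extension by the entry context of `Γ₁`. The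
            -- induction hypothesis, for this smaller context, moves it to the extension by the
            -- entry context of `Γ₀`.
            have hid' := ihN _ hlt (hB ▸ hc1.symm) hT.ctx hid rfl
            rw [← hc1.length_eq] at hid'
            have hv := Derives.var_idSp hΓ₁s h₁' hc1.erase_eq hid'
            rw [← hc1.erase_eq, Ctx.erase_wk, Ctx.length_wk] at hv
            rw [Nat.zero_add, Ctx.length_erase]
            refine .conv (T := T₁) ?_ hv hT
            rw [Ctx.erase_append, hB]
            exact hc2.symm
        | @there _ D _ X _ i hi =>
          obtain ⟨hDs, hXs⟩ := hi.isCtx (IsCtx.append.1 hPs.1).1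
          rw [Scope.nil_append] at hDs hXs
          obtain ⟨e1, e2, e3, e4⟩ := hctx hDs hXs
          have he' : Env.eta C ((P.snoc Δ T).erase nrm) Q.length (i + 1) =
              Env.eta C (P.erase nrm) (Q.length + 1) i := Env.eta_snoc_succ _ _ _ _ _
          rw [e2, e4, ← e1, ← e3, he']
          rcases ih i _ _ hi with h | ⟨u, hu, hN, h⟩
          · exact .inl h
          · refine .inr ⟨u, by rw [hu, Ctx.erase_wk], ?_, h⟩
            exact Scope.sizeOf_lt_of_get? ((hi.there (Δ' := Δ) (T' := T)).get? nrm)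
    have hσ := key Γ₀ .nil rfl
    have := Derives.hs (Ξ := .nil) h𝕋 hJ hσ hΓ₁
    -- For the whole of `Γ₀` the shift is by `0`, so the environment acts as the identity.
    have hs := Env.same_eta (𝕋.presig nrm) (Γ.erase nrm) (Γ₀.erase nrm) .nil
    have hJs := (h𝕋.derives hJ).2
    rw [Ctx.erase_append] at hJs
    simp only [Ctx.length, Env.lift_zero, Ctx.hs, Ctx.append_nil] at this
    have e := hs.judgment hJs
    simp only [Scope.length] at e
    rw [e] at this
    exact (Judgment.hs_id S J) ▸ this

/-- If the identity spine can be typed by a context then this context is convertible to the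
ambient one. -/
theorem Derives.ctxConv_of_idSp (h𝕋 : 𝕋.WellScoped nrm) {Γ Γ₀ Δ : Ctx C}
    (hΔ : IsCtx nrm (𝕋.presig nrm) (Γ.erase nrm) Δ) (he : Γ₀.erase nrm = Δ.erase nrm)
    (h : Derives nrm 𝕋 (Γ.append Γ₀) (.sp (CompLF.idSp (Δ.erase nrm)) (Δ.wk Γ₀.length 0))) :
    CtxConv nrm (𝕋.presig nrm) 𝕋.rew (Γ.erase nrm) Γ₀ Δ := by
  induction hN : sizeOf (Δ.erase nrm) using Nat.strong_induction_on generalizing Γ Γ₀ Δ with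
  | _ N ihN =>
    subst hN
    have hΓ := (h𝕋.derives h).1
    have hl : Γ₀.length = Δ.length := by rw [← Ctx.length_erase nrm, he, Ctx.length_erase]
    have key : ∀ {i Ξ X D T}, Γ₀.Has i Ξ X → Δ.Has i D T →
        CtxConv nrm (𝕋.presig nrm) 𝕋.rew ((Γ.erase nrm).append (Γ₀.erase nrm)) Ξ D ∧
        Conv (𝕋.presig nrm) 𝕋.rew (((Γ.erase nrm).append (Γ₀.erase nrm)).append (Ξ.erase nrm))
          .ty X.expr T.expr := by
      intro i Ξ X D T hi hi'
      have heq : Ξ.erase nrm = D.erase nrm := by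
        have h1 := hi.get? nrm
        have h2 := hi'.get? nrm
        rw [he, h2, Option.some.injEq, Prod.mk.injEq] at h1
        exact h1.1.symm
      have hs := Env.wEnv_shift (𝕋.presig nrm) (Γ.erase nrm) (Γ₀.erase nrm)
      rw [Ctx.length_erase] at hs
      have hi'' := (hi'.hs hΔ hs).append_right (Γ.append Γ₀)
      -- The argument at position `i` is the eta-expanded variable, typed at the entry of `Δ`.
      -- Inverting its typing brings in the entry of `Γ₀` for the same variable.
      have ht := h.tEnvLt_inst h𝕋
      rw [Ctx.erase_wk, Ctx.wk_zero_eq_hs S] at ht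
      have hinst := Env.inst_of_get? (hi'.get? nrm) (arg?_idSp (C := C) (hi'.get? nrm))
      obtain ⟨hDs, hTs⟩ := hi'.isCtx hΔ
      have hc := Env.comm_idSp (𝕋.presig nrm) (Γ.erase nrm) (Δ.erase nrm)
      have hc' := hc.lift (D.erase nrm)
      simp only [Ctx.length_erase] at hc hc'
      rcases ht _ _ _ hi'' with ⟨j, hj, -⟩ | ⟨u, hu, -, hu'⟩
      · rw [hinst] at hj; cases hj
      · rw [hinst] at hu
        simp only [Sum.inr.injEq, Prod.mk.injEq] at hu
        obtain ⟨-, rfl⟩ := hu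
        rw [Ctx.length_hs, hl, hc.ctx hDs, hc'.ty hTs] at hu'
        simp only [Env.lift_id, Ctx.hs_id, Ty.hs_id, Ctx.length_erase] at hu'
        obtain ⟨Δ', X', hx, hts, hconv⟩ := hu'.inv_var
        obtain ⟨rfl, rfl⟩ := hx.unique ((hi.append_right Γ).append_left D)
        rw [← heq] at hts
        obtain ⟨hΞs, hXs⟩ := (hi.append_right Γ).isCtx hΓ
        rw [Scope.nil_append] at hΞs hXs
        have hl' : D.length = Ξ.length := by
          rw [← Ctx.length_erase nrm, ← heq, Ctx.length_erase]
        -- Here an identity spine in the extension by `D` is typed by `Ξ`: the two contexts have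
        -- exchanged roles, whence the later `symm`.
        have h3 := ihN (sizeOf (Ξ.erase nrm)) (heq ▸ Scope.sizeOf_lt_of_get? (hi'.get? nrm))
          hΞs heq.symm hts rfl
        have hcX := (Env.comm_idSp (𝕋.presig nrm) ((Γ.append Γ₀).erase nrm) (Ξ.erase nrm)).ty hXs
        rw [Ty.subst_zero_eq_hs, Ctx.erase_wk, ← heq, Ty.wk_eq_hs S, hl'] at hconv
        simp only [Ctx.length_erase, Ty.hs_id] at hcX
        rw [hcX, Ctx.erase_append, ← heq] at hconv
        rw [Ctx.erase_append] at h3 hconv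
        exact ⟨h3.symm, hconv⟩
    exact .mk he (fun i _ _ _ _ hi hi' => (key hi hi').1) (fun i _ _ _ _ hi hi' => (key hi hi').2)

end

/-! ### Matching up to conversion -/

section

variable {C : Type u} {S : Type v} {ς : PreSig C S} {R : Set (Rule C S)} {nrm : C ↪ S}
  {𝕋 : Theory C S}

/-! ### Many-step rewriting of spines -/

theorem Reds.isExpr (hR : ∀ r ∈ R, IsRule ς r) {γ : Scope S} {K : Kind S} {e e' : Expr C}
    (h : Reds ς R γ K e e') (he : IsExpr ς γ K e) : IsExpr ς γ K e' :=
  ((Conv.of_reds h).isExpr_iff hR).1 he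

theorem Reds.exists_arg {γ δ : Scope S} {us vs : Expr C}
    (h : Reds ς R γ (.sp δ) us vs) (hus : IsExpr ς γ (.sp δ) us) {i : ℕ} {ξ : Scope S} {s : S}
    (hi : δ.get? i = some (ξ, s)) :
    ∃ u v, us.arg? i = some u ∧ vs.arg? i = some v ∧ Reds ς R (γ.append ξ) (.tm s) u v := by
  induction h with
  | refl =>
    obtain ⟨u, hu, -⟩ := hus.exists_arg hi
    exact ⟨u, u, hu, hu, .refl⟩
  | tail _ h ih =>
    obtain ⟨u, v, hu, hv, huv⟩ := ih
    obtain ⟨v', w, hv', hw, hvw⟩ := h.exists_arg hi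
    rw [hv] at hv'
    cases hv'
    exact ⟨u, w, hu, hw, huv.trans hvw⟩

theorem Red.append_right {γ δ ξ : Scope S} {us vs vs' : Expr C} (hus : IsExpr ς γ (.sp δ) us)
    (h : Red ς R γ (.sp ξ) vs vs') :
    Red ς R γ (.sp (δ.append ξ)) (us.append vs) (us.append vs') := by
  induction ξ generalizing vs vs' with
  | nil => cases h
  | snoc ξ _ _ ih _ =>
    cases h with
    | snocLeft h hn hu => exact .snocLeft (ih h) hn hu
    | snocRight hts hn h => exact .snocRight (hus.append hts) hn h

theorem Reds.append_right {γ δ ξ : Scope S} {us vs vs' : Expr C} (hus : IsExpr ς γ (.sp δ) us)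
    (h : Reds ς R γ (.sp ξ) vs vs') :
    Reds ς R γ (.sp (δ.append ξ)) (us.append vs) (us.append vs') := by
  induction h with
  | refl => exact .refl
  | tail _ h ih => exact ih.tail (Red.append_right hus h)

theorem Red.append_left {γ δ ξ : Scope S} {us us' vs : Expr C} (hvs : IsExpr ς γ (.sp ξ) vs)
    (h : Red ς R γ (.sp δ) us us') :
    Red ς R γ (.sp (δ.append ξ)) (us.append vs) (us'.append vs) := by
  induction ξ generalizing vs with
  | nil => cases hvs; simpa using h
  | snoc ξ _ _ ih _ =>
    cases hvs with
    | snoc hts hn ht => exact .snocLeft (ih hts) hn ht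

theorem Reds.append_left {γ δ ξ : Scope S} {us us' vs : Expr C} (hvs : IsExpr ς γ (.sp ξ) vs)
    (h : Reds ς R γ (.sp δ) us us') :
    Reds ς R γ (.sp (δ.append ξ)) (us.append vs) (us'.append vs) := by
  induction h with
  | refl => exact .refl
  | tail _ h ih => exact ih.tail (Red.append_left hvs h)

theorem Expr.append_assoc (us vs ws : Expr C) :
    (us.append vs).append ws = us.append (vs.append ws) := by
  induction ws with
  | snoc ts n t ih _ => simp only [append, ih]
  | _ => simp [append]

theorem Env.inst_append_of_lt {γ δ ξ : Scope S} {us vs : Expr C} (hvs : IsExpr ς γ (.sp ξ) vs)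
    {i : ℕ} (hi : i < ξ.length) : inst (δ.append ξ) (us.append vs) i = inst ξ vs i := by
  simp only [inst, Scope.get?_append_of_lt _ hi, Expr.arg?_append_of_lt hvs hi]
  obtain ⟨δ', s, h⟩ := Scope.exists_get? hi
  simp only [h]

theorem Env.lift_congr {n m : ℕ} {σ τ : Env C S} (h : ∀ i < m, σ i = τ i) :
    ∀ i < m + n, σ.lift n i = τ.lift n i := by
  intro i hi
  by_cases hk : i < n
  · rw [lift_of_lt _ hk, lift_of_lt _ hk]
  · obtain ⟨l, rfl⟩ := Nat.exists_eq_add_of_le' (not_lt.1 hk)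
    simp only [lift, Nat.add_sub_cancel, h l (by omega)]

theorem Env.lift_comp_liftRen (n : ℕ) (σ : Env C S) (ρ : ℕ → ℕ) :
    σ.lift n ∘ liftRen n ρ = Env.lift n (σ ∘ ρ) := by
  funext i
  by_cases hi : i < n
  · simp [Env.lift_of_lt _ hi, liftRen_of_lt _ hi]
  · obtain ⟨j, rfl⟩ := Nat.exists_eq_add_of_le' (not_lt.1 hi)
    simp [Env.lift]

/-! ### Matching -/

theorem Strategy.reds (𝔖 : Strategy ς R) {γ : Scope S} {K : Kind S} {e e' : Expr C}
    (h : 𝔖.steps γ K e e') : Reds ς R γ K e e' := by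
  induction h with
  | refl => exact .refl
  | tail _ h ih => exact ih.trans (𝔖.le_reds h)

variable {𝔖 : Strategy ς R}

namespace Match

theorem isExpr (hR : ∀ r ∈ R, IsRule ς r) {γf γ γ₀ : Scope S} {K : Kind S} {t u vs : Expr C}
    (h : Match 𝔖 γf γ γ₀ K t u vs) : IsExpr ς γf (.sp γ) vs := by
  induction h with
  | rigid _ _ _ ih => exact ih
  | flex hu => exact .snoc .nil rfl hu
  | nil => exact .nil
  | snoc _ _ _ h1 h12' _ h2 hnf _ _ _ =>
    exact (h1.append (Reds.isExpr hR (𝔖.reds hnf.1) h12')).append h2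
  | ty _ _ ih => exact ih

theorem isExpr_pattern {γf γ γ₀ : Scope S} {K : Kind S} {t u vs : Expr C}
    (h : Match 𝔖 γf γ γ₀ K t u vs) : IsExpr ς (γ.append γ₀) K t := by
  induction h with
  | rigid hc _ _ ih => exact .const hc ih
  | @flex γ₀ s u hu =>
    refine .var (δ := γ₀) ?_ ((isExpr_idSp ς γ₀).left_append _)
    exact (congrArg _ (Nat.zero_add _).symm).trans (Scope.get?_append_add _ γ₀ 0)
  | nil => exact .nil
  | @snoc γ₁ γ₁₂ γ₂ γ₀ δ γx s n ts t us u vs₁ vs₁₂ vs₁₂' vs₁₂'' vs₂ _ hn _ _ _ _ _ _ _ ih ih' =>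
    refine .snoc ih.wk hn ?_
    have := ih'.left_append γ₁
    rwa [← Scope.append_assoc, ← Scope.append_assoc, ← Scope.append_assoc] at this
  | ty hc _ ih => exact .ty hc ih

/-- The instance of the pattern by the result of matching is convertible to the matched
expression. -/
theorem conv (hR : ∀ r ∈ R, IsRule ς r) {γf γ γ₀ : Scope S} {K : Kind S} {t u vs : Expr C}
    (h : Match 𝔖 γf γ γ₀ K t u vs) :
    Conv ς R (γf.append γ₀) K (Expr.subst γ vs γ₀.length t) u := by
  induction h with
  | rigid hc hu _ ih =>
    rw [Expr.subst_eq_hs] at ih ⊢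
    exact (Conv.const hc ih).trans (Conv.of_reds (𝔖.reds hu)).symm
  | @flex γ₀ s u hu =>
    have h0 : Env.inst (.snoc .nil γ₀ s) (.snoc .nil γ₀.length u) 0 = .inr (γ₀, u) := rfl
    have h1 := Env.lift_add_inr (n := γ₀.length) h0
    rw [Nat.zero_add] at h1
    rw [Expr.subst_eq_hs, Expr.hs_var_inr h1, idSp_hs _ (fun k hk => Env.lift_of_lt _ hk),
      Expr.subst_zero_eq_hs, Expr.hs_idSp_aux _ _ _ _ hu]
    exact Conv.refl _
  | nil =>
    rw [Expr.subst_eq_hs]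
    exact Conv.refl _
  | @snoc γ₁ γ₁₂ γ₂ γ₀ δ γx s n ts t us u vs₁ vs₁₂ vs₁₂' vs₁₂'' vs₂ h hn h' h1 h12' h12'' h2
      hnf hnf' ih ih' =>
    subst hn
    have h12 := Reds.isExpr hR (𝔖.reds hnf.1) h12'
    have hv := (h1.append h12).append h2
    have hp := h.isExpr_pattern
    have hp' := h'.isExpr_pattern
    rw [Expr.subst_eq_hs] at ih ih' ⊢
    rw [Expr.hs, Env.lift_lift]
    rw [Scope.length_append] at ih'
    -- The left part was matched with `vs₁₂'` for the shared variables, of which `vs₁₂` is a reduct;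
    -- the weakening by `γ₂` cancels the values `vs₂`.
    have c1 : Conv ς R (γf.append γ₀) (.sp δ)
        ((ts.wk γ₂.length γ₀.length).hs ((Env.inst ((γ₁.append γ₁₂).append γ₂)
          ((vs₁.append vs₁₂).append vs₂)).lift γ₀.length)) us := by
      have hc := (Env.comm_shift_inst_append (h1.append h12) h2).lift γ₀
      have hp2 : IsExpr ς ((γf.append (γ₁.append γ₁₂)).append γ₀) (.sp δ) ts := by
        rw [Scope.append_assoc]; exact hp.left_append _
      rw [Expr.wk_eq_hs S, hc.expr hp2, Env.lift_id, Expr.hs_id]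
      refine Conv.trans ?_ ih
      exact hp2.hs_conv hR ((wEnv_inst (h1.append h12)).lift γ₀)
        ((wEnv_inst (h1.append h12')).lift γ₀)
        ((Env.convOn_inst hR (Conv.of_reds (Reds.append_right h1 (𝔖.reds hnf.1))).symm
          (h1.append h12)).lift hR γ₀)
    -- The right part contains only variables of `γ₁₂.append γ₂`, so it does not see `vs₁`; then
    -- `vs₁₂''` is replaced by its reduct `vs₁₂`.
    have c2 : Conv ς R ((γf.append γ₀).append γx) (.tm s)
        (t.hs ((Env.inst ((γ₁.append γ₁₂).append γ₂)
          ((vs₁.append vs₁₂).append vs₂)).lift (γ₀.length + γx.length))) u := by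
      rw [Scope.append_assoc γf]
      have e : t.hs ((Env.inst ((γ₁.append γ₁₂).append γ₂)
          ((vs₁.append vs₁₂).append vs₂)).lift (γ₀.length + γx.length)) =
          t.hs ((Env.inst (γ₁₂.append γ₂) (vs₁₂.append vs₂)).lift (γ₀.length + γx.length)) := by
        apply Expr.hs_congr_get hp'
        simp only [Scope.length_append γ₀, Scope.length_append (γ₁₂.append γ₂)]
        apply Env.lift_congr
        intro i hi
        rw [Scope.append_assoc, Expr.append_assoc]
        exact Env.inst_append_of_lt (h12.append h2) hi
      rw [e]
      have hp2 : IsExpr ς ((γf.append (γ₁₂.append γ₂)).append (γ₀.append γx)) (.tm s) t := by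
        rw [Scope.append_assoc]; exact hp'.left_append _
      refine Conv.trans ?_ ih'
      rw [← Scope.length_append]
      exact hp2.hs_conv hR ((wEnv_inst (h12.append h2)).lift (γ₀.append γx))
        ((wEnv_inst (h12''.append h2)).lift (γ₀.append γx))
        ((Env.convOn_inst hR (Conv.of_reds (Reds.append_left h2 (𝔖.reds hnf'.1))).symm
          (h12.append h2)).lift hR (γ₀.append γx))
    refine .snoc ?_ ?_ c1 c2
    · refine IsExpr.hs (IsExpr.wk hp |>.left_append γf) ?_
      rw [← Scope.append_assoc]
      exact (wEnv_inst hv).lift γ₀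
    · refine (c2.isExpr_iff hR).1 ?_
      have := (hp'.left_append γ₁).left_append γf
      rw [← Scope.append_assoc, ← Scope.append_assoc, ← Scope.append_assoc,
        ← Scope.append_assoc] at this
      have hh := this.hs (σ := (Env.inst ((γ₁.append γ₁₂).append γ₂)
          ((vs₁.append vs₁₂).append vs₂)).lift (γ₀.length + γx.length))
        (γ' := (γf.append γ₀).append γx) (by
          rw [Scope.append_assoc γf, Scope.append_assoc γf, ← Env.lift_lift]
          exact ((wEnv_inst hv).lift γ₀).lift γx)
      exact hh
  | ty hc _ ih =>
    rw [Expr.subst_eq_hs] at ih ⊢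
    exact Conv.ty hc ih

end Match

/-- The entries of the spine `w` for `θ`, from position `b` on, are convertible to those of the spine
`v` for `γ`. -/
def SegConv (ς : PreSig C S) (R : Set (Rule C S)) (γf θ γ : Scope S) (b : ℕ) (w v : Expr C) :
    Prop :=
  ∀ i δ s, γ.get? i = some (δ, s) → θ.get? (i + b) = some (δ, s) ∧
    ∃ a a', w.arg? (i + b) = some a ∧ v.arg? i = some a' ∧ Conv ς R (γf.append δ) (.tm s) a a'

/-- A pattern embedded into a larger scope of flexible variables. -/
theorem Match.conv_wk (hR : ∀ r ∈ R, IsRule ς r) {γf θ γ γ₀ : Scope S} {K : Kind S}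
    {t u v w : Expr C} {b : ℕ} (h : Match 𝔖 γf γ γ₀ K t u v) (hw : IsExpr ς γf (.sp θ) w)
    (hv : SegConv ς R γf θ γ b w v) :
    Conv ς R (γf.append γ₀) K ((t.wk b γ₀.length).hs ((Env.inst θ w).lift γ₀.length)) u := by
  refine Conv.trans ?_ (h.conv hR)
  rw [Expr.subst_eq_hs, Expr.wk, Expr.hs_ren, wkRen_eq, Env.lift_comp_liftRen]
  have hvs := h.isExpr hR
  refine h.isExpr_pattern.hs_conv hR (WEnv.lift ?_ γ₀) (WEnv.lift ?_ γ₀)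
    (Env.ConvOn.lift hR ?_ γ₀)
  · intro i δ s hi
    obtain ⟨h1, a, a', ha, -⟩ := hv i δ s hi
    obtain ⟨a₂, ha₂, h⟩ := hw.exists_arg h1
    exact .inr ⟨a₂, Env.inst_of_get? h1 ha₂, Scope.sizeOf_lt_of_get? hi, h⟩
  · intro i δ s hi
    obtain ⟨a, ha, h⟩ := hvs.exists_arg hi
    exact .inr ⟨a, Env.inst_of_get? hi ha, Scope.sizeOf_lt_of_get? hi, h⟩
  · intro i δ s hi
    obtain ⟨h1, a, a', ha, ha', h⟩ := hv i δ s hi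
    exact .inr ⟨a, a', Env.inst_of_get? h1 ha, Env.inst_of_get? hi ha', h⟩

end

/-! ### Matching with types -/

section

variable {C : Type u} {S : Type v} {ς : PreSig C S} {R : Set (Rule C S)} {nrm : C ↪ S}
  {𝕋 : Theory C S}

/-! ### Rigidity -/

theorem Expr.occurs_ren {c : C} {e : Expr C} (ρ : ℕ → ℕ) : (e.ren ρ).Occurs c ↔ e.Occurs c := by
  induction e generalizing ρ with
  | var i ts ih => exact ih ρ
  | const d ts ih => exact or_congr Iff.rfl (ih ρ)
  | nil => exact Iff.rfl
  | snoc ts n t ih ih' => exact or_congr (ih ρ) (ih' _)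

theorem keep_of_forall {γ : Scope S} {Δ : Ctx C} {ts : Expr C} {ν : List Bool}
    (h : IsExpr ς γ (.sp (Δ.erase nrm)) ts) (hl : ν.length = Δ.length)
    (hν : ∀ b ∈ ν, b = false) : keep ν ts = ts := by
  induction Δ generalizing ts ν with
  | nil => cases h; cases ν <;> rfl
  | snoc Δ Γ T ih _ =>
    cases h with
    | snoc hts hn ht =>
      cases ν with
      | nil => cases hl
      | cons b ν =>
        obtain ⟨rfl, hν'⟩ := List.forall_mem_cons.1 hν
        simp only [keep, ih hts (Nat.succ.inj hl) hν', Bool.false_eq_true, if_false]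

theorem Ctx.eraseBy_of_forall {Δ : Ctx C} {ν : List Bool} (hl : ν.length = Δ.length)
    (hν : ∀ b ∈ ν, b = false) : Δ.eraseBy nrm ν = Δ.erase nrm := by
  induction Δ generalizing ν with
  | nil => cases ν <;> rfl
  | snoc Δ Γ T ih _ =>
    cases ν with
    | nil => cases hl
    | cons b ν =>
      obtain ⟨rfl, hν'⟩ := List.forall_mem_cons.1 hν
      simp only [eraseBy, ih (Nat.succ.inj hl) hν', Bool.false_eq_true, if_false, erase]

theorem Theory.SubjectReduction.reds (hsr : 𝕋.SubjectReduction nrm) {Γ : Ctx C} {t t' : Expr C}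
    {T : Ty C} (ht : Derives nrm 𝕋 Γ (.tm t T))
    (h : Reds (𝕋.presig nrm) 𝕋.rew (Γ.erase nrm) (.tm (T.erase nrm)) t t') :
    Derives nrm 𝕋 Γ (.tm t' T) := by
  induction h with
  | refl => exact ht
  | tail _ h ih => exact hsr _ _ _ _ ih h

theorem Derives.inv_ty {Γ : Ctx C} {c : C} {us : Expr C} (h : Derives nrm 𝕋 Γ (.ty ⟨c, us⟩)) :
    ∃ Δ ν ts, (⟨c, Δ, ν, none⟩ : Decl C) ∈ 𝕋.sig ∧ us = keep ν ts ∧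
      Derives nrm 𝕋 Γ (.sp ts Δ) := by
  cases h with
  | type hc hts => exact ⟨_, _, _, hc, rfl, hts⟩

theorem Derives.inv_snoc {Γ Δ Γx : Ctx C} {T : Ty C} {ts t : Expr C} {n : ℕ}
    (h : Derives nrm 𝕋 Γ (.sp (.snoc ts n t) (Δ.snoc Γx T))) :
    Derives nrm 𝕋 Γ (.sp ts Δ) ∧
      Derives nrm 𝕋 (Γ.append (Γx.subst (Δ.erase nrm) ts 0))
        (.tm t (T.subst (Δ.erase nrm) ts Γx.length)) := by
  cases h with
  | extSpine _ h1 h2 => exact ⟨h1, h2⟩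

/-! ### Segments of spines -/

namespace SegConv

theorem conv_right (hR : ∀ r ∈ R, IsRule ς r) {γf θ γ : Scope S} {b : ℕ} {w v v' : Expr C}
    (h : SegConv ς R γf θ γ b w v) (hv : IsExpr ς γf (.sp γ) v)
    (h' : Conv ς R γf (.sp γ) v v') : SegConv ς R γf θ γ b w v' := by
  intro i δ s hi
  obtain ⟨h1, a, a', ha, ha', hc⟩ := h i δ s hi
  obtain ⟨x, y, hx, hy, hxy⟩ := h'.exists_arg hR hv hi
  rw [ha'] at hx
  cases hx
  exact ⟨h1, a, y, ha, hy, hc.trans hxy⟩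

/-- Positions are counted from the right, so the left part of a concatenation starts `δ.length`
places further on. -/
theorem left {γf θ γ δ : Scope S} {b : ℕ} {w v v' : Expr C} (hv' : IsExpr ς γf (.sp δ) v')
    (h : SegConv ς R γf θ (γ.append δ) b w (v.append v')) :
    SegConv ς R γf θ γ (δ.length + b) w v := by
  intro i ξ s hi
  have := h (i + δ.length) ξ s (by simpa using hi)
  rwa [Expr.arg?_append_add hv', Nat.add_assoc] at this

theorem right {γf θ γ δ : Scope S} {b : ℕ} {w v v' : Expr C} (hv' : IsExpr ς γf (.sp δ) v')
    (h : SegConv ς R γf θ (γ.append δ) b w (v.append v')) :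
    SegConv ς R γf θ δ b w v' := by
  intro i ξ s hi
  have := h i ξ s (Scope.get?_append_of_some _ hi)
  rwa [Expr.arg?_append_of_lt hv' (Scope.lt_of_get? hi)] at this

end SegConv

/-! ### Typed matching -/

/-- The typing hypotheses on a pattern `t` in `Γ.Θ.Γ₀` and an expression `u` in `Γ.Γ₀'`, where
`σ` is an environment from `Γ.Θ` to `Γ`. -/
def MatchTyped (nrm : C ↪ S) (𝕋 : Theory C S) (Γ Θ Γ₀ Γ₀' : Ctx C) (σ : Env C S)
    (t u : Expr C) : Kind S → Prop
  | .tm s => ∃ T U, Derives nrm 𝕋 ((Γ.append Θ).append Γ₀) (.tm t T) ∧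
      Derives nrm 𝕋 (Γ.append Γ₀') (.tm u U) ∧ U.erase nrm = s ∧
      Conv (𝕋.presig nrm) 𝕋.rew ((Γ.erase nrm).append (Γ₀.erase nrm)) .ty
        (T.hs (σ.lift Γ₀.length)).expr U.expr
  | .sp δ => ∃ Δ, IsCtx nrm (𝕋.presig nrm) .nil Δ ∧ Δ.erase nrm = δ ∧
      Derives nrm 𝕋 ((Γ.append Θ).append Γ₀) (.sp t Δ) ∧ Derives nrm 𝕋 (Γ.append Γ₀') (.sp u Δ)
  | .ty => ∃ T U, t = T.expr ∧ u = U.expr ∧ Derives nrm 𝕋 ((Γ.append Θ).append Γ₀) (.ty T) ∧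
      Derives nrm 𝕋 (Γ.append Γ₀') (.ty U)

/-- The first arguments of the spine `v` instantiate the entries of `Γ.Θ` from position `b` on, up
to conversion of their contexts and types. -/
def ArgsTyped (nrm : C ↪ S) (𝕋 : Theory C S) (Γ Θ : Ctx C) (σ : Env C S) (n b : ℕ)
    (v : Expr C) : Prop :=
  ∀ i D X, i < n → (Γ.append Θ).Has (i + b) D X → ∃ a D' X', v.arg? i = some a ∧
    CtxConv nrm (𝕋.presig nrm) 𝕋.rew (Γ.erase nrm) D' (D.hs σ) ∧
    Conv (𝕋.presig nrm) 𝕋.rew ((Γ.erase nrm).append (D'.erase nrm)) .ty X'.expr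
      (X.hs (σ.lift D.length)).expr ∧
    Derives nrm 𝕋 (Γ.append D') (.tm a X')

theorem Theory.WellScoped.eq_of_mem_presig (h𝕋 : 𝕋.WellScoped nrm) {d : Decl C} (hd : d ∈ 𝕋.sig)
    {δ : Scope S} {s : Option S} (h : (d.name, δ, s) ∈ 𝕋.presig nrm) :
    δ = d.ctx.eraseBy nrm d.erased := by
  obtain ⟨d', hd', he⟩ := List.mem_map.1 h
  simp only [Prod.mk.injEq] at he
  obtain ⟨h1, rfl, -⟩ := he
  rw [h𝕋.unique _ hd' _ hd h1]

/-- Without erased arguments the spine written in the pattern is the full spine of premises, so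
inversion types exactly what matching inspects. -/
theorem IsRigid.keep_eq (h𝕋 : 𝕋.WellScoped nrm) {c : C} {e : Expr C}
    (he : IsRigid 𝕋 (.const c e)) {Δ : Ctx C} {ν : List Bool} {X : Option (Ty C)}
    (hc : (⟨c, Δ, ν, X⟩ : Decl C) ∈ 𝕋.sig) {γ δ : Scope S} {s : Option S} {ts : Expr C}
    (hδ : (c, δ, s) ∈ 𝕋.presig nrm) (hts : IsExpr (𝕋.presig nrm) γ (.sp (Δ.erase nrm)) ts) :
    keep ν ts = ts ∧ Δ.erase nrm = δ := by
  have hν := (he c (.inl rfl)).2 _ hc rfl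
  have hl := h𝕋.erased _ hc
  refine ⟨keep_of_forall hts hl hν, ?_⟩
  rw [h𝕋.eq_of_mem_presig hc hδ]
  exact (Ctx.eraseBy_of_forall hl hν).symm

/-- A spine with well-typed arguments is well-typed. -/
theorem ArgsTyped.derives (h𝕋 : 𝕋.WellScoped nrm) {Γ Θ : Ctx C} {w : Expr C}
    (hw : IsExpr (𝕋.presig nrm) (Γ.erase nrm) (.sp (Θ.erase nrm)) w)
    (h : ArgsTyped nrm 𝕋 Γ Θ (Env.inst (Θ.erase nrm) w) Θ.length 0 w)
    (hΘ : Derives nrm 𝕋 (Γ.append Θ) .ctx) : Derives nrm 𝕋 Γ (.sp w Θ) := by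
  induction Θ generalizing w with
  | nil =>
    cases hw
    exact .emptySpine hΘ
  | snoc Θ D T ih _ =>
    have hT : Derives nrm 𝕋 ((Γ.append Θ).append D) (.ty T) := Derives.of_snoc hΘ
    have hΘs := (h𝕋.derives hΘ).1
    cases hw with
    | @snoc _ _ _ _ ts t n hts hn ht =>
    rw [Ctx.length_erase] at hn
    subst hn
    obtain ⟨hΘs, hDs, hTs⟩ := hΘs
    rw [Scope.nil_append, Ctx.erase_append] at hDs hTs
    have h1 : Derives nrm 𝕋 Γ (.sp ts Θ) := by
      refine ih hts ?_ hT.ctx.of_append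
      intro i D₀ X₀ hi hD₀
      obtain ⟨h3, h4⟩ := hD₀.isCtx hΘs
      rw [Scope.nil_append, Ctx.erase_append] at h3 h4
      obtain ⟨h5, h6⟩ := Env.hs_inst_snoc_wk hts ht h3 h4
      -- Positions in `Θ` shift by one because of the new last entry, and the instantiation of that
      -- entry is invisible to the earlier ones.
      have := h (i + 1) _ _ (Nat.succ_lt_succ hi) hD₀.there
      rwa [h5, h6] at this
    obtain ⟨a, D', X', ha, hD', hX', hty⟩ := h 0 _ _ (Nat.succ_pos _) .here
    cases ha
    obtain ⟨h5, h6⟩ := Env.hs_inst_snoc_wk hts ht hDs hTs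
    rw [h5] at hD'
    rw [h6] at hX'
    have hT' := hT.inst h𝕋 h1
    have hl := hD'.erase_eq
    rw [Ctx.erase_hs] at hl
    refine .extSpine ?_ h1 ?_
    · have := (h𝕋.derives hΘ).1
      rw [IsCtx.append, Scope.nil_append] at this
      exact this.2
    · rw [Ctx.subst_zero_eq_hs, Ty.subst_eq_hs]
      -- The argument is first moved from `D'` to the instance of `D`, then its type is converted.
      refine .conv ?_ (hD'.derives h𝕋 hT'.ctx hty) hT'
      rwa [Ctx.erase_append, Ctx.erase_hs, ← hl]

namespace Match

variable {𝔖 : Strategy (𝕋.presig nrm) 𝕋.rew}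

/-- Matching a well-typed rigid pattern against a well-typed expression gives well-typed
arguments. -/
theorem typed (h𝕋 : 𝕋.WellScoped nrm) (hsr : 𝕋.SubjectReduction nrm) {Γ Θ : Ctx C} {w : Expr C}
    (hw : IsExpr (𝕋.presig nrm) (Γ.erase nrm) (.sp (Θ.erase nrm)) w)
    {γ γ₀ : Scope S} {K : Kind S} {t u v : Expr C} (h : Match 𝔖 (Γ.erase nrm) γ γ₀ K t u v)
    {Γ₀ Γ₀' : Ctx C} {b : ℕ}
    (hv : SegConv (𝕋.presig nrm) 𝕋.rew (Γ.erase nrm) (Θ.erase nrm) γ b w v)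
    (hγ₀ : Γ₀.erase nrm = γ₀)
    (hΓ₀ : CtxConv nrm (𝕋.presig nrm) 𝕋.rew (Γ.erase nrm)
      (Γ₀.hs (Env.inst (Θ.erase nrm) w)) Γ₀')
    (ht : IsRigid 𝕋 t)
    (hK : MatchTyped nrm 𝕋 Γ Θ Γ₀ Γ₀' (Env.inst (Θ.erase nrm) w) (t.wk b γ₀.length) u K) :
    ArgsTyped nrm 𝕋 Γ Θ (Env.inst (Θ.erase nrm) w) γ.length b v := by
  have hR := h𝕋.rew
  have hwe := wEnv_inst hw
  induction h generalizing Γ₀ Γ₀' b with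
  | @rigid γ γ₀ δ s c ts u us vs hc hu _ ih =>
    obtain ⟨T, U, h1, h2, rfl, hTU⟩ := hK
    have he : (Γ.append Γ₀').erase nrm = (Γ.erase nrm).append γ₀ := by
      rw [Ctx.erase_append, ← hΓ₀.erase_eq, Ctx.erase_hs, hγ₀]
    obtain ⟨Δ, ν, X, ts', hd, hts, hts', -⟩ := h1.inv_const
    -- The strategy exposes the head constant by rewriting, and subject reduction keeps the reduct
    -- typed.
    have h3 := hsr.reds h2 (he ▸ 𝔖.reds hu)
    obtain ⟨Δ', ν', X', us', hd', hus, hus', -⟩ := h3.inv_const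
    -- Both inversions found the same declaration, so the two argument spines are typed by the same
    -- closed context.
    have hdd := h𝕋.unique _ hd' _ hd rfl
    simp only [Decl.mk.injEq, true_and, Option.some.injEq] at hdd
    obtain ⟨rfl, rfl, rfl⟩ := hdd
    obtain ⟨e1, e2⟩ := ht.keep_eq h𝕋 hd hc (h𝕋.derives hts').2.2
    obtain ⟨e3, -⟩ := ht.keep_eq h𝕋 hd hc (h𝕋.derives hus').2.2
    rw [e1] at hts
    rw [e3] at hus
    subst hts hus
    exact ih hv hγ₀ hΓ₀ (fun d hd => ht d (.inr hd)) ⟨_, h𝕋.ctx _ hd, e2, hts', hus'⟩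
  | @ty γ γ₀ δ c ts us vs hc _ ih =>
    obtain ⟨⟨c', T⟩, ⟨c'', U⟩, hT, hU, h1, h2⟩ := hK
    simp only [Expr.wk, Expr.ren, Ty.expr, Expr.const.injEq] at hT hU
    obtain ⟨rfl, rfl⟩ := hT
    obtain ⟨rfl, rfl⟩ := hU
    obtain ⟨Δ, ν, ts', hd, hts, hts'⟩ := h1.inv_ty
    obtain ⟨Δ', ν', us', hd', hus, hus'⟩ := h2.inv_ty
    have hdd := h𝕋.unique _ hd' _ hd rfl
    simp only [Decl.mk.injEq, true_and, and_true] at hdd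
    obtain ⟨rfl, rfl⟩ := hdd
    obtain ⟨e1, e2⟩ := ht.keep_eq h𝕋 hd hc (h𝕋.derives hts').2.2
    obtain ⟨e3, -⟩ := ht.keep_eq h𝕋 hd hc (h𝕋.derives hus').2.2
    rw [e1] at hts
    rw [e3] at hus
    subst hts hus
    exact ih hv hγ₀ hΓ₀ (fun d hd => ht d (.inr hd)) ⟨_, h𝕋.ctx _ hd, e2, hts', hus'⟩
  | @flex γ₀ s u hu =>
    obtain ⟨T, U, h1, h2, rfl, hTU⟩ := hK
    subst hγ₀
    intro i D X hi hD
    obtain rfl : i = 0 := by simpa [Scope.length] using hi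
    have e : (Expr.var (Γ₀.erase nrm).length (idSp (Γ₀.erase nrm)) : Expr C).wk b
        (Γ₀.erase nrm).length = .var (0 + b + Γ₀.length) (idSp (Γ₀.erase nrm)) := by
      rw [Expr.wk, Expr.ren, wkRen_eq, idSp_ren _ fun k hk => liftRen_of_lt _ hk]
      have := liftRen_add (Γ₀.erase nrm).length 0 (· + b)
      rw [Nat.zero_add] at this
      rw [this, Ctx.length_erase]
    rw [e] at h1
    obtain ⟨Δ, Y, hY, hid, hc⟩ := h1.inv_var
    obtain ⟨rfl, rfl⟩ := hY.unique (hD.append_left Γ₀)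
    have hDe : Γ₀.erase nrm = D.erase nrm := by
      obtain ⟨-, h3⟩ := h𝕋.derives hid
      have h4 := hD.get? nrm
      have h5 := (hv 0 _ _ rfl).1
      rw [Ctx.erase_append, Scope.get?_append_of_some _ h5] at h4
      simp only [Option.some.injEq, Prod.mk.injEq] at h4
      exact h4.1
    have hl : Γ₀.length = D.length := by
      rw [← Ctx.length_erase nrm, hDe, Ctx.length_erase]
    have hctx := (h𝕋.derives h1).1
    rw [IsCtx.append] at hctx
    obtain ⟨hDs, hXs⟩ := hD.isCtx hctx.1
    have hctx2 := hctx.2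
    rw [Scope.nil_append] at hDs hXs hctx2
    rw [hDe] at hid
    -- The pattern applies the variable to the identity spine of the local context, which is thus
    -- typed by `D`; so the local context and `D` are convertible.
    have hcc := hid.ctxConv_of_idSp h𝕋 hDs hDe
    have hcX := (Env.comm_idSp (𝕋.presig nrm) ((Γ.append Θ).erase nrm) (D.erase nrm)).ty hXs
    rw [Ty.subst_zero_eq_hs, Ctx.erase_wk, hDe, Ty.wk_eq_hs S, hl] at hc
    simp only [Ctx.length_erase, Ty.hs_id] at hcX
    rw [hcX, Ctx.erase_append] at hc
    rw [Ctx.erase_append] at hcc hctx2 hDs hc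
    have hcc' := hcc.hs hR hctx2 hDs hwe
    have hwe' := hwe.lift (Γ₀.erase nrm)
    have hc' := hc.hs hR hwe'
    have hΓe := hΓ₀.erase_eq
    rw [Ctx.erase_hs] at hΓe
    refine ⟨u, Γ₀', U, rfl, hΓ₀.symm.trans hcc', ?_, h2⟩
    rw [← hΓe, ← hl]
    rw [Ctx.length_erase] at hc'
    exact (hc'.trans hTU).symm
  | nil =>
    intro i D X hi
    cases hi
  | @snoc γ₁ γ₁₂ γ₂ γ₀ δ γx s n ts t us u vs₁ vs₁₂ vs₁₂' vs₁₂'' vs₂ h hn h' hv1 hv12' hv12'' hv2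
      hnf hnf' ih ih' =>
    have hv12 := Reds.isExpr hR (𝔖.reds hnf.1) hv12'
    obtain ⟨Δ, hΔs, hΔe, h1, h2⟩ := hK
    cases Δ with
    | nil => cases hΔe
    | snoc Δ Γx T =>
    simp only [Ctx.erase, Scope.snoc.injEq] at hΔe
    obtain ⟨rfl, rfl, rfl⟩ := hΔe
    subst hγ₀
    have ew : (ts.wk γ₂.length (Γ₀.erase nrm).length).wk b (Γ₀.erase nrm).length =
        ts.wk (γ₂.length + b) (Γ₀.erase nrm).length := Expr.wk_wk_same _ _ _ _
    have et : t.ren (liftRen n (wkRen b (Γ₀.erase nrm).length)) =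
        t.wk b ((Γ₀.erase nrm).append (Γx.erase nrm)).length := by
      rw [wkRen_eq, liftRen_liftRen, ← wkRen_eq, hn, Scope.length_append]
      rfl
    rw [Expr.wk, Expr.ren, et] at h1
    rw [← Expr.wk, ew] at h1
    obtain ⟨hctx, -⟩ := h𝕋.derives h1
    rw [IsCtx.append] at hctx
    have hΓ₀s := hctx.2
    rw [Scope.nil_append, Ctx.erase_append] at hΓ₀s
    obtain ⟨hctx', -⟩ := h𝕋.derives h2
    rw [IsCtx.append] at hctx'
    have hΓ₀s' := hctx'.2
    rw [Scope.nil_append] at hΓ₀s'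
    have hΓe := hΓ₀.erase_eq
    rw [Ctx.erase_hs] at hΓe
    -- In the shared positions `w` agrees up to conversion with the common normal form, hence with
    -- either of the two values found by the subpatterns.
    have hv' : Conv (𝕋.presig nrm) 𝕋.rew (Γ.erase nrm) _ ((vs₁.append vs₁₂').append vs₂)
        ((vs₁.append vs₁₂).append vs₂) :=
      Conv.of_reds (Reds.append_left hv2 (Reds.append_right hv1 (𝔖.reds hnf.1)))
    have hseg : SegConv (𝕋.presig nrm) 𝕋.rew (Γ.erase nrm) (Θ.erase nrm) (γ₁.append γ₁₂)
        (γ₂.length + b) w (vs₁.append vs₁₂') :=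
      (hv.conv_right hR ((hv1.append hv12).append hv2) hv'.symm).left hv2
    have hseg' : SegConv (𝕋.presig nrm) 𝕋.rew (Γ.erase nrm) (Θ.erase nrm) (γ₁₂.append γ₂)
        b w (vs₁₂''.append vs₂) := by
      have h3 := hv
      rw [Scope.append_assoc, Expr.append_assoc] at h3
      exact (h3.right (hv12.append hv2)).conv_right hR (hv12.append hv2)
        (Conv.of_reds (Reds.append_left hv2 (𝔖.reds hnf'.1))).symm
    have htsr : IsRigid 𝕋 ts := fun d hd => ht d (.inl ((Expr.occurs_ren _).2 hd))
    obtain ⟨h1, ht1⟩ := h1.inv_snoc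
    obtain ⟨h2, hu2⟩ := h2.inv_snoc
    have hts' := (h𝕋.derives h1).2.2
    have hus := (h𝕋.derives h2).2.2
    have ih := ih hseg rfl hΓ₀ htsr ⟨Δ, hΔs.1, rfl, h1, h2⟩
    have hcv := h.conv_wk hR hw hseg
    obtain ⟨-, hΓxs, hTs⟩ := hΔs
    rw [Scope.nil_append] at hΓxs hTs
    have hwe' := hwe.lift (Γ₀.erase nrm)
    rw [Ctx.erase_append, Ctx.erase_append] at hts'
    have hcm := Env.comm_inst hts' hwe'
    have hcm' := hcm.lift (Γx.erase nrm)
    have hΓx2 := hΓxs.left_append (((Γ.erase nrm).append (Θ.erase nrm)).append (Γ₀.erase nrm))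
    have hΓx2' := hΓxs.left_append ((Γ.erase nrm).append (Γ₀.erase nrm))
    have hcΓ : (Γx.subst (Δ.erase nrm) (ts.wk (γ₂.length + b) (Γ₀.erase nrm).length) 0).hs
        ((Env.inst (Θ.erase nrm) w).lift (Γ₀.erase nrm).length) = Γx.hs (Env.inst (Δ.erase nrm)
          ((ts.wk (γ₂.length + b) (Γ₀.erase nrm).length).hs
            ((Env.inst (Θ.erase nrm) w).lift (Γ₀.erase nrm).length))) := by
      rw [Ctx.subst_zero_eq_hs, hcm.ctx hΓx2, (Env.same_lift_id _ _ _).ctx hΓxs, Ctx.hs_id]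
    have hcv2 : Env.ConvOn (𝕋.presig nrm) 𝕋.rew _ _ _ _ :=
      Env.convOn_inst hR hcv (hts'.hs hwe')
    rw [Ctx.erase_append, ← hΓe] at hus
    have hCΓ := CtxConv.of_convOn (nrm := nrm) hR hΓx2' (wEnv_inst (hts'.hs hwe')) (wEnv_inst hus)
      hcv2
    rw [← hcΓ, ← Ctx.subst_zero_eq_hs] at hCΓ
    -- The pattern continues under the binders instantiated by its own arguments and the expression
    -- under those instantiated by `us`. The two local contexts become convertible under `w`,
    -- because the arguments do.
    have hnew : CtxConv nrm (𝕋.presig nrm) 𝕋.rew (Γ.erase nrm)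
        ((Γ₀.append (Γx.subst (Δ.erase nrm) (ts.wk (γ₂.length + b) (Γ₀.erase nrm).length) 0)).hs
          (Env.inst (Θ.erase nrm) w)) (Γ₀'.append (Γx.subst (Δ.erase nrm) us 0)) := by
      rw [Ctx.hs_append, ← Ctx.length_erase nrm Γ₀]
      refine CtxConv.append hR hΓ₀ (hΓ₀s.hs hwe) hΓ₀s' ?_
      rwa [Ctx.erase_hs]
    rw [Ctx.append_assoc] at ht1 hu2
    have hγ' : (Γ₀.append (Γx.subst (Δ.erase nrm) (ts.wk (γ₂.length + b) (Γ₀.erase nrm).length)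
        0)).erase nrm = (Γ₀.erase nrm).append (Γx.erase nrm) := by
      rw [Ctx.erase_append, Ctx.subst_zero_eq_hs, Ctx.erase_hs]
    have hT2 := hTs.left_append (((Γ.erase nrm).append (Θ.erase nrm)).append (Γ₀.erase nrm))
    have hT2' := hTs.left_append ((Γ.erase nrm).append (Γ₀.erase nrm))
    rw [← Scope.append_assoc _ (Δ.erase nrm)] at hT2 hT2'
    have hTl := ((Env.same_lift_id (𝕋.presig nrm) (Δ.erase nrm)
      ((Env.inst (Θ.erase nrm) w).lift (Γ₀.erase nrm).length)).lift (Γx.erase nrm)).ty hTs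
    rw [Env.lift_id, Ty.hs_id] at hTl
    -- The expected types are the instances of the same `T` by the two spines, so they are
    -- convertible under `w` by `hcv2`.
    have ih' := ih' hseg' hγ' hnew (fun d hd => ht d (.inr hd)) ⟨_, _, ht1, hu2, by
        rw [Ty.subst_eq_hs, Ty.erase_hs], by
        rw [Ctx.erase_append, ← Scope.append_assoc, Ctx.length_append, ← Env.lift_lift,
          Ctx.subst_zero_eq_hs, Ctx.erase_hs, Ctx.length_hs, Ty.subst_eq_hs, Ty.subst_eq_hs,
          ← Ctx.length_erase nrm Γ₀, ← Ctx.length_erase nrm Γx, hcm'.ty hT2,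
          hTl]
        exact IsExpr.hs_conv hR hT2' ((wEnv_inst (hts'.hs hwe')).lift _) ((wEnv_inst hus).lift _)
          (hcv2.lift hR _)⟩
    intro i D X hi hD
    -- Variables of `γ₂` are typed by the right subpattern, all others, shared ones included, by the
    -- left one.
    by_cases hk : i < γ₂.length
    · obtain ⟨a, D', X', ha, h3⟩ := ih' i D X
        (by rw [Scope.length_append]; omega) hD
      refine ⟨a, D', X', ?_, h3⟩
      rwa [Expr.arg?_append_of_lt hv2 hk] at ha ⊢
    · obtain ⟨j, rfl⟩ := Nat.exists_eq_add_of_le' (not_lt.1 hk)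
      rw [Scope.length_append] at hi
      have hj : j < (γ₁.append γ₁₂).length := by omega
      obtain ⟨a, D', X', ha, hD', hX', hty⟩ := ih j D X hj (by rwa [← Nat.add_assoc])
      obtain ⟨ξ, s, hξ⟩ := Scope.exists_get? hj
      obtain ⟨a₁, a₂, ha₁, ha₂, haa⟩ := Reds.exists_arg (Reds.append_right hv1 (𝔖.reds hnf.1))
        (hv1.append hv12') hξ
      rw [ha] at ha₁
      cases ha₁
      refine ⟨a₂, D', X', by rwa [Expr.arg?_append_add hv2], hD', hX', ?_⟩
      -- The left subpattern typed the value in `vs₁.append vs₁₂'`; normalizing the shared part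
      -- keeps it typed by subject reduction.
      refine hsr.reds hty ?_
      have h4 := hD.get? nrm
      have h5 := (hseg j _ _ hξ).1
      rw [Ctx.erase_append, Nat.add_assoc, Scope.get?_append_of_some _ h5] at h4
      simp only [Option.some.injEq, Prod.mk.injEq] at h4
      obtain ⟨rfl, rfl⟩ := h4
      have h6 := hD'.erase_eq
      rw [Ctx.erase_hs] at h6
      rw [Ctx.erase_append, h6, hX'.erase_eq nrm, Ty.erase_hs]
      exact haa

/-- The result of matching a well-typed rigid pattern against a well-typed type. -/
theorem derives (h𝕋 : 𝕋.WellScoped nrm) (hsr : 𝕋.SubjectReduction nrm) {Γ Θ Γ₀ Γ₀' : Ctx C}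
    {T V : Ty C} {v : Expr C}
    (h : Match 𝔖 (Γ.erase nrm) (Θ.erase nrm) (Γ₀.erase nrm) .ty T.expr V.expr v)
    (hT : IsRigid 𝕋 T.expr) (hΘ : Derives nrm 𝕋 (Γ.append Θ) .ctx)
    (hΓ₀ : Γ₀.hs (Env.inst (Θ.erase nrm) v) = Γ₀')
    (hT' : Derives nrm 𝕋 ((Γ.append Θ).append Γ₀) (.ty T))
    (hV : Derives nrm 𝕋 (Γ.append Γ₀') (.ty V)) : Derives nrm 𝕋 Γ (.sp v Θ) := by
  have hv := h.isExpr h𝕋.rew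
  refine ArgsTyped.derives h𝕋 hv ?_ hΘ
  rw [← Ctx.length_erase nrm Θ]
  -- The general statement is used with `w = v` and `b = 0`: the flexible variables are all of `Θ`.
  refine h.typed h𝕋 hsr hv ?_ rfl (hΓ₀ ▸ CtxConv.refl _ _) hT ⟨T, V, ?_, rfl, hT', hV⟩
  · intro i δ s hi
    obtain ⟨a, ha, -⟩ := hv.exists_arg hi
    exact ⟨hi, a, a, ha, ha, Conv.refl _⟩
  · have e : wkRen 0 (Γ₀.erase nrm).length = id := by
      funext i
      simp [wkRen]
    rw [Expr.wk, e, Expr.ren_id]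

end Match

end

/-! ### From moded theories to well-formed theories -/

section

variable {C : Type u} {S : Type v} {ς : PreSig C S} {nrm : C ↪ S} {𝕋 : Theory C S}

/-! ### Concatenation of spines -/

/-- Scoping matters: `append` discards a second argument that is not a spine. -/
theorem Expr.nil_append {γ δ : Scope S} {ts : Expr C} (h : IsExpr ς γ (.sp δ) ts) :
    Expr.nil.append ts = ts := by
  induction δ generalizing ts with
  | nil => cases h; rfl
  | snoc δ _ _ ih _ =>
    cases h with
    | snoc hts _ _ => simp only [append, ih hts]

/-- Erasure assignments list the rightmost entry first, so the block for the last segment of the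
spine comes first in the list. -/
theorem keep_replicate_false_append {γ : Scope S} {Δ : Ctx C} {ts us : Expr C}
    (h : IsExpr ς γ (.sp (Δ.erase nrm)) ts) (ν : List Bool) :
    keep (List.replicate Δ.length false ++ ν) (us.append ts) = (keep ν us).append ts := by
  induction Δ generalizing ts with
  | nil => cases h; simp [Ctx.length]
  | snoc Δ Γ T ih _ =>
    cases h with
    | snoc hts _ _ =>
      simp only [Ctx.length, List.replicate_succ, List.cons_append, Expr.append, keep, ih hts,
        Bool.false_eq_true, if_false]

theorem keep_replicate_true_append {γ : Scope S} {Δ : Ctx C} {ts us : Expr C}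
    (h : IsExpr ς γ (.sp (Δ.erase nrm)) ts) (ν : List Bool) :
    keep (List.replicate Δ.length true ++ ν) (us.append ts) = keep ν us := by
  induction Δ generalizing ts with
  | nil => cases h; simp [Ctx.length]
  | snoc Δ Γ T ih _ =>
    cases h with
    | snoc hts _ _ =>
      simp only [Ctx.length, List.replicate_succ, List.cons_append, Expr.append, keep, ih hts,
        if_true]

theorem keep_replicate_false {γ : Scope S} {Δ : Ctx C} {ts : Expr C}
    (h : IsExpr ς γ (.sp (Δ.erase nrm)) ts) : keep (List.replicate Δ.length false) ts = ts :=
  keep_of_forall h (List.length_replicate ..) fun _ hb => List.eq_of_mem_replicate hb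

/-- Instantiating a weakened context. -/
theorem Ctx.hs_wk_append {γ δ : Scope S} {Ξ Δ : Ctx C} {us vs : Expr C}
    (hus : IsExpr ς γ (.sp δ) us) (hvs : IsExpr ς γ (.sp (Ξ.erase nrm)) vs)
    (hΔ : IsCtx nrm ς (γ.append δ) Δ) :
    (Δ.wk Ξ.length 0).hs (Env.inst (δ.append (Ξ.erase nrm)) (us.append vs)) =
      Δ.hs (Env.inst δ us) := by
  have := (Env.comm_shift_inst_append hus hvs).ctx hΔ
  rwa [Ctx.hs_id, Ctx.length_erase, ← Ctx.wk_zero_eq_hs] at this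

/-- Instantiating by `us` and then by `vs` is instantiating by the concatenation, so the premises
for `vs` turn into those for the longer spine. -/
theorem Derives.append_sp (h𝕋 : 𝕋.WellScoped nrm) {Γ Δ Ξ : Ctx C} {us vs : Expr C}
    (hus : Derives nrm 𝕋 Γ (.sp us Δ))
    (hΞ : IsCtx nrm (𝕋.presig nrm) ((Γ.erase nrm).append (Δ.erase nrm)) Ξ)
    (hvs : Derives nrm 𝕋 Γ (.sp vs (Ξ.hs (Env.inst (Δ.erase nrm) us)))) :
    Derives nrm 𝕋 Γ (.sp (us.append vs) (Δ.append Ξ)) := by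
  induction Ξ generalizing vs with
  | nil =>
    have := (h𝕋.derives hvs).2.2
    cases this
    exact hus
  | snoc Ξ D T ih _ =>
    obtain ⟨-, hΔs, hus'⟩ := h𝕋.derives hus
    have hvs' := (h𝕋.derives hvs).2.2
    cases hvs' with
    | @snoc _ _ _ _ vs v n hvs' hn hv' =>
    rw [Ctx.length_erase, Ctx.length_hs] at hn
    subst hn
    obtain ⟨h1, h2⟩ := hvs.inv_snoc
    have ih := ih hΞ.1 h1
    rw [Ctx.erase_hs] at hvs'
    have hc := Env.comm_inst_append hus' hvs'
    have hc' := hc.lift (D.erase nrm)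
    refine .extSpine (IsCtx.append.2 ⟨hΔs, hΞ⟩) ih ?_
    rw [Ctx.subst_zero_eq_hs, Ty.subst_eq_hs, Ctx.length_hs, Ctx.erase_hs] at h2
    simp only [Ctx.length_erase] at hc hc'
    rw [hc.ctx hΞ.2.1, hc'.ty hΞ.2.2, Ctx.hs_id, Env.lift_id, Ty.hs_id] at h2
    rw [Ctx.subst_zero_eq_hs, Ty.subst_eq_hs, Ctx.erase_append]
    exact h2

/-! ### Moded theories -/

theorem IsPatt.isExpr {γ γ₀ : Scope S} {K : Kind S} {t : Expr C} (h : IsPatt ς γ γ₀ K t) :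
    IsExpr ς (γ.append γ₀) K t := by
  induction h with
  | rigid hc _ ih => exact .const hc ih
  | @flex γ₀ s =>
    refine .var (δ := γ₀) ?_ ((isExpr_idSp ς γ₀).left_append _)
    exact (congrArg _ (Nat.zero_add _).symm).trans (Scope.get?_append_add _ γ₀ 0)
  | nil => exact IsExpr.nil
  | @snoc γ₁ γ₁₂ γ₂ γ₀ δ γx s ts t n _ hn _ ih ih' =>
    refine .snoc ih.wk hn ?_
    have := ih'.left_append γ₁
    rwa [← Scope.append_assoc, ← Scope.append_assoc, ← Scope.append_assoc] at this
  | ty hc _ ih => exact .ty hc ih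

theorem IsPatt.mono {ς' : PreSig C S} (hς : ς ⊆ ς') {γ γ₀ : Scope S} {K : Kind S} {t : Expr C}
    (h : IsPatt ς γ γ₀ K t) : IsPatt ς' γ γ₀ K t := by
  induction h with
  | rigid hc _ ih => exact .rigid (hς hc) ih
  | flex => exact .flex
  | nil => exact .nil
  | snoc _ hn _ ih ih' => exact .snoc ih hn ih'
  | ty hc _ ih => exact .ty (hς hc) ih

theorem IsModedDecl.mono {ς' : PreSig C S} (hς : ς ⊆ ς') {d : ModedDecl C}
    (h : IsModedDecl nrm ς d) : IsModedDecl nrm ς' d := by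
  cases d with
  | type c Δ => exact IsCtx.mono hς h
  | infer c Δ T => exact ⟨h.1.mono hς, IsExpr.mono hς h.2⟩
  | check c Δ' Δ T => exact ⟨h.1.mono hς, h.2.1.mono hς, h.2.2.mono hς⟩
  | synth c Δ₁ Δ' Γx T Δ₂ U =>
    obtain ⟨h1, h2, h3, h4, h5, h6⟩ := h
    exact ⟨h1.mono hς, h2.mono hς, h3.mono hς, h4.mono hς, h5.mono hς, IsExpr.mono hς h6⟩

theorem IsModedSig.isModedDecl {msig : ModedSig C} (h : IsModedSig nrm msig) {d : ModedDecl C}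
    (hd : d ∈ msig) : IsModedDecl nrm (Sig.erase nrm (ModedSig.sig msig)) d := by
  induction msig with
  | nil => cases hd
  | cons d' msig ih =>
    have hς : Sig.erase nrm (ModedSig.sig msig) ⊆ Sig.erase nrm (ModedSig.sig (d' :: msig)) :=
      fun _ hx => List.mem_cons_of_mem _ hx
    rcases List.mem_cons.1 hd with rfl | hd
    · exact h.2.2.mono hς
    · exact (ih h.1 hd).mono hς

theorem IsModedSig.unique {msig : ModedSig C} (h : IsModedSig nrm msig) {d d' : Decl C}
    (hd : d ∈ ModedSig.sig msig) (hd' : d' ∈ ModedSig.sig msig) (he : d.name = d'.name) :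
    d = d' := by
  induction msig with
  | nil => cases hd
  | cons d₀ msig ih =>
    have key : ∀ {e : Decl C}, e ∈ ModedSig.sig msig → e.name ≠ d₀.decl.name := by
      intro e hee
      obtain ⟨e', he', rfl⟩ := List.mem_map.1 hee
      exact h.2.1 e' he'
    rcases List.mem_cons.1 hd with rfl | hd <;> rcases List.mem_cons.1 hd' with rfl | hd'
    · rfl
    · exact (key hd' he.symm).elim
    · exact (key hd he).elim
    · exact ih h.1 hd hd'

namespace IsModedDecl

theorem isCtx {d : ModedDecl C} (h : IsModedDecl nrm ς d) : IsCtx nrm ς .nil d.decl.ctx := by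
  cases d with
  | type c Δ => exact h
  | infer c Δ T => exact h.1
  | check c Δ' Δ T =>
    refine IsCtx.append.2 ⟨h.1, ?_⟩
    rw [Scope.nil_append]
    exact h.2.1
  | synth c Δ₁ Δ' Γx T Δ₂ U =>
    obtain ⟨h1, h2, h3, h4, h5, -⟩ := h
    refine IsCtx.append.2 ⟨⟨IsCtx.append.2 ⟨h1, by rwa [Scope.nil_append]⟩, ?_, ?_⟩, ?_⟩
    · rw [Scope.nil_append, Ctx.erase_append, Ctx.wk_zero_eq_hs S, ← Ctx.length_erase nrm Δ']
      exact h3.hs (Env.wEnv_shift _ _ _)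
    · rw [Scope.nil_append, Ctx.erase_append, Ctx.erase_wk, Scope.append_assoc]
      exact IsExpr.left_append h4.isExpr _
    · rwa [Scope.nil_append]

theorem length_erased (d : ModedDecl C) : d.decl.erased.length = d.decl.ctx.length := by
  cases d with
  | type c Δ => simp [ModedDecl.decl]
  | infer c Δ T => simp [ModedDecl.decl]
  | check c Δ' Δ T => simp [ModedDecl.decl, Nat.add_comm]
  | synth c Δ₁ Δ' Γx T Δ₂ U =>
    simp only [ModedDecl.decl, List.length_append, List.length_replicate, List.length_cons,
      Ctx.length_append, synthCtx, Ctx.length]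
    omega

theorem isTy_result {d : ModedDecl C} (h : IsModedDecl nrm ς d) {T : Ty C}
    (hT : T ∈ d.decl.result) : IsTy ς (d.decl.ctx.erase nrm) T := by
  cases d with
  | type c Δ => cases hT
  | infer c Δ T => cases hT; exact h.2
  | check c Δ' Δ T =>
    cases hT
    have h1 : IsTy ς (Δ'.erase nrm) T := h.2.2.isExpr
    have := h1.hs (Env.wEnv_shift ς _ (Δ.erase nrm))
    rwa [Ctx.length_erase, ← Ty.wk_zero_eq_hs, ← Ctx.erase_append] at this
  | synth c Δ₁ Δ' Γx T Δ₂ U =>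
    cases hT
    exact h.2.2.2.2.2

end IsModedDecl

namespace ModedTheory

variable {M : ModedTheory C S}

theorem IsModedTheory.wellScoped (hM : M.IsModedTheory nrm) : M.theory.WellScoped nrm where
  rew := hM.rew
  ctx d hd := by
    obtain ⟨d', hd', rfl⟩ := List.mem_map.1 hd
    exact (hM.msig.isModedDecl hd').isCtx
  erased d hd := by
    obtain ⟨d', -, rfl⟩ := List.mem_map.1 hd
    exact IsModedDecl.length_erased d'
  result d hd T hT := by
    obtain ⟨d', hd', rfl⟩ := List.mem_map.1 hd
    exact (hM.msig.isModedDecl hd').isTy_result hT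
  unique d hd d' hd' he := hM.msig.unique hd hd' he

theorem DeclWellTyped.mono {𝕋' : Theory C S} (hsig : 𝕋.sig ⊆ 𝕋'.sig) (hrew : 𝕋.rew ⊆ 𝕋'.rew)
    {d : ModedDecl C} (h : M.DeclWellTyped nrm 𝕋 d) : M.DeclWellTyped nrm 𝕋' d := by
  cases d with
  | type c Δ => exact Derives.mono hsig hrew h
  | infer c Δ T => exact Derives.mono hsig hrew h
  | check c Δ' Δ T => exact ⟨h.1.mono hsig hrew, h.2.1.mono hsig hrew, h.2.2⟩
  | synth c Δ₁ Δ' Γx T Δ₂ U => exact ⟨h.1.mono hsig hrew, h.2.1.mono hsig hrew, h.2.2⟩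

/-- Derivability is monotone in the theory, so conditions checked over the earlier declarations hold
in the whole theory. -/
theorem WellTyped.declWellTyped (h : M.WellTyped nrm) {d : ModedDecl C} (hd : d ∈ M.msig) :
    M.DeclWellTyped nrm M.theory d := by
  obtain ⟨s, t, ht⟩ := List.append_of_mem hd
  have hrew : (M.theory.restrict nrm (ModedSig.sig t)).rew ⊆ M.theory.rew := fun _ hr => hr.1
  refine (h d t ⟨s, ht.symm⟩).mono (List.map_subset _ fun x hx => ?_) hrew
  rw [ht]
  exact List.mem_append_right _ (List.mem_cons_of_mem _ hx)

theorem WellTyped.wellFormed (h : M.WellTyped nrm) (hM : M.IsModedTheory nrm) :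
    M.theory.WellFormed nrm where
  toWellScoped := hM.wellScoped
  ctx_derives d hd := by
    obtain ⟨d', hd', rfl⟩ := List.mem_map.1 hd
    have hw := h.declWellTyped hd'
    cases d' with
    | type c Δ => exact hw
    | infer c Δ T => exact Derives.ctx hw
    | check c Δ' Δ T => exact hw.1
    | synth c Δ₁ Δ' Γx T Δ₂ U => exact hw.1.ctx
  result_derives d hd T hT := by
    obtain ⟨d', hd', rfl⟩ := List.mem_map.1 hd
    have hw := h.declWellTyped hd'
    cases d' with
    | type c Δ => cases hT
    | infer c Δ T => cases hT; exact hw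
    | check c Δ' Δ T =>
      cases hT
      have := hw.2.1.wk_nil hM.wellScoped hw.1
      rwa [Judgment.hs, ← Ty.wk_zero_eq_hs] at this
    | synth c Δ₁ Δ' Γx T Δ₂ U => cases hT; exact hw.1

end ModedTheory

end

/-! ### Soundness of the algorithm -/

section

variable {C : Type u} {S : Type v} {ς : PreSig C S} {nrm : C ↪ S} {𝕋 : Theory C S}

/-! ### Soundness -/

/-- Typing of the principal argument of a synthesizing constant, together with the arguments
recovered from its type. -/
theorem Derives.synth_sp (h𝕋 : 𝕋.WellFormed nrm) (hsr : 𝕋.SubjectReduction nrm)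
    {𝔖 : Strategy (𝕋.presig nrm) 𝕋.rew} {Γ Δ₁ Δ' Γx : Ctx C} {T V : Ty C} {ts t vs : Expr C}
    (hTs : IsTy (𝕋.presig nrm) ((Δ'.erase nrm).append (Γx.erase nrm)) T)
    (hΔ's : IsCtx nrm (𝕋.presig nrm) (Δ₁.erase nrm) Δ')
    (hΓxs : IsCtx nrm (𝕋.presig nrm) (Δ₁.erase nrm) Γx)
    (hctx : Derives nrm 𝕋 (Γ.append (synthCtx Δ₁ Δ' Γx T)) .ctx) (hrigid : IsRigid 𝕋 T.expr)
    (hts : Derives nrm 𝕋 Γ (.sp ts Δ₁))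
    (ht : Derives nrm 𝕋 (Γ.append (Γx.subst (Δ₁.erase nrm) ts 0)) (.tm t V))
    (hm : Match 𝔖 (Γ.erase nrm) (Δ'.erase nrm) (Γx.erase nrm) .ty T.expr V.expr vs) :
    Derives nrm 𝕋 Γ (.sp ((ts.append vs).snoc Γx.length t) (synthCtx Δ₁ Δ' Γx T)) := by
  have hs := h𝕋.toWellScoped
  have hvs := hm.isExpr hs.rew
  have htse := (hs.derives hts).2.2
  have hctxs := (hs.derives hctx).1
  rw [IsCtx.append, Scope.nil_append] at hctxs
  have hT : Derives nrm 𝕋 ((Γ.append (Δ₁.append Δ')).append (Γx.wk Δ'.length 0)) (.ty T) :=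
    Derives.of_snoc hctx
  -- `T` lives in `Δ'` and `Γx` only, so it is fixed by environments lifted past both.
  have hTl := fun σ : Env C S => hTs.hs_lift σ
  simp only [Scope.length_append, Ctx.length_erase] at hTl
  have hΓx' := hΓxs.left_append (Γ.erase nrm)
  have hwk := IsCtx.hs hΓx' (Env.wEnv_shift _ _ (Δ'.erase nrm))
  rw [Ctx.length_erase, ← Ctx.wk_zero_eq_hs] at hwk
  have hc := Env.comm_inst_append htse hvs
  have hc' := hc.lift (Γx.erase nrm)
  simp only [Ctx.length_erase] at hc hc'
  have hTT := hTs.left_append ((Γ.erase nrm).append (Δ₁.erase nrm))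
  rw [← Scope.append_assoc] at hTT
  have hTvs : T.hs ((Env.inst ((Δ₁.erase nrm).append (Δ'.erase nrm)) (ts.append vs)).lift
      Γx.length) = T.hs ((Env.inst (Δ'.erase nrm) vs).lift Γx.length) := by
    have := hc'.ty hTT
    rw [Env.lift_id, Ty.hs_id, Env.lift_lift, hTl] at this
    exact this.symm
  -- `Γx` does not depend on `Δ'`, so instantiating `Δ'` by `vs` merely removes its weakening. This
  -- is the context in which the type of `t` was inferred.
  have hΓ₀ : ((Γx.wk Δ'.length 0).hs ((Env.inst (Δ₁.erase nrm) ts).lift Δ'.length)).hs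
      (Env.inst (Δ'.erase nrm) vs) = Γx.subst (Δ₁.erase nrm) ts 0 := by
    rw [hc.ctx hwk, Ctx.hs_id, Ctx.hs_wk_append htse hvs hΓx', Ctx.subst_zero_eq_hs]
  have hT' := hT
  rw [← Ctx.append_assoc Γ, Ctx.append_assoc (Γ.append Δ₁)] at hT'
  have hT1 := hT'.inst hs hts
  rw [Judgment.hs, Ctx.length_append, Ctx.length_wk, hTl, Ctx.hs_append, ← Ctx.append_assoc] at hT1
  -- Matching takes place after `Δ₁` has been instantiated by `ts`: the flexible context is the
  -- instance of `Δ'`.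
  have hsp : Derives nrm 𝕋 Γ (.sp vs (Δ'.hs (Env.inst (Δ₁.erase nrm) ts))) := by
    refine Match.derives hs hsr (T := T) (V := V) (𝔖 := 𝔖) ?_ hrigid hT1.ctx.of_append ?_ hT1
      (ht.ty_of_tm h𝕋)
    · rwa [Ctx.erase_hs, Ctx.erase_hs, Ctx.erase_wk]
    · rwa [Ctx.erase_hs]
  have hsp' := hts.append_sp hs (hΔ's.left_append _) hsp
  have hT2 := hT.inst hs hsp'
  rw [Ctx.erase_append, Ctx.hs_wk_append htse hvs hΓx', Judgment.hs, Ctx.length_wk, hTvs,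
    ← Ctx.subst_zero_eq_hs] at hT2
  rw [synthCtx] at hctxs ⊢
  rw [← Ctx.length_wk Δ'.length 0 Γx]
  refine .extSpine hctxs.2 hsp' ?_
  rw [Ctx.erase_append, Ctx.subst_zero_eq_hs, Ty.subst_eq_hs, Ctx.hs_wk_append htse hvs hΓx',
    Ctx.length_wk, hTvs, ← Ctx.subst_zero_eq_hs]
  -- The inferred type `V` is convertible to the instance of the pattern `T` by the result of
  -- matching.
  refine .conv ?_ ht hT2
  have := (hm.conv hs.rew).symm
  rw [Expr.subst_eq_hs, Ctx.length_erase] at this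
  rwa [Ctx.erase_append, Ctx.subst_zero_eq_hs, Ctx.erase_hs]

/-- The declarative judgment guaranteed by an algorithmic one. -/
def AlgJudgment.Sound (nrm : C ↪ S) (𝕋 : Theory C S) (Γ : Ctx C) : AlgJudgment C → Prop
  | infer t T => Derives nrm 𝕋 Γ (.tm t T)
  | check t T => Derives nrm 𝕋 Γ (.ty T) → Derives nrm 𝕋 Γ (.tm t T)
  | ty T => Derives nrm 𝕋 Γ (.ty T)
  | sp ts Δ => Derives nrm 𝕋 (Γ.append Δ) .ctx → Derives nrm 𝕋 Γ (.sp ts Δ)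

/-- The invariant is that expected types and contexts are valid before they are used. Declarations
are valid in every valid `Γ`, and each prefix of a spine, once typed, may be substituted to validate
what is expected of the rest. -/
theorem Alg.sound {M : ModedTheory C S} (hM : M.IsModedTheory nrm) (hwt : M.WellTyped nrm)
    (hsr : M.theory.SubjectReduction nrm) {𝔖 : Strategy (M.theory.presig nrm) M.theory.rew}
    {Γ : Ctx C} {J : AlgJudgment C} (h : Alg nrm M 𝔖 Γ J) (hΓ : Derives nrm M.theory Γ .ctx) :
    J.Sound nrm M.theory Γ := by
  have hf := hwt.wellFormed hM
  have hs := hf.toWellScoped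
  have hmem : ∀ {d : ModedDecl C}, d ∈ M.msig → d.decl ∈ M.theory.sig := List.mem_map_of_mem
  have hleft : ∀ {d : ModedDecl C}, d ∈ M.msig → ∀ {Γ : Ctx C}, Derives nrm M.theory Γ .ctx →
      Derives nrm M.theory (Γ.append d.decl.ctx) .ctx :=
    fun hd _ hΓ => (hf.ctx_derives _ (hmem hd)).left_append hs hΓ
  have hmd : ∀ {d : ModedDecl C}, d ∈ M.msig → IsModedDecl nrm (M.theory.presig nrm) d :=
    hM.msig.isModedDecl
  induction h with
  | var hi _ ih => exact .var hi (ih hΓ (hi.derives hs hΓ).ctx)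
  | const hc _ ih =>
    have h1 := ih hΓ (hleft hc hΓ)
    have := Derives.const (hmem hc) h1
    rwa [keep_replicate_false (hs.derives h1).2.2] at this
  | @constPlus Γ Δ₁ Δ' Γx Δ₂ c T U V ts t vs us hc _ _ hm _ ih1 ih2 ih3 =>
    obtain ⟨-, hΔ', hΓx, hT, hΔ₂, -⟩ := hmd hc
    obtain ⟨-, hwΓx, hrigid⟩ := hwt.declWellTyped hc
    have hctx := hleft hc hΓ
    simp only [ModedDecl.decl] at hctx
    rw [← Ctx.append_assoc] at hctx
    have hctx' := hctx.of_append
    have hΔ₁ : Derives nrm M.theory (Γ.append Δ₁) .ctx := by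
      have := hctx'.of_snoc.ctx.of_append
      rw [← Ctx.append_assoc] at this
      exact this.of_append
    have h1 := ih1 hΓ hΔ₁
    have hwΓx' := hwΓx.left_append hs hΓ
    rw [← Ctx.append_assoc] at hwΓx'
    -- The context of the principal argument must be valid before its type is inferred, hence before
    -- `Δ'` is known; validity of `Δ₁.append Γx` provides this.
    have hwΓx' := hwΓx'.inst hs h1
    rw [← Ctx.subst_zero_eq_hs] at hwΓx'
    have h2 := ih2 hwΓx'
    have h3 := Derives.synth_sp hf hsr hT.isExpr hΔ' hΓx hctx' hrigid h1 h2 hm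
    have hctx2 := hctx.inst hs h3
    rw [← Ctx.subst_zero_eq_hs] at hctx2
    have h4 := ih3 hΓ hctx2
    have h4' := (hs.derives h4).2.2
    rw [Ctx.subst_zero_eq_hs] at h4
    have h5 := Derives.const (hmem hc) (h3.append_sp hs (hΔ₂.left_append _) h4)
    rw [Ctx.subst_zero_eq_hs, Ctx.erase_hs] at h4'
    -- Dropping the recovered arguments `vs` gives back the spine written in the term.
    have hk : keep (List.replicate Δ'.length true ++ List.replicate Δ₁.length false)
        (ts.append vs) = ts := by
      rw [keep_replicate_true_append (hm.isExpr hs.rew), keep_replicate_false (hs.derives h1).2.2]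
    rw [keep_replicate_false_append h4', keep, hk] at h5
    exact h5
  | @switch Γ t W T U _ _ _ hW hW' ih =>
    intro hT
    -- Both types reduce to `W`.
    exact .conv ((Conv.of_reds (𝔖.reds hW'.1)).trans (Conv.of_reds (𝔖.reds hW.1)).symm) (ih hΓ) hT
  | @constMinus Γ Δ' Δ c T V ts vs _ hc hm _ ih =>
    intro hV
    obtain ⟨-, hΔ, hT⟩ := hmd hc
    obtain ⟨-, hwT, hrigid⟩ := hwt.declWellTyped hc
    have hctx := hleft hc hΓ
    simp only [ModedDecl.decl] at hctx
    rw [← Ctx.append_assoc] at hctx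
    -- There are no rigid variables here. The recovered spine gets its typing from the presupposed
    -- validity of `V`.
    have h1 : Derives nrm M.theory Γ (.sp vs Δ') :=
      Match.derives hs hsr (Γ₀ := .nil) (Γ₀' := .nil) hm hrigid hctx.of_append rfl
        (hwT.left_append hs hΓ) hV
    have hctx2 := hctx.inst hs h1
    rw [← Ctx.subst_zero_eq_hs] at hctx2
    have h2 := ih hΓ hctx2
    have h2' := (hs.derives h2).2.2
    rw [Ctx.subst_zero_eq_hs] at h2
    rw [Ctx.subst_zero_eq_hs, Ctx.erase_hs] at h2'
    have h3 := Derives.const (hmem hc) (h1.append_sp hs (hΔ.left_append _) h2)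
    have hk : keep (List.replicate Δ'.length true) vs = .nil := by
      have := keep_replicate_true_append (us := .nil) (hm.isExpr hs.rew) []
      rwa [List.append_nil, Expr.nil_append (hm.isExpr hs.rew)] at this
    have hTT : IsTy (M.theory.presig nrm) (Δ'.erase nrm) T := hT.isExpr
    have hsub := (Env.comm_shift_inst_append (hs.derives h1).2.2 h2').ty (hTT.left_append _)
    rw [Ctx.length_erase, Ty.hs_id, ← Ty.wk_zero_eq_hs] at hsub
    rw [keep_replicate_false_append h2', hk, Expr.nil_append h2', Ctx.erase_append,
      Ty.subst_zero_eq_hs, hsub] at h3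
    refine .conv ?_ h3 hV
    have := hm.conv hs.rew
    rwa [Expr.subst_eq_hs, Scope.length, Env.lift_zero] at this
  | type hc _ ih =>
    have h1 := ih hΓ (hleft hc hΓ)
    have := Derives.type (hmem hc) h1
    rwa [keep_replicate_false (hs.derives h1).2.2] at this
  | emptySp => exact fun _ => .emptySpine hΓ
  | @extSp Γ Δ Γx T ts t hΔ _ _ ih ih' =>
    intro h
    have hT : Derives nrm M.theory ((Γ.append Δ).append Γx) (.ty T) := Derives.of_snoc h
    have h1 := ih hΓ hT.ctx.of_append
    have hT' := hT.inst hs h1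
    -- Substituting the prefix already typed makes the local context and the expected type of the
    -- last argument valid.
    rw [Judgment.hs, ← Ctx.subst_zero_eq_hs, ← Ty.subst_eq_hs] at hT'
    exact .extSpine hΔ h1 (ih' hT'.ctx hT')

end

end CompLF

theorem theorem3p5 {C : Type*} {S : Type*} (nrm : C ↪ S) (M : CompLF.ModedTheory C S)
    (hM : M.IsModedTheory nrm) (hwt : M.WellTyped nrm)
    (hsr : M.theory.SubjectReduction nrm)
    (𝔖 : CompLF.Strategy (M.theory.presig nrm) M.theory.rew)
    (Γ : CompLF.Ctx C) (hΓ : CompLF.Derives nrm M.theory Γ .ctx) :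
    (∀ (t : CompLF.Expr C) (A : CompLF.Ty C),
      CompLF.Alg nrm M 𝔖 Γ (.infer t A) → CompLF.Derives nrm M.theory Γ (.tm t A)) ∧
    (∀ (t : CompLF.Expr C) (A : CompLF.Ty C),
      CompLF.Alg nrm M 𝔖 Γ (.check t A) → CompLF.Derives nrm M.theory Γ (.ty A) →
        CompLF.Derives nrm M.theory Γ (.tm t A)) ∧
    (∀ A : CompLF.Ty C,
      CompLF.Alg nrm M 𝔖 Γ (.ty A) → CompLF.Derives nrm M.theory Γ (.ty A)) ∧
    (∀ (ts : CompLF.Expr C) (Δ : CompLF.Ctx C),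
      CompLF.Alg nrm M 𝔖 Γ (.sp ts Δ) → CompLF.Derives nrm M.theory (Γ.append Δ) .ctx →
        CompLF.Derives nrm M.theory Γ (.sp ts Δ)) :=
  ⟨fun _ _ h => h.sound hM hwt hsr hΓ, fun _ _ h => h.sound hM hwt hsr hΓ,
    fun _ h => h.sound hM hwt hsr hΓ, fun _ _ h => h.sound hM hwt hsr hΓ⟩
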